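/- **Setting.** Let $K=\mathbb{Q}(q,t)$ and let $\lambda$ be a Young diagram with $n=|\lambda|$ boxes (English notation); the content of a box is $c(\square)=\text{column}-\text{row}$. *Algebras.* $\mathcal{H}_n$ is the $K$-algebra generated by $T_1,\dots,T_{n-1}$ with $(T_i-1)(T_i+t)=0$, $T_iT_{i+1}T_i=T_{i+1}T_iT_{i+1}$, and $T_iT_j=T_jT_i$ for $|i-j|>1$. Put $\bar\theta_1=1$, $\bar\theta_{i+1}=tT_i^{-1}\bar\theta_iT_i^{-1}$, $\bar\varphi_i=(tT_i^{-1})\bar\theta_i-\bar\theta_i(tT_i^{-1})$. The positive affine Hecke algebra $\mathcal{A}_n$ is generated by $T_1,\dots,T_{n-1},\theta_1,\dots,\theta_n$ with the relations of $\mathcal{H}_n$ together with $\theta_i\theta_j=\theta_j\theta_i$, $\theta_{i+1}=tT_i^{-1}\theta_iT_i^{-1}$, and $T_i\theta_j=\theta_jT_i$ for $j\notin\{i,i+1\}$; put $\pi_n=t^{n-1}\theta_1T_1^{-1}\cdots T_{n-1}^{-1}$ (and $\pi_0=1$). Let $\rho_n:\mathcal{A}_n\to\mathcal{H}_n$ be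 the homomorphism $T_i\mapsto T_i$, $\theta_i\mapsto\bar\theta_i$. The positive double affine Hecke algebra $\mathcal{D}_n$ is generated by the $T_i,\theta_i$ and $X_1,\dots,X_n$ with the relations of $\mathcal{A}_n$ together with $X_iX_j=X_jX_i$, $X_{i+1}=tT_i^{-1}X_iT_i^{-1}$, $T_iX_j=X_jT_i$ for $j\notin\{i,i+1\}$, $\pi_nX_i=X_{i+1}\pi_n$ for $1\le i\le n-1$, and $\pi_nX_n=qX_1\pi_n$. *Tableaux.* $\mathrm{RYT}(\lambda)$ is the set of labellings $T:\lambda\to\mathbb{Z}_{\ge0}$ weakly decreasing along rows and columns. $\mathrm{PSYT}(\lambda)$ is the set of labellings $\tau$ of $\lambda$ by formal products $jq^b$ ($1\le j\le n$, $b\ge0$), with each $j$ occurring in exactly one box, strictly increasing along rows and columns for the order $jq^m<kq^\ell$ iff $m>\ell$, or $m=\ell$ and $j<k$. $\mathrm{SYT}(\lambda)\subset\mathrm{PSYT}(\lambda)$ is the set of standard Young tableaux (all exponents $0$). If $\tau(\square)=iq^b$, put $w_\tau(i)=b$, $c_\tau(i)=c(\square)$, and $\mathfrak{p}_\lambda(\tau)(\square)=b$,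 so $\mathfrak{p}_\lambda:\mathrm{PSYT}(\lambda)\to\mathrm{RYT}(\lambda)$. Let $s_i(\tau)$ be $\tau$ with the numbers $i$ and $i+1$ exchanged (exponents stay in their boxes), defined if this lies in $\mathrm{PSYT}(\lambda)$. Write $s_i(\tau)>\tau$ if $s_i(\tau)$ is defined and either $w_\tau(i)<w_\tau(i+1)$, or $w_\tau(i)=w_\tau(i+1)$ and $c_\tau(i)-c_\tau(i+1)>1$. Let $\Psi(\tau)\in\mathrm{PSYT}(\lambda)$ be obtained by replacing $kq^a$ by $(k-1)q^a$ for $k\ge2$ and $1q^a$ by $nq^{a+1}$. *Modules.* Write $\lambda$ also for the $\mathcal{H}_n$-module generated by $\tau\in\mathrm{SYT}(\lambda)$ subject to: $\bar\theta_i\tau=t^{c_\tau(i)}\tau$; $\bar\varphi_i\tau=(t^{c_\tau(i)}-t^{c_\tau(i+1)})s_i(\tau)$ if $s_i(\tau)>\tau$; $T_i\tau=\tau$ if $i,i+1$ are in the same row of $\tau$; $T_i\tau=-t\tau$ if they are in the same column. Let $V_\lambda=\mathrm{Ind}_{\mathcal{A}_n}^{\mathcal{D}_n}\rho_n^*(\lambda)=\mathcal{D}_n\otimes_{\mathcal{A}_n}\rho_n^*(\lambda)$.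 **Statement.** The element $\pi_n$ acts bijectively on $V_\lambda$, and $V_\lambda$ has a $K$-basis $\{F_\tau:\tau\in\mathrm{PSYT}(\lambda)\}$ with the following properties: 1. $\theta_iF_\tau=q^{w_\tau(i)}t^{c_\tau(i)}F_\tau$ for $1\le i\le n$, and the weights $(q^{w_\tau(i)}t^{c_\tau(i)})_{1\le i\le n}$ are distinct for distinct $\tau$; 2. $F_\tau=1\otimes\tau$ if $\tau\in\mathrm{SYT}(\lambda)$; 3. if $s_i(\tau)>\tau$, then $\displaystyle F_{s_i(\tau)}=\Bigl(tT_i^{-1}+\frac{(t-1)q^{w_\tau(i+1)}t^{c_\tau(i+1)}}{q^{w_\tau(i)}t^{c_\tau(i)}-q^{w_\tau(i+1)}t^{c_\tau(i+1)}}\Bigr)F_\tau$; 4. $F_{\Psi(\tau)}=q^{w_\tau(1)}X_n\pi_n^{-1}F_\tau$ (for $n\ge1$). For every basis $(F_\tau)$ of $V_\lambda$ with these properties, and for $T\in\mathrm{RYT}(\lambda)$, the span $U_T=\mathrm{span}_K\{F_\tau:\mathfrak{p}_\lambda(\tau)=T\}$ is an $\mathcal{A}_n$-submodule of $V_\lambda$;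 moreover $$\mathrm{Res}^{\mathcal{D}_n}_{\mathcal{A}_n}V_\lambda=\bigoplus_{T\in\mathrm{RYT}(\lambda)}U_T,$$ and each $U_T$ is an irreducible $\mathcal{A}_n$-module. -/

import Mathlib

open scoped TensorProduct

noncomputable section

namespace MackeyDAHA

/-! ## The ground field and the algebras -/

/-- The field `ℚ(q,t)` of rational functions in two variables. -/
def Kqt : Type := FractionRing (MvPolynomial (Fin 2) ℚ)

instance : Field Kqt := inferInstanceAs (Field (FractionRing (MvPolynomial (Fin 2) ℚ)))

instance : Algebra (MvPolynomial (Fin 2) ℚ) Kqt :=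
  inferInstanceAs (Algebra (MvPolynomial (Fin 2) ℚ) (FractionRing (MvPolynomial (Fin 2) ℚ)))

instance : IsFractionRing (MvPolynomial (Fin 2) ℚ) Kqt :=
  inferInstanceAs
    (IsFractionRing (MvPolynomial (Fin 2) ℚ) (FractionRing (MvPolynomial (Fin 2) ℚ)))

/-- The indeterminate `q`. -/
def q : Kqt := algebraMap (MvPolynomial (Fin 2) ℚ) Kqt (MvPolynomial.X 0)

/-- The indeterminate `t`. -/
def t : Kqt := algebraMap (MvPolynomial (Fin 2) ℚ) Kqt (MvPolynomial.X 1)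

theorem t_ne_zero : t ≠ 0 := by
  unfold t
  rw [Ne, IsFractionRing.to_map_eq_zero_iff]
  exact MvPolynomial.X_ne_zero 1

/-- The position `i`, as an element of `{0, …, n-1}`, for `i` indexing a generator `T_i`.
All indices are shifted by one: `i : Fin (n - 1)` stands for `i + 1 ∈ {1, …, n-1}`. -/
def lo {n : ℕ} (i : Fin (n - 1)) : Fin n := ⟨i.1, by omega⟩

/-- The position `i + 1`, for `i` indexing a generator `T_i`. -/
def hi {n : ℕ} (i : Fin (n - 1)) : Fin n := ⟨i.1 + 1, by omega⟩

section Relations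

variable {R : Type*} [Ring R] [Algebra Kqt R]

/-- The inverse of a solution `x` of `(x - 1)(x + t) = 0`; see `mul_tinv` and `tinv_mul`. -/
def tinv (x : R) : R := t⁻¹ • (x + algebraMap Kqt R (t - 1))

theorem mul_tinv {x : R} (h : (x - 1) * (x + algebraMap Kqt R t) = 0) : x * tinv x = 1 := by
  have h1 : x * (x + algebraMap Kqt R (t - 1)) = algebraMap Kqt R t := by
    have h2 : x * (x + algebraMap Kqt R (t - 1)) - algebraMap Kqt R t
        = (x - 1) * (x + algebraMap Kqt R t) := by
      simp only [map_sub, map_one]; noncomm_ring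
    rw [h] at h2
    exact sub_eq_zero.mp h2
  rw [tinv, mul_smul_comm, h1, Algebra.algebraMap_eq_smul_one, smul_smul,
    inv_mul_cancel₀ t_ne_zero, one_smul]

theorem commute_tinv {x y : R} (h : Commute y x) : Commute y (tinv x) := by
  unfold tinv
  exact (h.add_right (Algebra.commutes _ _).symm).smul_right _

theorem tinv_mul {x : R} (h : (x - 1) * (x + algebraMap Kqt R t) = 0) : tinv x * x = 1 := by
  rw [← (commute_tinv (Commute.refl x)).eq, mul_tinv h]

theorem map_tinv {S : Type*} [Ring S] [Algebra Kqt S] (f : R →ₐ[Kqt] S) (x : R) :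
    f (tinv x) = tinv (f x) := by
  simp [tinv]

/-- The defining relations of the finite Hecke algebra. -/
inductive HeckeRel {n : ℕ} (T : Fin (n - 1) → R) : R → R → Prop
  | quad (i : Fin (n - 1)) : HeckeRel T ((T i - 1) * (T i + algebraMap Kqt R t)) 0
  | braid (i j : Fin (n - 1)) (h : i.1 + 1 = j.1) :
      HeckeRel T (T i * T j * T i) (T j * T i * T j)
  | far (i j : Fin (n - 1)) (h : i.1 + 1 < j.1 ∨ j.1 + 1 < i.1) : HeckeRel T (T i * T j) (T j * T i)

/-- The defining relations of the positive affine Hecke algebra. -/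
inductive AffRel {n : ℕ} (T : Fin (n - 1) → R) (θ : Fin n → R) : R → R → Prop
  | hecke {x y : R} (h : HeckeRel T x y) : AffRel T θ x y
  | comm (i j : Fin n) : AffRel T θ (θ i * θ j) (θ j * θ i)
  | step (i : Fin (n - 1)) :
      AffRel T θ (θ (hi i)) (t • (tinv (T i) * θ (lo i) * tinv (T i)))
  | far (i : Fin (n - 1)) (j : Fin n) (h₁ : j ≠ lo i) (h₂ : j ≠ hi i) :
      AffRel T θ (T i * θ j) (θ j * T i)

/-- `π_n = t^(n-1) θ_1 T_1⁻¹ ⋯ T_(n-1)⁻¹` (and `1` if `n = 0`). -/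
def piElt {n : ℕ} (T : Fin (n - 1) → R) (θ : Fin n → R) : R :=
  if h : 0 < n then t ^ (n - 1) • (θ ⟨0, h⟩ * (List.ofFn fun i => tinv (T i)).prod) else 1

/-- The defining relations of the positive double affine Hecke algebra. -/
inductive DahaRel {n : ℕ} (T : Fin (n - 1) → R) (θ X : Fin n → R) : R → R → Prop
  | aff {x y : R} (h : AffRel T θ x y) : DahaRel T θ X x y
  | comm (i j : Fin n) : DahaRel T θ X (X i * X j) (X j * X i)
  | step (i : Fin (n - 1)) :
      DahaRel T θ X (X (hi i)) (t • (tinv (T i) * X (lo i) * tinv (T i)))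
  | far (i : Fin (n - 1)) (j : Fin n) (h₁ : j ≠ lo i) (h₂ : j ≠ hi i) :
      DahaRel T θ X (T i * X j) (X j * T i)
  | pi (i : Fin (n - 1)) : DahaRel T θ X (piElt T θ * X (lo i)) (X (hi i) * piElt T θ)
  | pi_last (i j : Fin n) (h₁ : i.1 = 0) (h₂ : j.1 + 1 = n) :
      DahaRel T θ X (piElt T θ * X j) (q • (X i * piElt T θ))

theorem HeckeRel.map {S : Type*} [Ring S] [Algebra Kqt S] (f : R →ₐ[Kqt] S) {n : ℕ}
    {T : Fin (n - 1) → R} {x y : R} (h : HeckeRel T x y) :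
    HeckeRel (fun i => f (T i)) (f x) (f y) := by
  cases h with
  | quad i => simpa using HeckeRel.quad (T := fun i => f (T i)) i
  | braid i j h => simpa using HeckeRel.braid (T := fun i => f (T i)) i j h
  | far i j h => simpa using HeckeRel.far (T := fun i => f (T i)) i j h

theorem AffRel.map {S : Type*} [Ring S] [Algebra Kqt S] (f : R →ₐ[Kqt] S) {n : ℕ}
    {T : Fin (n - 1) → R} {θ : Fin n → R} {x y : R} (h : AffRel T θ x y) :
    AffRel (fun i => f (T i)) (fun i => f (θ i)) (f x) (f y) := by
  cases h with
  | hecke h => exact .hecke (h.map f)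
  | comm i j => simpa using AffRel.comm (T := fun i => f (T i)) (θ := fun i => f (θ i)) i j
  | step i =>
    simpa [map_tinv] using AffRel.step (T := fun i => f (T i)) (θ := fun i => f (θ i)) i
  | far i j h₁ h₂ =>
    simpa using AffRel.far (T := fun i => f (T i)) (θ := fun i => f (θ i)) i j h₁ h₂

/-- `θ̄_1 = 1` and `θ̄_(k+1) = t T_k⁻¹ θ̄_k T_k⁻¹`, with indices shifted by one
(the value beyond `n` is not used). -/
def thetaBarAux {n : ℕ} (T : Fin (n - 1) → R) : ℕ → R
  | 0 => 1
  | k + 1 => if h : k < n - 1 then t • (tinv (T ⟨k, h⟩) * thetaBarAux T k * tinv (T ⟨k, h⟩)) else 1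

/-- Any `T` satisfying the Hecke relations: `θ̄_(k+1)` commutes with `T_j` for `j > k + 1`. -/
theorem thetaBarAux_commute_above {n : ℕ} {T : Fin (n - 1) → R}
    (H : ∀ x y, HeckeRel T x y → x = y) (k : ℕ) (j : Fin (n - 1)) (hk : k < j.1) :
    Commute (T j) (thetaBarAux T k) := by
  induction k with
  | zero => exact Commute.one_right _
  | succ k ih =>
    rw [thetaBarAux]
    split_ifs with h
    · have h1 : Commute (T j) (tinv (T ⟨k, h⟩)) :=
        commute_tinv (H _ _ (.far j ⟨k, h⟩ (Or.inr hk)))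
      exact ((h1.mul_right (ih (by omega))).mul_right h1).smul_right _
    · exact Commute.one_right _

theorem braid_tinv {n : ℕ} {T : Fin (n - 1) → R}
    (H : ∀ x y, HeckeRel T x y → x = y) (i j : Fin (n - 1)) (h : i.1 + 1 = j.1) :
    T i * tinv (T j) * tinv (T i) = tinv (T j) * tinv (T i) * T j ∧
      tinv (T i) * tinv (T j) * T i = T j * tinv (T i) * tinv (T j) := by
  have b := H _ _ (.braid i j h)
  have i1 := mul_tinv (H _ _ (.quad i))
  have i2 := tinv_mul (H _ _ (.quad i))
  have j1 := mul_tinv (H _ _ (.quad j))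
  have j2 := tinv_mul (H _ _ (.quad j))
  generalize tinv (T i) = a at *
  generalize tinv (T j) = c at *
  generalize T i = x at *
  generalize T j = y at *
  constructor
  · calc x * c * a = (c * (a * x) * y) * (x * c * a) := by rw [i2, mul_one, j2, one_mul]
      _ = c * a * (x * y * x) * c * a := by noncomm_ring
      _ = c * a * y * (x * (y * c) * a) := by rw [b]; noncomm_ring
      _ = c * a * y := by rw [j1, mul_one, i1, mul_one]
  · calc a * c * x = (a * c * x) * (y * (x * a) * c) := by rw [i1, mul_one, j1, mul_one]
      _ = a * c * (x * y * x) * a * c := by noncomm_ring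
      _ = (a * (c * y) * x) * y * a * c := by rw [b]; noncomm_ring
      _ = y * a * c := by rw [j2, mul_one, i2, one_mul]

/-- `θ̄_(k+1)` commutes with `T_j` for `j < k`. -/
theorem thetaBarAux_commute_below {n : ℕ} {T : Fin (n - 1) → R}
    (H : ∀ x y, HeckeRel T x y → x = y) (k : ℕ) (j : Fin (n - 1)) (hk : j.1 + 1 < k) :
    Commute (T j) (thetaBarAux T k) := by
  induction k with
  | zero => omega
  | succ k ih =>
    rw [thetaBarAux]
    split_ifs with h
    · by_cases hj : j.1 + 1 < k
      · have h1 : Commute (T j) (tinv (T ⟨k, h⟩)) :=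
          commute_tinv (H _ _ (.far j ⟨k, h⟩ (Or.inl hj)))
        exact ((h1.mul_right (ih hj)).mul_right h1).smul_right _
      · obtain rfl : k = j.1 + 1 := by omega
        have hj' : j.1 < n - 1 := j.2
        rw [thetaBarAux, dif_pos hj']
        obtain ⟨b1, b2⟩ := braid_tinv H j ⟨j.1 + 1, h⟩ rfl
        have c := (thetaBarAux_commute_above H j.1 ⟨j.1 + 1, h⟩ (Nat.lt_succ_self _)).eq
        simp only [Fin.eta]
        generalize tinv (T ⟨j.1 + 1, h⟩) = u at *
        generalize T ⟨j.1 + 1, h⟩ = v at *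
        generalize thetaBarAux T j.1 = w at *
        generalize tinv (T j) = a at *
        generalize T j = x at *
        rw [mul_smul_comm, smul_mul_assoc]
        refine Commute.smul_right (Commute.smul_right ?_ _) _
        show x * (u * (a * w * a) * u) = u * (a * w * a) * u * x
        calc x * (u * (a * w * a) * u) = (x * u * a) * w * (a * u) := by noncomm_ring
          _ = u * a * (v * w) * (a * u) := by rw [b1]; noncomm_ring
          _ = u * a * w * (v * a * u) := by rw [c]; noncomm_ring
          _ = u * (a * w * a) * u * x := by rw [← b2]; noncomm_ring
    · exact Commute.one_right _

theorem thetaBarAux_commute_lt {n : ℕ} {T : Fin (n - 1) → R}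
    (H : ∀ x y, HeckeRel T x y → x = y) (k l : ℕ) (hkl : k < l) :
    Commute (thetaBarAux T k) (thetaBarAux T l) := by
  induction k with
  | zero => exact Commute.one_left _
  | succ k ih =>
    rw [thetaBarAux]
    split_ifs with h
    · have h1 : Commute (tinv (T ⟨k, h⟩)) (thetaBarAux T l) :=
        (commute_tinv (thetaBarAux_commute_below H l ⟨k, h⟩ hkl).symm).symm
      exact ((h1.mul_left (ih (by omega))).mul_left h1).smul_left _
    · exact Commute.one_left _

/-- The elements `θ̄_i` satisfy the affine relations. -/
theorem affRel_thetaBarAux {n : ℕ} {T : Fin (n - 1) → R}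
    (H : ∀ x y, HeckeRel T x y → x = y) {x y : R}
    (h : AffRel T (fun i : Fin n => thetaBarAux T i.1) x y) : x = y := by
  cases h with
  | hecke h => exact H _ _ h
  | comm i j =>
    rcases lt_trichotomy i.1 j.1 with h | h | h
    · exact thetaBarAux_commute_lt H _ _ h
    · rw [h]
    · exact (thetaBarAux_commute_lt H _ _ h).symm
  | step i =>
    show thetaBarAux T (i.1 + 1) = _
    rw [thetaBarAux, dif_pos i.2]
    rfl
  | far i j h₁ h₂ =>
    have h₁' : j.1 ≠ i.1 := fun e => h₁ (Fin.ext e)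
    have h₂' : j.1 ≠ i.1 + 1 := fun e => h₂ (Fin.ext e)
    rcases lt_or_gt_of_ne h₁' with h | h
    · exact thetaBarAux_commute_above H _ _ h
    · exact thetaBarAux_commute_below H _ _ (by omega)

end Relations

/-! ### The finite Hecke algebra -/

/-- The finite Hecke algebra `ℋ_n` over `ℚ(q,t)`. -/
def Hecke (n : ℕ) : Type :=
  RingQuot (HeckeRel (FreeAlgebra.ι Kqt : Fin (n - 1) → FreeAlgebra Kqt (Fin (n - 1))))

instance (n : ℕ) : Ring (Hecke n) :=
  inferInstanceAs (Ring (RingQuot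
    (HeckeRel (FreeAlgebra.ι Kqt : Fin (n - 1) → FreeAlgebra Kqt (Fin (n - 1))))))

instance (n : ℕ) : Algebra Kqt (Hecke n) :=
  inferInstanceAs (Algebra Kqt (RingQuot
    (HeckeRel (FreeAlgebra.ι Kqt : Fin (n - 1) → FreeAlgebra Kqt (Fin (n - 1))))))

/-- The quotient map from the free algebra. -/
def Hecke.mk (n : ℕ) : FreeAlgebra Kqt (Fin (n - 1)) →ₐ[Kqt] Hecke n :=
  RingQuot.mkAlgHom Kqt (HeckeRel (FreeAlgebra.ι Kqt))

/-- The generators `T_i` of `ℋ_n`. -/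
def Hecke.T {n : ℕ} (i : Fin (n - 1)) : Hecke n := Hecke.mk n (FreeAlgebra.ι Kqt i)

/-- The elements `θ̄_i` of `ℋ_n`. -/
def Hecke.thetaBar {n : ℕ} (i : Fin n) : Hecke n := thetaBarAux Hecke.T i.1

/-- `φ̄_i = (t T_i⁻¹) θ̄_i - θ̄_i (t T_i⁻¹)`. -/
def Hecke.phiBar {n : ℕ} (i : Fin (n - 1)) : Hecke n :=
  (t • tinv (Hecke.T i)) * Hecke.thetaBar (lo i) - Hecke.thetaBar (lo i) * (t • tinv (Hecke.T i))

theorem Hecke.rel {n : ℕ} (x y : Hecke n) (h : HeckeRel (Hecke.T (n := n)) x y) : x = y := by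
  have key : ∀ {a b : FreeAlgebra Kqt (Fin (n - 1))}, HeckeRel (FreeAlgebra.ι Kqt) a b →
      Hecke.mk n a = Hecke.mk n b := fun h => RingQuot.mkAlgHom_rel Kqt h
  cases h with
  | quad i => simpa [Hecke.T] using key (.quad i)
  | braid i j h => simpa [Hecke.T] using key (.braid i j h)
  | far i j h => simpa [Hecke.T] using key (.far i j h)

/-! ### The positive affine Hecke algebra -/

/-- The generators of `𝒜_n`. -/
inductive AffGen (n : ℕ) : Type
  | T (i : Fin (n - 1))
  | θ (i : Fin n)

/-- The defining relations of `𝒜_n` in the free algebra. -/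
abbrev affRel (n : ℕ) : FreeAlgebra Kqt (AffGen n) → FreeAlgebra Kqt (AffGen n) → Prop :=
  AffRel (fun i => FreeAlgebra.ι Kqt (AffGen.T i)) (fun i => FreeAlgebra.ι Kqt (AffGen.θ i))

/-- The positive affine Hecke algebra `𝒜_n` over `ℚ(q,t)`. -/
def Aff (n : ℕ) : Type := RingQuot (affRel n)

instance (n : ℕ) : Ring (Aff n) := inferInstanceAs (Ring (RingQuot (affRel n)))

instance (n : ℕ) : Algebra Kqt (Aff n) := inferInstanceAs (Algebra Kqt (RingQuot (affRel n)))

/-- The quotient map from the free algebra. -/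
def Aff.mk (n : ℕ) : FreeAlgebra Kqt (AffGen n) →ₐ[Kqt] Aff n :=
  RingQuot.mkAlgHom Kqt (affRel n)

/-- The generators `T_i` of `𝒜_n`. -/
def Aff.T {n : ℕ} (i : Fin (n - 1)) : Aff n := Aff.mk n (FreeAlgebra.ι Kqt (AffGen.T i))

/-- The generators `θ_i` of `𝒜_n`. -/
def Aff.θ {n : ℕ} (i : Fin n) : Aff n := Aff.mk n (FreeAlgebra.ι Kqt (AffGen.θ i))

/-- The element `π_n` of `𝒜_n`. -/
def Aff.pi (n : ℕ) : Aff n := piElt Aff.T Aff.θ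

/-- The algebra homomorphism `ρ_n : 𝒜_n → ℋ_n`, `T_i ↦ T_i`, `θ_i ↦ θ̄_i`. -/
def rho (n : ℕ) : Aff n →ₐ[Kqt] Hecke n :=
  RingQuot.liftAlgHom Kqt ⟨FreeAlgebra.lift Kqt (fun g : AffGen n => match g with
      | .T i => Hecke.T i
      | .θ i => Hecke.thetaBar i), by
    intro x y h
    have h' := h.map (FreeAlgebra.lift Kqt (fun g : AffGen n => match g with
      | .T i => Hecke.T i
      | .θ i => Hecke.thetaBar i))
    simp only [FreeAlgebra.lift_ι_apply] at h'
    exact affRel_thetaBarAux Hecke.rel h'⟩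

theorem rho_T {n : ℕ} (i : Fin (n - 1)) : rho n (Aff.T i) = Hecke.T i := by
  unfold rho Aff.T Aff.mk
  exact (RingQuot.liftAlgHom_mkAlgHom_apply Kqt _ _ _).trans (FreeAlgebra.lift_ι_apply _ _)

theorem rho_θ {n : ℕ} (i : Fin n) : rho n (Aff.θ i) = Hecke.thetaBar i := by
  unfold rho Aff.θ Aff.mk
  exact (RingQuot.liftAlgHom_mkAlgHom_apply Kqt _ _ _).trans (FreeAlgebra.lift_ι_apply _ _)

/-! ### The positive double affine Hecke algebra -/

/-- The generators of `𝒟_n`. -/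
inductive DahaGen (n : ℕ) : Type
  | T (i : Fin (n - 1))
  | θ (i : Fin n)
  | X (i : Fin n)

/-- The defining relations of `𝒟_n` in the free algebra. -/
abbrev dahaRel (n : ℕ) : FreeAlgebra Kqt (DahaGen n) → FreeAlgebra Kqt (DahaGen n) → Prop :=
  DahaRel (fun i => FreeAlgebra.ι Kqt (DahaGen.T i)) (fun i => FreeAlgebra.ι Kqt (DahaGen.θ i))
    (fun i => FreeAlgebra.ι Kqt (DahaGen.X i))

/-- The positive double affine Hecke algebra `𝒟_n` over `ℚ(q,t)`. -/
def Daha (n : ℕ) : Type := RingQuot (dahaRel n)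

instance (n : ℕ) : Ring (Daha n) := inferInstanceAs (Ring (RingQuot (dahaRel n)))

instance (n : ℕ) : Algebra Kqt (Daha n) := inferInstanceAs (Algebra Kqt (RingQuot (dahaRel n)))

/-- The quotient map from the free algebra. -/
def Daha.mk (n : ℕ) : FreeAlgebra Kqt (DahaGen n) →ₐ[Kqt] Daha n :=
  RingQuot.mkAlgHom Kqt (dahaRel n)

/-- The generators `T_i` of `𝒟_n`. -/
def Daha.T {n : ℕ} (i : Fin (n - 1)) : Daha n := Daha.mk n (FreeAlgebra.ι Kqt (DahaGen.T i))

/-- The generators `θ_i` of `𝒟_n`. -/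
def Daha.θ {n : ℕ} (i : Fin n) : Daha n := Daha.mk n (FreeAlgebra.ι Kqt (DahaGen.θ i))

/-- The generators `X_i` of `𝒟_n`. -/
def Daha.X {n : ℕ} (i : Fin n) : Daha n := Daha.mk n (FreeAlgebra.ι Kqt (DahaGen.X i))

/-- The canonical homomorphism `𝒜_n → 𝒟_n`, `T_i ↦ T_i`, `θ_i ↦ θ_i`. -/
def incl (n : ℕ) : Aff n →ₐ[Kqt] Daha n :=
  RingQuot.liftAlgHom Kqt ⟨(Daha.mk n).comp (FreeAlgebra.lift Kqt (fun g : AffGen n => match g with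
      | .T i => FreeAlgebra.ι Kqt (DahaGen.T i)
      | .θ i => FreeAlgebra.ι Kqt (DahaGen.θ i))), by
    intro x y h
    have h' := h.map (FreeAlgebra.lift Kqt (fun g : AffGen n => match g with
      | .T i => FreeAlgebra.ι Kqt (DahaGen.T i)
      | .θ i => FreeAlgebra.ι Kqt (DahaGen.θ i)))
    simp only [FreeAlgebra.lift_ι_apply] at h'
    exact RingQuot.mkAlgHom_rel Kqt (DahaRel.aff h')⟩

theorem incl_T {n : ℕ} (i : Fin (n - 1)) : incl n (Aff.T i) = Daha.T i := by
  unfold incl Aff.T Aff.mk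
  refine (RingQuot.liftAlgHom_mkAlgHom_apply Kqt _ _ _).trans ?_
  rw [AlgHom.comp_apply, FreeAlgebra.lift_ι_apply]
  rfl

theorem incl_θ {n : ℕ} (i : Fin n) : incl n (Aff.θ i) = Daha.θ i := by
  unfold incl Aff.θ Aff.mk
  refine (RingQuot.liftAlgHom_mkAlgHom_apply Kqt _ _ _).trans ?_
  rw [AlgHom.comp_apply, FreeAlgebra.lift_ι_apply]
  rfl

/-! ## Labellings of Young diagrams -/

/-- The boxes `(row, column)` of a Young diagram in English notation. -/
abbrev Box (lam : YoungDiagram) : Type := {b : ℕ × ℕ // b ∈ lam.cells}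

/-- The content (column minus row) of a box. -/
def content {lam : YoungDiagram} (b : Box lam) : ℤ := (b.1.2 : ℤ) - (b.1.1 : ℤ)

/-- The box `b` comes strictly before `b'` in the same row or in the same column. -/
def Before {lam : YoungDiagram} (b b' : Box lam) : Prop :=
  (b.1.1 = b'.1.1 ∧ b.1.2 < b'.1.2) ∨ (b.1.2 = b'.1.2 ∧ b.1.1 < b'.1.1)

/-- The order on the labels: the pair `(j, m)` stands for the formal product `(j+1) q^m`, and
`j q^m < k q^l` if `m > l`, or `m = l` and `j < k`. -/
def LabelLt {n : ℕ} (x y : Fin n × ℕ) : Prop := y.2 < x.2 ∨ (x.2 = y.2 ∧ x.1 < y.1)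

/-- Non-negative reverse Young tableaux. -/
@[ext]
structure RYT (lam : YoungDiagram) where
  /-- the labelling -/
  toFun : Box lam → ℕ
  anti : ∀ b b', Before b b' → toFun b' ≤ toFun b

/-- Standard Young tableaux. The labels `1, …, n` are shifted to `0, …, n-1`. -/
@[ext]
structure SYT (lam : YoungDiagram) where
  /-- the labelling -/
  toFun : Box lam → Fin lam.card
  bij : Function.Bijective toFun
  mono : ∀ b b', Before b b' → toFun b < toFun b'

/-- Non-negative periodic standard Young tableaux; the pair `(j, m)` stands for the label
`(j+1) q^m`. -/
@[ext]
structure PSYT (lam : YoungDiagram) where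
  /-- the labelling -/
  toFun : Box lam → Fin lam.card × ℕ
  bij : Function.Bijective fun b => (toFun b).1
  mono : ∀ b b', Before b b' → LabelLt (toFun b) (toFun b')

instance (lam : YoungDiagram) : DecidableEq (RYT lam) := Classical.decEq _

/-- The inclusion of standard into periodic standard Young tableaux. -/
def SYT.toPSYT {lam : YoungDiagram} (τ : SYT lam) : PSYT lam where
  toFun b := (τ.toFun b, 0)
  bij := τ.bij
  mono b b' h := Or.inr ⟨rfl, τ.mono b b' h⟩

namespace PSYT

variable {lam : YoungDiagram}

/-- The box of `τ` with label `i q^b` for some `b`. -/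
def box (τ : PSYT lam) (i : Fin lam.card) : Box lam := (Equiv.ofBijective _ τ.bij).symm i

/-- `w_τ(i) = b` if `i q^b` is a label of `τ`. -/
def w (τ : PSYT lam) (i : Fin lam.card) : ℕ := (τ.toFun (τ.box i)).2

/-- `c_τ(i)` is the content of the box of `τ` with label `i q^b` for some `b`. -/
def c (τ : PSYT lam) (i : Fin lam.card) : ℤ := content (τ.box i)

/-- The weight `q^(w_τ(i)) t^(c_τ(i))`. -/
def weight (τ : PSYT lam) (i : Fin lam.card) : Kqt := q ^ τ.w i * t ^ τ.c i

/-- `s_i(τ)` is defined and equal to `τ'`. -/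
def IsSwap (i : Fin (lam.card - 1)) (τ τ' : PSYT lam) : Prop :=
  ∀ b, τ'.toFun b = (Equiv.swap (lo i) (hi i) (τ.toFun b).1, (τ.toFun b).2)

/-- `s_i(τ)` is defined, equal to `τ'`, and larger than `τ`. -/
def SwapUp (i : Fin (lam.card - 1)) (τ τ' : PSYT lam) : Prop :=
  IsSwap i τ τ' ∧ (τ.w (lo i) < τ.w (hi i) ∨
    (τ.w (lo i) = τ.w (hi i) ∧ 1 < τ.c (lo i) - τ.c (hi i)))

/-- The effect of `Ψ` on labels: `k q^a ↦ (k-1) q^a` for `k ≥ 2`, and `1 q^a ↦ n q^(a+1)`. -/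
def psiLabel {n : ℕ} (x : Fin n × ℕ) : Fin n × ℕ :=
  if x.1.1 = 0 then (⟨n - 1, by have := x.1.2; omega⟩, x.2 + 1)
  else (⟨x.1.1 - 1, by have := x.1.2; omega⟩, x.2)

/-- The map `Ψ`. -/
def psi (τ : PSYT lam) : PSYT lam where
  toFun b := psiLabel (τ.toFun b)
  bij := by
    have h : Function.Injective (fun k : Fin lam.card => (psiLabel (k, 0)).1) := by
      intro x y h
      simp only [psiLabel] at h
      have hx := x.2
      have hy := y.2
      split_ifs at h <;> simp only [Fin.mk.injEq] at h <;> apply Fin.ext <;> omega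
    have h2 := (Finite.injective_iff_bijective.mp h).comp τ.bij
    convert h2 using 1
    funext b
    simp only [psiLabel, Function.comp]
    split_ifs <;> rfl
  mono b b' hb := by
    have h := τ.mono b b' hb
    have hne : (τ.toFun b).1 ≠ (τ.toFun b').1 := by
      intro e
      have := τ.bij.1 e
      subst this
      rcases hb with hb | hb <;> omega
    have hne' : (τ.toFun b).1.1 ≠ (τ.toFun b').1.1 := fun e => hne (Fin.ext e)
    simp only [LabelLt, psiLabel, Fin.lt_def] at h ⊢
    have h1 := (τ.toFun b).1.2
    have h2 := (τ.toFun b').1.2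
    split_ifs <;> simp only <;> omega

/-- The map `𝔭_λ : PSYT(λ) → RYT(λ)`. -/
def toRYT (τ : PSYT lam) : RYT lam where
  toFun b := (τ.toFun b).2
  anti b b' h := by
    rcases τ.mono b b' h with h | h
    · exact h.le
    · exact h.1.ge

end PSYT

/-! ## The modules -/

/-- The defining relations of the irreducible `ℋ_n`-module attached to `λ`, in the free
`ℋ_n`-module on the standard Young tableaux of shape `λ`. -/
inductive SpechtRel (lam : YoungDiagram) : (SYT lam →₀ Hecke lam.card) →
    (SYT lam →₀ Hecke lam.card) → Prop
  | theta (i : Fin lam.card) (τ : SYT lam) :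
      SpechtRel lam (Hecke.thetaBar i • Finsupp.single τ 1)
        (t ^ τ.toPSYT.c i • Finsupp.single τ 1)
  | phi (i : Fin (lam.card - 1)) (τ τ' : SYT lam) (h : PSYT.SwapUp i τ.toPSYT τ'.toPSYT) :
      SpechtRel lam (Hecke.phiBar i • Finsupp.single τ 1)
        ((t ^ τ.toPSYT.c (lo i) - t ^ τ.toPSYT.c (hi i)) • Finsupp.single τ' 1)
  | row (i : Fin (lam.card - 1)) (τ : SYT lam)
      (h : (τ.toPSYT.box (lo i)).1.1 = (τ.toPSYT.box (hi i)).1.1) :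
      SpechtRel lam (Hecke.T i • Finsupp.single τ 1) (Finsupp.single τ 1)
  | col (i : Fin (lam.card - 1)) (τ : SYT lam)
      (h : (τ.toPSYT.box (lo i)).1.2 = (τ.toPSYT.box (hi i)).1.2) :
      SpechtRel lam (Hecke.T i • Finsupp.single τ 1) ((-t) • Finsupp.single τ 1)

/-- The submodule generated by the relations. -/
abbrev spechtSub (lam : YoungDiagram) :
    Submodule (Hecke lam.card) (SYT lam →₀ Hecke lam.card) :=
  Submodule.span (Hecke lam.card) {z | ∃ x y, SpechtRel lam x y ∧ z = x - y}

/-- The `ℋ_n`-module attached to `λ`: generated by the standard Young tableaux of shape `λ`,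
subject to the relations `SpechtRel`. -/
def Specht (lam : YoungDiagram) : Type := (SYT lam →₀ Hecke lam.card) ⧸ spechtSub lam

instance (lam : YoungDiagram) : AddCommGroup (Specht lam) :=
  inferInstanceAs (AddCommGroup (_ ⧸ spechtSub lam))

instance (lam : YoungDiagram) : Module (Hecke lam.card) (Specht lam) :=
  inferInstanceAs (Module (Hecke lam.card) (_ ⧸ spechtSub lam))

instance (lam : YoungDiagram) : Module Kqt (Specht lam) :=
  inferInstanceAs (Module Kqt (_ ⧸ spechtSub lam))

instance (lam : YoungDiagram) : IsScalarTower Kqt (Hecke lam.card) (Specht lam) :=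
  inferInstanceAs (IsScalarTower Kqt (Hecke lam.card) (_ ⧸ spechtSub lam))

/-- The element of `Specht lam` given by a standard Young tableau. -/
def Specht.vec {lam : YoungDiagram} (τ : SYT lam) : Specht lam :=
  (spechtSub lam).mkQ (Finsupp.single τ 1)

/-- The `𝒜_n`-module `ρ_n^*(λ)`: the pull-back of the `ℋ_n`-module along `ρ_n`. -/
instance (lam : YoungDiagram) : Module (Aff lam.card) (Specht lam) :=
  Module.compHom (Specht lam) (rho lam.card).toRingHom

/-- The `𝒟_n`-submodule of `𝒟_n ⊗_K ρ_n^*(λ)` that makes the tensor product `𝒜_n`-balanced. -/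
abbrev inducedSub (lam : YoungDiagram) :
    Submodule (Daha lam.card) (Daha lam.card ⊗[Kqt] Specht lam) :=
  Submodule.span (Daha lam.card) {z | ∃ (d : Daha lam.card) (a : Aff lam.card) (m : Specht lam),
    z = (d * incl lam.card a) ⊗ₜ[Kqt] m - d ⊗ₜ[Kqt] (a • m)}

/-- The `𝒟_n`-module `V_λ`, induced from the `𝒜_n`-module `ρ_n^*(λ)`, that is, the tensor product
`𝒟_n ⊗_{𝒜_n} ρ_n^*(λ)`. -/
def V (lam : YoungDiagram) : Type := (Daha lam.card ⊗[Kqt] Specht lam) ⧸ inducedSub lam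

instance (lam : YoungDiagram) : AddCommGroup (V lam) :=
  inferInstanceAs (AddCommGroup (_ ⧸ inducedSub lam))

instance (lam : YoungDiagram) : Module (Daha lam.card) (V lam) :=
  inferInstanceAs (Module (Daha lam.card) (_ ⧸ inducedSub lam))

instance (lam : YoungDiagram) : Module Kqt (V lam) :=
  inferInstanceAs (Module Kqt (_ ⧸ inducedSub lam))

instance (lam : YoungDiagram) : IsScalarTower Kqt (Daha lam.card) (V lam) :=
  inferInstanceAs (IsScalarTower Kqt (Daha lam.card) (_ ⧸ inducedSub lam))

/-- The restriction of `V_λ` to `𝒜_n`. -/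
instance (lam : YoungDiagram) : Module (Aff lam.card) (V lam) :=
  Module.compHom (V lam) (incl lam.card).toRingHom

theorem aff_smul_def {lam : YoungDiagram} (a : Aff lam.card) (v : V lam) :
    a • v = incl lam.card a • v := rfl

instance (lam : YoungDiagram) : IsScalarTower Kqt (Aff lam.card) (V lam) where
  smul_assoc k a v := by rw [aff_smul_def, aff_smul_def, map_smul, smul_assoc]

/-- The class `d ⊗ m` in `V_λ`. -/
def V.tmul {lam : YoungDiagram} (d : Daha lam.card) (m : Specht lam) : V lam :=
  (inducedSub lam).mkQ (d ⊗ₜ[Kqt] m)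

/-- The properties that characterise the basis of non-symmetric vector-valued Macdonald
polynomials `F_τ` of `V_λ`. In `psi`, the vector `v` is `π_n⁻¹ F_τ`. -/
structure IsMacdonaldBasis {lam : YoungDiagram} (F : Module.Basis (PSYT lam) Kqt (V lam)) :
    Prop where
  weight : ∀ (τ : PSYT lam) (i : Fin lam.card),
    (Aff.θ i : Aff lam.card) • F τ = τ.weight i • F τ
  weight_injective : Function.Injective (PSYT.weight (lam := lam))
  standard : ∀ τ : SYT lam, F τ.toPSYT = V.tmul 1 (Specht.vec τ)
  swap : ∀ (i : Fin (lam.card - 1)) (τ τ' : PSYT lam), PSYT.SwapUp i τ τ' →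
    F τ' = (t • tinv (Aff.T i : Aff lam.card)) • F τ +
      ((t - 1) * τ.weight (hi i) / (τ.weight (lo i) - τ.weight (hi i))) • F τ
  psi : ∀ (τ : PSYT lam) (i j : Fin lam.card), i.1 = 0 → j.1 + 1 = lam.card →
    ∀ v : V lam, Aff.pi lam.card • v = F τ →
      F τ.psi = q ^ τ.w i • (Daha.X j : Daha lam.card) • v

end MackeyDAHA

end

noncomputable section

namespace MackeyDAHA

/-! ## Combinatorics of periodic standard Young tableaux -/

/-! The module V_λ is identified with an explicit model: the vector space with basis `e τ`, τ ∈
PSYT(λ). There θ_i acts diagonally by the weights, S_i = tT_i⁻¹ acts as an intertwiner I_i minus a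
diagonal operator κ_i, where I_i sends `e τ` to a multiple of `e (sw i τ)`, and Q = X_n π_n⁻¹ sends
`e τ` to q^(-w_τ(1)) times `e τ.psi`. The coefficient of I_i is 1 going up and the full value of
I_i² going down; for consecutive numbers it vanishes exactly when their boxes are neighbours with
equal exponents, that is, when the exchange is not defined.

The relations between the θ_i, S_i and Q, collected in `IntertwinerData`, reduce to rational
identities in at most three weights (`kap_identity₁` to `kap_identity₃`) and to the way the s_i and
Ψ compose. From these, `IntertwinerData.dahaRel` deduces every relation of 𝒟_n by pure algebra, with
X_1 = q⁻¹ π Q and the other X_i obtained from it by conjugation with the S_i.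

In degree 0 the model satisfies the relations of the ℋ_n-module λ, which gives a map `Model.ofV`
from V_λ. It is onto because s_i and Ψ produce all tableaux from the standard ones
(`PSYT.induction_sw_psi`). It is injective by a count: the vectors X^α (1 ⊗ σ) span V_λ
(`V.monSpan_eq_top`), and the pairs (α, σ) embed into PSYT(λ) with |α| equal to the sum of the
exponents (`PSYT.ofExponents`). So the model maps onto V_λ, and the composite with `Model.ofV` is a
surjective graded endomorphism with finite-dimensional pieces, hence bijective. Neither a basis of
𝒟_n nor the dimension of λ has to be known beforehand.

For the decomposition, q and t are independent and a tableau is determined by the exponents and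
contents of its numbers (`PSYT.d_injective`), so the joint spectrum of the θ_i is simple. Hence any
admissible F_τ is a multiple of the vector of τ, and every θ-stable subspace is spanned by basis
vectors. The exchanges keep the exponents in their boxes, so each U_T is a submodule; it is
irreducible because exchanges with nonzero coefficients connect all tableaux with the same exponents
(`PSYT.induction_sw`). -/

theorem LabelLt.trans {n : ℕ} {x y z : Fin n × ℕ} (h₁ : LabelLt x y) (h₂ : LabelLt y z) :
    LabelLt x z := by
  simp only [LabelLt, Fin.lt_def] at *; omega

theorem LabelLt.irrefl {n : ℕ} (x : Fin n × ℕ) : ¬ LabelLt x x := by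
  simp only [LabelLt, Fin.lt_def]; omega

/-- Two labels with data `(exponent, content)` that cannot be exchanged. -/
def Adj (x y : ℕ × ℤ) : Prop := x.1 = y.1 ∧ |x.2 - y.2| ≤ 1

/-- Exchanging two labels with data `(exponent, content)` leads to a larger tableau. -/
def Up (x y : ℕ × ℤ) : Prop := x.1 < y.1 ∨ (x.1 = y.1 ∧ 1 < x.2 - y.2)

theorem Adj.symm {x y : ℕ × ℤ} (h : Adj x y) : Adj y x :=
  ⟨h.1.symm, by rw [abs_sub_comm]; exact h.2⟩

theorem Up.not_adj {x y : ℕ × ℤ} (h : Up x y) : ¬ Adj x y := by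
  rintro ⟨h1, h2⟩
  rw [abs_le] at h2
  rcases h with h | h <;> omega

theorem Up.asymm {x y : ℕ × ℤ} (h : Up x y) : ¬ Up y x := by
  simp only [Up] at *; omega

theorem up_or_up_of_not_adj {x y : ℕ × ℤ} (h : ¬ Adj x y) : Up x y ∨ Up y x := by
  simp only [Up, Adj, abs_le] at *
  omega

theorem lo_ne_hi {n : ℕ} (i : Fin (n - 1)) : (lo i : Fin n) ≠ hi i := by
  simp [lo, hi]

namespace PSYT

variable {lam : YoungDiagram}

theorem toFun_box (τ : PSYT lam) (i : Fin lam.card) : τ.toFun (τ.box i) = (i, τ.w i) := by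
  have h : (τ.toFun (τ.box i)).1 = i := (Equiv.ofBijective _ τ.bij).apply_symm_apply i
  exact Prod.ext h rfl

theorem box_fst (τ : PSYT lam) (b : Box lam) : τ.box (τ.toFun b).1 = b :=
  (Equiv.ofBijective _ τ.bij).symm_apply_apply b

theorem box_injective (τ : PSYT lam) : Function.Injective τ.box :=
  (Equiv.ofBijective _ τ.bij).symm.injective

/-- The pair of the exponent and the content of the label with number `i`. -/
def d (τ : PSYT lam) (i : Fin lam.card) : ℕ × ℤ := (τ.w i, τ.c i)

theorem box_eq_of_toFun {τ : PSYT lam} {b : Box lam} {i : Fin lam.card} {m : ℕ}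
    (h : τ.toFun b = (i, m)) : τ.box i = b := by
  have := τ.box_fst b
  rwa [h] at this

theorem w_eq_of_toFun {τ : PSYT lam} {b : Box lam} {i : Fin lam.card} {m : ℕ}
    (h : τ.toFun b = (i, m)) : τ.w i = m := by
  rw [w, box_eq_of_toFun h, h]

theorem d_eq_of_toFun {τ : PSYT lam} {b : Box lam} {i : Fin lam.card} {m : ℕ}
    (h : τ.toFun b = (i, m)) : τ.d i = (m, content b) := by
  rw [d, c, w_eq_of_toFun h, box_eq_of_toFun h]

theorem mem_of_le {b : Box lam} {r c : ℕ} (hr : r ≤ b.1.1) (hc : c ≤ b.1.2) :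
    (r, c) ∈ lam.cells :=
  lam.isLowerSet (show ((r, c) : ℕ × ℕ) ≤ b.1 from ⟨hr, hc⟩) b.2

/-- Boxes in no common row or column are linked through the corner in the row of `b` and the column
of `b'`, which belongs to the diagram. -/
theorem labelLt_of_le (τ : PSYT lam) {b b' : Box lam} (hr : b.1.1 ≤ b'.1.1)
    (hc : b.1.2 ≤ b'.1.2) (hne : b ≠ b') : LabelLt (τ.toFun b) (τ.toFun b') := by
  have hne' : ¬ (b.1.1 = b'.1.1 ∧ b.1.2 = b'.1.2) :=
    fun h => hne (Subtype.ext (Prod.ext h.1 h.2))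
  by_cases h1 : b.1.1 = b'.1.1
  · exact τ.mono _ _ (Or.inl ⟨h1, by omega⟩)
  by_cases h2 : b.1.2 = b'.1.2
  · exact τ.mono _ _ (Or.inr ⟨h2, by omega⟩)
  · let m : Box lam := ⟨(b.1.1, b'.1.2), mem_of_le (b := b') hr le_rfl⟩
    exact (τ.mono b m (Or.inl ⟨rfl, show b.1.2 < b'.1.2 by omega⟩)).trans
      (τ.mono m b' (Or.inr ⟨rfl, show b.1.1 < b'.1.1 by omega⟩))

/-- No label lies strictly between two consecutive numbers with the same exponent, so the rectangle
spanned by their boxes holds no third box. -/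
theorem eq_or_eq_of_between (τ : PSYT lam) (i : Fin (lam.card - 1))
    (hw : τ.w (lo i) = τ.w (hi i)) (m : Box lam)
    (h1 : (τ.box (lo i)).1.1 ≤ m.1.1) (h2 : (τ.box (lo i)).1.2 ≤ m.1.2)
    (h3 : m.1.1 ≤ (τ.box (hi i)).1.1) (h4 : m.1.2 ≤ (τ.box (hi i)).1.2) :
    m = τ.box (lo i) ∨ m = τ.box (hi i) := by
  by_contra! h
  have a := τ.labelLt_of_le h1 h2 h.1.symm
  have b := τ.labelLt_of_le h3 h4 h.2
  rw [toFun_box] at a b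
  simp only [LabelLt, Fin.lt_def, lo, hi] at *
  omega

/-- The possible positions of two boxes with consecutive numbers and the same exponent. -/
theorem consecutive_cases (τ : PSYT lam) (i : Fin (lam.card - 1))
    (hw : τ.w (lo i) = τ.w (hi i)) :
    ((τ.box (hi i)).1.1 = (τ.box (lo i)).1.1 ∧ (τ.box (hi i)).1.2 = (τ.box (lo i)).1.2 + 1) ∨
    ((τ.box (hi i)).1.2 = (τ.box (lo i)).1.2 ∧ (τ.box (hi i)).1.1 = (τ.box (lo i)).1.1 + 1) ∨
    ((τ.box (lo i)).1.1 < (τ.box (hi i)).1.1 ∧ (τ.box (hi i)).1.2 < (τ.box (lo i)).1.2) ∨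
    ((τ.box (hi i)).1.1 < (τ.box (lo i)).1.1 ∧ (τ.box (lo i)).1.2 < (τ.box (hi i)).1.2) := by
  have hne : τ.box (lo i) ≠ τ.box (hi i) := fun h => lo_ne_hi i (τ.box_injective h)
  have hlt : LabelLt (τ.toFun (τ.box (lo i))) (τ.toFun (τ.box (hi i))) := by
    rw [toFun_box, toFun_box]; exact Or.inr ⟨hw, by simp [lo, hi, Fin.lt_def]⟩
  have btw := τ.eq_or_eq_of_between i hw
  have anti : ¬ ((τ.box (hi i)).1.1 ≤ (τ.box (lo i)).1.1 ∧
      (τ.box (hi i)).1.2 ≤ (τ.box (lo i)).1.2) := fun h =>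
    LabelLt.irrefl _ (hlt.trans (τ.labelLt_of_le h.1 h.2 hne.symm))
  generalize τ.box (lo i) = b at *
  generalize τ.box (hi i) = b' at *
  have key : b.1.1 ≤ b'.1.1 → b.1.2 ≤ b'.1.2 → ∀ r c, b.1.1 ≤ r → b.1.2 ≤ c → r ≤ b'.1.1 →
      c ≤ b'.1.2 → (r = b.1.1 ∧ c = b.1.2) ∨ (r = b'.1.1 ∧ c = b'.1.2) := by
    intro _ _ r c h1 h2 h3 h4
    rcases btw ⟨(r, c), mem_of_le (b := b') h3 h4⟩ h1 h2 h3 h4 with h | h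
    · rw [← h]; exact Or.inl ⟨rfl, rfl⟩
    · rw [← h]; exact Or.inr ⟨rfl, rfl⟩
  -- Three test boxes of the rectangle: the corner forces a common row or column, and then the right
  -- or lower neighbour of the first box has to be the second box.
  have k1 := fun h1 h2 => key h1 h2 b.1.1 b'.1.2 le_rfl h2 h1 le_rfl
  have k2 := fun h1 h2 h3 => key h1 h2 b.1.1 (b.1.2 + 1) le_rfl (by omega) h1 h3
  have k3 := fun h1 h2 h3 => key h1 h2 (b.1.1 + 1) b.1.2 (by omega) le_rfl h3 h2
  clear key btw hlt hne
  generalize b.1.1 = r at *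
  generalize b.1.2 = c at *
  generalize b'.1.1 = r' at *
  generalize b'.1.2 = c' at *
  clear hw
  by_cases h1 : r ≤ r'
  · by_cases h2 : c ≤ c'
    · have := k1 h1 h2
      by_cases h3 : c + 1 ≤ c'
      · have := k2 h1 h2 h3; omega
      · by_cases h4 : r + 1 ≤ r'
        · have := k3 h1 h2 h4; omega
        · omega
    · omega
  · omega

/-- In the two other positions allowed by `consecutive_cases` the contents differ by at least 2. -/
theorem adj_iff (τ : PSYT lam) (i : Fin (lam.card - 1)) :
    Adj (τ.d (lo i)) (τ.d (hi i)) ↔ τ.w (lo i) = τ.w (hi i) ∧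
      (((τ.box (hi i)).1.1 = (τ.box (lo i)).1.1 ∧ (τ.box (hi i)).1.2 = (τ.box (lo i)).1.2 + 1) ∨
      ((τ.box (hi i)).1.2 = (τ.box (lo i)).1.2 ∧
        (τ.box (hi i)).1.1 = (τ.box (lo i)).1.1 + 1)) := by
  constructor
  · intro h
    refine ⟨h.1, ?_⟩
    have h2 := h.2
    have h3 := τ.consecutive_cases i h.1
    simp only [d, c, content, abs_le] at h2
    omega
  · rintro ⟨hw, h⟩
    refine ⟨hw, ?_⟩
    simp only [d, c, content, abs_le]
    omega

/-- Two boxes on one diagonal with equal exponents span a rectangle whose other two corners carry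
distinct numbers strictly between theirs, so the numbers differ by at least 3. This keeps the
denominators for i, i+1, i+2 nonzero in the braid relation. -/
theorem d_ne_of_close (τ : PSYT lam) {i j : Fin lam.card} (h₁ : i.1 < j.1)
    (h₂ : j.1 < i.1 + 3) : τ.d i ≠ τ.d j := by
  intro h
  obtain ⟨hw, hc⟩ : τ.w i = τ.w j ∧ τ.c i = τ.c j := by simpa [d] using h
  have hne : τ.box i ≠ τ.box j := fun h => by
    have := τ.box_injective h; subst this; omega
  have hlt : LabelLt (τ.toFun (τ.box i)) (τ.toFun (τ.box j)) := by
    rw [toFun_box, toFun_box]; exact Or.inr ⟨hw, h₁⟩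
  have anti : ¬ ((τ.box j).1.1 ≤ (τ.box i).1.1 ∧ (τ.box j).1.2 ≤ (τ.box i).1.2) := fun h =>
    LabelLt.irrefl _ (hlt.trans (τ.labelLt_of_le h.1 h.2 hne.symm))
  simp only [c, content] at hc
  have e1 := τ.toFun_box i
  have e2 := τ.toFun_box j
  generalize τ.box i = b at *
  generalize τ.box j = b' at *
  have hr : b.1.1 < b'.1.1 := by omega
  have hcol : b.1.2 < b'.1.2 := by omega
  have hm : (b.1.1, b'.1.2) ∈ lam.cells := mem_of_le (b := b') hr.le le_rfl
  have hm' : (b'.1.1, b.1.2) ∈ lam.cells := mem_of_le (b := b') le_rfl hcol.le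
  have l1 := τ.mono b ⟨_, hm⟩ (Or.inl ⟨rfl, hcol⟩)
  have l2 := τ.mono ⟨_, hm⟩ b' (Or.inr ⟨rfl, hr⟩)
  have l3 := τ.mono b ⟨_, hm'⟩ (Or.inr ⟨rfl, hr⟩)
  have l4 := τ.mono ⟨_, hm'⟩ b' (Or.inl ⟨rfl, hcol⟩)
  have hdiff : (τ.toFun ⟨_, hm⟩).1 ≠ (τ.toFun ⟨_, hm'⟩).1 := fun h => by
    have := congrArg (fun x : Box lam => x.1.1) (τ.bij.1 h)
    simp only at this; omega
  have hdiff' := fun h => hdiff (Fin.ext h)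
  simp only [e1, e2, LabelLt, Fin.lt_def] at l1 l2 l3 l4
  omega

/-- `s_i(τ)` if it is defined, and `τ` otherwise. -/
def sw (i : Fin (lam.card - 1)) (τ : PSYT lam) : PSYT lam :=
  open Classical in
  if h : Adj (τ.d (lo i)) (τ.d (hi i)) then τ else
  { toFun := fun b => (Equiv.swap (lo i) (hi i) (τ.toFun b).1, (τ.toFun b).2)
    bij := (Equiv.swap (lo i) (hi i)).bijective.comp τ.bij
    mono := by
      intro b b' hb
      have hl := τ.mono b b' hb
      -- The exchange can only spoil the order of `lo i` and `hi i` with equal exponents; in a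
      -- common row or column their boxes would be neighbours, which `h` excludes.
      have h1 : (τ.toFun b).1 = lo i → (τ.toFun b').1 = hi i →
          (τ.toFun b).2 ≠ (τ.toFun b').2 := by
        intro e1 e2 e3
        have f1 : τ.box (lo i) = b := by rw [← e1, box_fst]
        have f2 : τ.box (hi i) = b' := by rw [← e2, box_fst]
        have hw : τ.w (lo i) = τ.w (hi i) := by rw [w, w, f1, f2, e3]
        have cc := τ.consecutive_cases i hw
        rw [adj_iff] at h
        refine h ⟨hw, ?_⟩
        rw [f1, f2] at cc ⊢
        rcases hb with hb | hb <;> omega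
      generalize τ.toFun b = x at *
      generalize τ.toFun b' = y at *
      obtain ⟨⟨x1, hx⟩, x2⟩ := x
      obtain ⟨⟨y1, hy⟩, y2⟩ := y
      simp only [LabelLt, Equiv.swap_apply_def, lo, hi, Fin.lt_def, Fin.mk.injEq] at *
      split_ifs <;> simp only <;> omega }

theorem sw_of_adj {i : Fin (lam.card - 1)} {τ : PSYT lam} (h : Adj (τ.d (lo i)) (τ.d (hi i))) :
    sw i τ = τ := by rw [sw, dif_pos h]

theorem sw_toFun {i : Fin (lam.card - 1)} {τ : PSYT lam} (h : ¬ Adj (τ.d (lo i)) (τ.d (hi i)))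
    (b : Box lam) :
    (sw i τ).toFun b = (Equiv.swap (lo i) (hi i) (τ.toFun b).1, (τ.toFun b).2) := by
  rw [sw, dif_neg h]

theorem sw_d {i : Fin (lam.card - 1)} {τ : PSYT lam} (h : ¬ Adj (τ.d (lo i)) (τ.d (hi i))) :
    (sw i τ).d = τ.d ∘ Equiv.swap (lo i) (hi i) := by
  funext j
  have := sw_toFun h (τ.box (Equiv.swap (lo i) (hi i) j))
  rw [toFun_box, Equiv.swap_apply_self] at this
  exact d_eq_of_toFun this

theorem sw_sw (i : Fin (lam.card - 1)) (τ : PSYT lam) : sw i (sw i τ) = τ := by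
  by_cases h : Adj (τ.d (lo i)) (τ.d (hi i))
  · rw [sw_of_adj h, sw_of_adj h]
  · have h' : ¬ Adj ((sw i τ).d (lo i)) ((sw i τ).d (hi i)) := by
      rw [sw_d h]
      simpa using fun h' => h (Adj.symm h')
    ext1
    funext b
    rw [sw_toFun h', sw_toFun h]
    simp

theorem eq_sw_of_isSwap {i : Fin (lam.card - 1)} {τ τ' : PSYT lam} (h : IsSwap i τ τ')
    (hn : ¬ Adj (τ.d (lo i)) (τ.d (hi i))) : τ' = sw i τ := by
  ext1
  funext b
  rw [h b, sw_toFun hn]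

/-- Replaces the partial operation s_i, given as a relation, by the total operation `sw`; going up
already excludes adjacency. -/
theorem swapUp_iff {i : Fin (lam.card - 1)} {τ τ' : PSYT lam} :
    SwapUp i τ τ' ↔ Up (τ.d (lo i)) (τ.d (hi i)) ∧ τ' = sw i τ := by
  constructor
  · intro h
    have hu : Up (τ.d (lo i)) (τ.d (hi i)) := h.2
    exact ⟨hu, eq_sw_of_isSwap h.1 hu.not_adj⟩
  · rintro ⟨hu, rfl⟩
    exact ⟨sw_toFun hu.not_adj, hu⟩

theorem sw_toRYT (i : Fin (lam.card - 1)) (τ : PSYT lam) : (sw i τ).toRYT = τ.toRYT := by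
  by_cases h : Adj (τ.d (lo i)) (τ.d (hi i))
  · rw [sw_of_adj h]
  · ext b
    simp [toRYT, sw_toFun h]

theorem psi_d_of_lt (τ : PSYT lam) {i : Fin lam.card} (h : i.1 + 1 < lam.card) :
    τ.psi.d i = τ.d ⟨i.1 + 1, h⟩ := by
  have : τ.psi.toFun (τ.box ⟨i.1 + 1, h⟩) = (i, τ.w ⟨i.1 + 1, h⟩) := by
    show psiLabel _ = _
    rw [toFun_box]; simp [psiLabel]
  exact d_eq_of_toFun this

theorem psi_d_last (τ : PSYT lam) {i : Fin lam.card} (h : ¬ i.1 + 1 < lam.card) :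
    τ.psi.d i = ((τ.d ⟨0, i.pos⟩).1 + 1, (τ.d ⟨0, i.pos⟩).2) := by
  have : τ.psi.toFun (τ.box ⟨0, i.pos⟩) = (i, τ.w ⟨0, i.pos⟩ + 1) := by
    show psiLabel _ = _
    rw [toFun_box]
    simp only [psiLabel, if_true, Prod.mk.injEq, and_true]
    exact Fin.ext (by have := i.2; simp only; omega)
  exact d_eq_of_toFun this

/-- Well-founded induction on labels. If the number i sat in two different boxes of one diagonal,
the upper left one would carry a smaller label in the tableau that puts i in the lower right one; by
induction that smaller label occupies the same box in both tableaux, which is absurd. -/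
theorem d_injective : Function.Injective (PSYT.d (lam := lam)) := by
  intro τ τ' h
  have hw : ∀ i, τ.w i = τ'.w i := fun i => congrArg Prod.fst (congrFun h i)
  have hc : ∀ i, τ.c i = τ'.c i := fun i => congrArg Prod.snd (congrFun h i)
  have key : ∀ i, τ.box i = τ'.box i := by
    let R : Fin lam.card → Fin lam.card → Prop := fun i j => LabelLt (i, τ.w i) (j, τ.w j)
    have : IsTrans _ R := ⟨fun _ _ _ => LabelLt.trans⟩
    have : Std.Irrefl R := ⟨fun _ => LabelLt.irrefl _⟩
    have wf : WellFounded R := Finite.wellFounded_of_trans_of_irrefl R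
    intro i
    induction i using wf.induction with
    | _ i ih =>
      by_contra hne
      have hci := hc i
      simp only [c, content] at hci
      have aux : ∀ σ σ' : PSYT lam, (∀ j, σ.w j = σ'.w j) → (∀ j, R j i → σ.box j = σ'.box j) →
          (∀ j, σ'.w j = τ.w j) → σ.box i ≠ σ'.box i →
          ¬ ((σ.box i).1.1 ≤ (σ'.box i).1.1 ∧ (σ.box i).1.2 ≤ (σ'.box i).1.2) := by
        intro σ σ' hσ ih' hτ hne' ⟨hr, hcol⟩
        have h1 := σ'.labelLt_of_le hr hcol hne'
        rw [toFun_box] at h1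
        set b := σ.box i with hb
        have h2 := σ'.toFun_box (σ'.toFun b).1
        rw [box_fst] at h2
        rw [h2, hτ, hτ] at h1
        have h3 := ih' _ h1
        rw [box_fst, hb] at h3
        have h4 := σ.box_injective h3
        rw [h4] at h1
        exact LabelLt.irrefl _ h1
      have a1 := aux τ τ' hw ih (fun j => (hw j).symm) hne
      have a2 := aux τ' τ (fun j => (hw j).symm) (fun j hj => (ih j hj).symm) (fun j => rfl)
        (Ne.symm hne)
      omega
  ext1
  funext b
  have h1 := τ.toFun_box (τ.toFun b).1
  have h2 := τ'.toFun_box (τ.toFun b).1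
  rw [← key, box_fst] at h2
  rw [box_fst] at h1
  rw [h1, h2, hw]

end PSYT

/-! ### Degree, generation by s_i and Ψ, connectedness, tableaux with prescribed exponents. -/

namespace PSYT

variable {lam : YoungDiagram}

/-- The sum of all exponents. -/
def deg (τ : PSYT lam) : ℕ := ∑ b, (τ.toFun b).2

theorem deg_sw (i : Fin (lam.card - 1)) (τ : PSYT lam) : (sw i τ).deg = τ.deg := by
  have h := sw_toRYT i τ
  have h' : ∀ b, ((sw i τ).toFun b).2 = (τ.toFun b).2 := fun b =>
    congrFun (congrArg RYT.toFun h) b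
  simp only [deg, h']

theorem deg_psi (τ : PSYT lam) (h : 0 < lam.card) : τ.psi.deg = τ.deg + 1 := by
  have h1 : ∀ b, (τ.psi.toFun b).2 =
      (τ.toFun b).2 + if b = τ.box ⟨0, h⟩ then 1 else 0 := by
    intro b
    show (psiLabel _).2 = _
    have hb : b = τ.box ⟨0, h⟩ ↔ (τ.toFun b).1.1 = 0 := by
      constructor
      · rintro rfl; rw [toFun_box]
      · intro e
        rw [← τ.box_fst b]
        exact congrArg _ (Fin.ext e)
    simp only [hb, psiLabel]
    split_ifs <;> rfl
  simp only [deg, h1, Finset.sum_add_distrib]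
  simp

theorem deg_toPSYT (τ : SYT lam) : τ.toPSYT.deg = 0 := by simp [deg, SYT.toPSYT]

theorem exists_toPSYT_eq {τ : PSYT lam} (h : τ.deg = 0) : ∃ σ : SYT lam, σ.toPSYT = τ := by
  have h0 : ∀ b, (τ.toFun b).2 = 0 := by
    simpa [deg, Finset.sum_eq_zero_iff] using h
  refine ⟨⟨fun b => (τ.toFun b).1, τ.bij, fun b b' hb => ?_⟩, ?_⟩
  · have := τ.mono b b' hb
    simp only [LabelLt, h0] at this
    simpa using this
  · ext1
    funext b
    exact Prod.ext rfl (h0 b).symm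

/-- The inverse of the effect of `Ψ` on labels. -/
def psiInvLabel {n : ℕ} (x : Fin n × ℕ) : Fin n × ℕ :=
  if h : x.1.1 + 1 < n then (⟨x.1.1 + 1, h⟩, x.2) else (⟨0, x.1.pos⟩, x.2 - 1)

theorem exists_psi_eq (τ : PSYT lam) {i : Fin lam.card} (hi : ¬ i.1 + 1 < lam.card)
    (hw : 0 < τ.w i) : ∃ σ : PSYT lam, σ.psi = τ := by
  -- Positivity makes the truncated subtraction in `psiInvLabel` a true one.
  have hpos : ∀ b, ¬ (τ.toFun b).1.1 + 1 < lam.card → 0 < (τ.toFun b).2 := by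
    intro b hb
    have e : (τ.toFun b).1 = i := by
      apply Fin.ext
      have := i.2
      have := (τ.toFun b).1.2
      omega
    have := τ.box_fst b
    rw [e] at this
    rwa [w, this] at hw
  have hinj : Function.Injective (fun k : Fin lam.card => (psiInvLabel (k, 0)).1) := by
    intro x y h
    simp only [psiInvLabel] at h
    have hx := x.2
    have hy := y.2
    split_ifs at h <;> simp only [Fin.mk.injEq] at h <;> apply Fin.ext <;> omega
  refine ⟨⟨fun b => psiInvLabel (τ.toFun b), ?_, ?_⟩, ?_⟩
  · have h2 := (Finite.injective_iff_bijective.mp hinj).comp τ.bij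
    convert h2 using 1
    funext b
    simp only [psiInvLabel, Function.comp]
    split_ifs <;> rfl
  · intro b b' hb
    have h := τ.mono b b' hb
    have hne : (τ.toFun b).1 ≠ (τ.toFun b').1 := by
      intro e
      have := τ.bij.1 e
      subst this
      rcases hb with hb | hb <;> omega
    have hne' : (τ.toFun b).1.1 ≠ (τ.toFun b').1.1 := fun e => hne (Fin.ext e)
    have p1 := hpos b
    have p2 := hpos b'
    simp only [LabelLt, psiInvLabel, Fin.lt_def] at h ⊢
    have h1 := (τ.toFun b).1.2
    have h2 := (τ.toFun b').1.2
    split_ifs <;> simp only <;> omega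
  · ext1
    funext b
    show psiLabel (psiInvLabel (τ.toFun b)) = _
    have p1 := hpos b
    have h1 := (τ.toFun b).1.2
    by_cases h : (τ.toFun b).1.1 + 1 < lam.card
    · simp [psiLabel, psiInvLabel, h]
    · have := p1 h
      simp only [psiLabel, psiInvLabel, h, dite_false, if_true]
      refine Prod.ext (Fin.ext ?_) ?_ <;> simp only <;> omega

/-- Every periodic standard Young tableau is obtained from the standard ones by the operations
`s_i` and `Ψ`. -/
theorem induction_sw_psi {P : PSYT lam → Prop} (h₀ : ∀ σ : SYT lam, P σ.toPSYT)
    (h₁ : ∀ i τ, P τ → P (sw i τ)) (h₂ : ∀ τ, P τ → P τ.psi) (τ : PSYT lam) : P τ := by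
  induction hN : τ.deg using Nat.strong_induction_on generalizing τ with
  | _ N ih =>
    rcases Nat.eq_zero_or_pos N with rfl | hpos
    · obtain ⟨σ, rfl⟩ := exists_toPSYT_eq hN
      exact h₀ σ
    -- Here `k` is the distance of `i` from the last number. Exchanges carry a positive exponent to
    -- the last number, where Ψ can be undone and the degree drops by one.
    have main : ∀ (k : ℕ) (σ : PSYT lam) (i : Fin lam.card), i.1 + 1 + k = lam.card → σ.deg = N →
        0 < σ.w i → P σ := by
      intro k
      induction k with
      | zero =>
        intro σ i hi hσ hw
        obtain ⟨ρ, rfl⟩ := exists_psi_eq σ (i := i) (by omega) hw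
        rw [deg_psi _ i.pos] at hσ
        exact h₂ _ (ih ρ.deg (by omega) ρ rfl)
      | succ k ihk =>
        intro σ i hi hσ hw
        let j : Fin (lam.card - 1) := ⟨i.1, by omega⟩
        by_cases hw' : 0 < σ.w (MackeyDAHA.hi j)
        · exact ihk σ _ (by simp only [MackeyDAHA.hi, j]; omega) hσ hw'
        · have hna : ¬ Adj (σ.d (lo j)) (σ.d (MackeyDAHA.hi j)) := by
            intro h
            have : σ.w i = σ.w (MackeyDAHA.hi j) := h.1
            exact hw' (this ▸ hw)
          have hd := congrFun (sw_d hna) (MackeyDAHA.hi j)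
          have hw2 : (sw j σ).w (MackeyDAHA.hi j) = σ.w (lo j) := by
            simpa [d] using congrArg Prod.fst hd
          have := h₁ j _ (ihk (sw j σ) (MackeyDAHA.hi j)
            (by simp only [MackeyDAHA.hi, j]; omega) (by rw [deg_sw, hσ]) (by rw [hw2]; exact hw))
          rwa [sw_sw] at this
    obtain ⟨b, -, hb⟩ : ∃ b ∈ Finset.univ, 0 < (τ.toFun b).2 := by
      by_contra! hcon
      have : τ.deg = 0 := Finset.sum_eq_zero fun b hb => Nat.le_zero.mp (hcon b hb)
      omega
    have hb' : 0 < τ.w (τ.toFun b).1 := by rwa [w, box_fst]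
    have := (τ.toFun b).1.2
    exact main (lam.card - ((τ.toFun b).1.1 + 1)) τ _ (by omega) hN hb'

/-- Two tableaux with the same exponents are connected by operations `s_i`. -/
theorem induction_sw {P : PSYT lam → Prop} (h₁ : ∀ i τ, P τ → P (sw i τ)) {τ τ' : PSYT lam}
    (hτ : τ.toRYT = τ'.toRYT) (h : P τ) : P τ' := by
  classical
  -- Bubble sort: `inv σ` collects the pairs of boxes that σ and τ' number in opposite order, and an
  -- exchange at a descent of the relative permutation `f` below shrinks it.
  let inv : PSYT lam → Finset (Box lam × Box lam) := fun σ =>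
    Finset.univ.filter fun p => (σ.toFun p.1).1 < (σ.toFun p.2).1 ∧
      (τ'.toFun p.2).1 < (τ'.toFun p.1).1
  induction hN : (inv τ).card using Nat.strong_induction_on generalizing τ with
  | _ N ih =>
    have hexp : ∀ b, (τ.toFun b).2 = (τ'.toFun b).2 := fun b =>
      congrFun (congrArg RYT.toFun hτ) b
    let f : Fin lam.card → Fin lam.card := fun i => (τ'.toFun (τ.box i)).1
    have hfb : Function.Bijective f :=
      τ'.bij.comp (Equiv.ofBijective _ τ.bij).symm.bijective
    by_cases hdesc : ∃ i : Fin (lam.card - 1), f (hi i) < f (lo i)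
    · obtain ⟨i, hi'⟩ := hdesc
      have hna : ¬ Adj (τ.d (lo i)) (τ.d (hi i)) := by
        intro ha
        rw [adj_iff] at ha
        have hb : Before (τ.box (lo i)) (τ.box (hi i)) := by
          rcases ha.2 with h | h
          · exact Or.inl ⟨h.1.symm, by omega⟩
          · exact Or.inr ⟨h.1.symm, by omega⟩
        have hm := τ'.mono _ _ hb
        have e := ha.1
        simp only [w, hexp] at e
        simp only [LabelLt, e, lt_irrefl, false_or, true_and] at hm
        exact absurd hm (not_lt.mpr hi'.le)
      refine ih _ ?_ ((sw_toRYT i τ).trans hτ) (h₁ i τ h) rfl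
      rw [← hN]
      apply Finset.card_lt_card
      rw [Finset.ssubset_iff_of_subset]
      · refine ⟨(τ.box (lo i), τ.box (hi i)), ?_, ?_⟩
        · simp only [inv, Finset.mem_filter, Finset.mem_univ, true_and]
          refine ⟨?_, hi'⟩
          rw [toFun_box, toFun_box]
          exact Nat.lt_succ_self i.1
        · simp only [inv, Finset.mem_filter, Finset.mem_univ, true_and, sw_toFun hna]
          rw [toFun_box, toFun_box]
          simp only [Equiv.swap_apply_left, Equiv.swap_apply_right]
          exact fun h => absurd h.1 (not_lt.mpr (Nat.le_succ i.1))
      · rintro ⟨b, b'⟩ hp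
        simp only [inv, Finset.mem_filter, Finset.mem_univ, true_and, sw_toFun hna] at hp ⊢
        refine ⟨?_, hp.2⟩
        have hno : ¬ ((τ.toFun b).1 = hi i ∧ (τ.toFun b').1 = lo i) := by
          rintro ⟨e1, e2⟩
          have g1 := τ.box_fst b
          have g2 := τ.box_fst b'
          rw [e1] at g1
          rw [e2] at g2
          have := hp.2
          rw [← g1, ← g2] at this
          exact absurd this (not_lt.mpr hi'.le)
        replace hp := hp.1
        clear hi' hna hfb hexp
        generalize (τ.toFun b).1 = x at *
        generalize (τ.toFun b').1 = y at *
        obtain ⟨x, hx⟩ := x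
        obtain ⟨y, hy⟩ := y
        simp only [Equiv.swap_apply_def, lo, hi, Fin.lt_def, Fin.mk.injEq] at *
        split_ifs at hp <;> simp only at hp <;> omega
    -- Without a descent `f` is a strictly increasing bijection of a finite chain, hence the
    -- identity, and the tableaux coincide.
    · push Not at hdesc
      have hmono : ∀ (k : ℕ) (i j : Fin lam.card), j.1 = i.1 + 1 + k → f i < f j := by
        intro k
        induction k with
        | zero =>
          intro i j hij
          have h1 := hdesc ⟨i.1, by omega⟩
          have e1 : (lo ⟨i.1, by omega⟩ : Fin lam.card) = i := rfl
          have e2 : (hi ⟨i.1, by omega⟩ : Fin lam.card) = j := Fin.ext hij.symm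
          rw [e1, e2] at h1
          exact lt_of_le_of_ne h1 fun h => by
            have := hfb.1 h; subst this; omega
        | succ k ihk =>
          intro i j hij
          have := j.2
          exact (ihk i ⟨i.1 + 1 + k, by omega⟩ rfl).trans (by
            have h1 := hdesc ⟨i.1 + 1 + k, by omega⟩
            have e2 : (hi ⟨i.1 + 1 + k, by omega⟩ : Fin lam.card) = j :=
              Fin.ext (by simp only [hi]; omega)
            rw [e2] at h1
            exact lt_of_le_of_ne h1 fun h => by
              have := hfb.1 h; rw [Fin.ext_iff] at this; simp only at this; omega)
      have hsm : StrictMono f := fun i j hij => by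
        rw [Fin.lt_def] at hij
        exact hmono (j.1 - i.1 - 1) i j (by omega)
      have hid : f = id := (hsm.range_inj strictMono_id).mp (by
        rw [hfb.2.range_eq]; simp)
      have : τ = τ' := by
        ext1
        funext b
        refine Prod.ext ?_ (hexp b)
        have := congrFun hid (τ.toFun b).1
        simp only [f, box_fst, id] at this
        exact this.symm
      rwa [← this]

/-- The permutation that sorts the labels `(j, α j)` increasingly. -/
def sortPerm {n : ℕ} (α : Fin n → ℕ) : Equiv.Perm (Fin n) :=
  Tuple.sort fun j => toLex (OrderDual.toDual (α j), j)

theorem sortPerm_labelLt {n : ℕ} (α : Fin n → ℕ) {r s : Fin n} (h : r < s) :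
    LabelLt (sortPerm α r, α (sortPerm α r)) (sortPerm α s, α (sortPerm α s)) := by
  have hm := Tuple.monotone_sort (fun j => toLex (OrderDual.toDual (α j), j))
  have h1 := hm h.le
  simp only [Function.comp] at h1
  change toLex (OrderDual.toDual (α (sortPerm α r)), sortPerm α r) ≤
    toLex (OrderDual.toDual (α (sortPerm α s)), sortPerm α s) at h1
  rw [Prod.Lex.toLex_le_toLex] at h1
  have hne : sortPerm α r ≠ sortPerm α s := fun e => h.ne ((sortPerm α).injective e)
  rcases h1 with h1 | h1
  · exact Or.inl h1
  · exact Or.inr ⟨h1.1, lt_of_le_of_ne h1.2 hne⟩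

/-- The tableau with given exponents of the numbers whose standardization is a given standard
tableau. -/
def ofExponents (p : (Fin lam.card → ℕ) × SYT lam) : PSYT lam where
  toFun b := (sortPerm p.1 (p.2.toFun b), p.1 (sortPerm p.1 (p.2.toFun b)))
  bij := (sortPerm p.1).bijective.comp p.2.bij
  mono b b' h := sortPerm_labelLt p.1 (p.2.mono b b' h)

/-- The labels display α, and α determines the sorting permutation, which can then be cancelled. -/
theorem ofExponents_injective : Function.Injective (ofExponents (lam := lam)) := by
  rintro ⟨α, σ⟩ ⟨β, ρ⟩ h
  have hb : ∀ b, (ofExponents (α, σ)).toFun b = (ofExponents (β, ρ)).toFun b := fun b => by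
    rw [h]
  have hαβ : α = β := by
    funext j
    obtain ⟨b, rfl⟩ := (ofExponents (α, σ)).bij.2 j
    have h1 := congrArg Prod.fst (hb b)
    have h2 := congrArg Prod.snd (hb b)
    simp only [ofExponents] at h1 h2 ⊢
    rw [h2, ← h1]
  subst hαβ
  congr 1
  ext1
  funext b
  exact (sortPerm α).injective (congrArg Prod.fst (hb b))

theorem deg_ofExponents (p : (Fin lam.card → ℕ) × SYT lam) :
    (ofExponents p).deg = ∑ i, p.1 i :=
  (Equiv.ofBijective _ (ofExponents p).bij).sum_comp p.1

theorem finite_deg (N : ℕ) : {τ : PSYT lam | τ.deg = N}.Finite := by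
  let g : PSYT lam → (Box lam → Fin lam.card × ℕ) := PSYT.toFun
  have hg : Function.Injective g := fun τ τ' h => PSYT.ext h
  apply Set.Finite.of_finite_image (f := g) _ hg.injOn
  apply (Set.Finite.pi (ι := Box lam) (t := fun _ => (Set.univ ×ˢ Set.Iic N))
    (fun _ => Set.finite_univ.prod (Set.finite_Iic N))).subset
  rintro _ ⟨τ, hτ, rfl⟩ b -
  refine ⟨trivial, ?_⟩
  have : (τ.toFun b).2 ≤ τ.deg :=
    Finset.single_le_sum (f := fun b => (τ.toFun b).2) (fun _ _ => Nat.zero_le _)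
      (Finset.mem_univ b)
  exact this.trans hτ.le

end PSYT

/-! ## Scalars -/

theorem q_ne_zero : q ≠ 0 := by
  unfold q
  rw [Ne, IsFractionRing.to_map_eq_zero_iff]
  exact MvPolynomial.X_ne_zero 0

/-- The weight `q^w t^c` attached to the pair `(w, c)`. -/
def wt (x : ℕ × ℤ) : Kqt := q ^ x.1 * t ^ x.2

theorem wt_ne_zero (x : ℕ × ℤ) : wt x ≠ 0 :=
  mul_ne_zero (pow_ne_zero _ q_ne_zero) (zpow_ne_zero _ t_ne_zero)

theorem monomial_injective {a b m n : ℕ} (h : q ^ a * t ^ m = q ^ b * t ^ n) :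
    a = b ∧ m = n := by
  have h1 : algebraMap (MvPolynomial (Fin 2) ℚ) Kqt (.X 0 ^ a * .X 1 ^ m) =
      algebraMap (MvPolynomial (Fin 2) ℚ) Kqt (.X 0 ^ b * .X 1 ^ n) := by
    rw [map_mul, map_mul, map_pow, map_pow, map_pow, map_pow]
    exact h
  have h2 := IsFractionRing.injective (MvPolynomial (Fin 2) ℚ) Kqt h1
  rw [MvPolynomial.X_pow_eq_monomial, MvPolynomial.X_pow_eq_monomial,
    MvPolynomial.X_pow_eq_monomial, MvPolynomial.X_pow_eq_monomial, MvPolynomial.monomial_mul,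
    MvPolynomial.monomial_mul, mul_one] at h2
  have h3 := MvPolynomial.monomial_left_injective (one_ne_zero) h2
  constructor
  · simpa using DFunLike.congr_fun h3 0
  · simpa using DFunLike.congr_fun h3 1

theorem wt_injective : Function.Injective wt := by
  rintro ⟨a, m⟩ ⟨b, n⟩ h
  simp only [wt] at h
  -- Adding |m| + |n| to both exponents of t makes them natural numbers.
  have h1 : q ^ a * t ^ (m + |m| + |n|).toNat = q ^ b * t ^ (n + |m| + |n|).toNat := by
    have hm : ((m + |m| + |n|).toNat : ℤ) = m + |m| + |n| :=
      Int.toNat_of_nonneg (by have := neg_abs_le m; have := abs_nonneg n; omega)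
    have hn : ((n + |m| + |n|).toNat : ℤ) = n + |m| + |n| :=
      Int.toNat_of_nonneg (by have := neg_abs_le n; have := abs_nonneg m; omega)
    rw [← zpow_natCast t, ← zpow_natCast t, hm, hn]
    simp only [zpow_add₀ t_ne_zero]
    linear_combination (t ^ |m| * t ^ |n|) * h
  obtain ⟨h2, h3⟩ := monomial_injective h1
  have := neg_abs_le m
  have := neg_abs_le n
  have := abs_nonneg m
  have := abs_nonneg n
  exact Prod.ext h2 (by simp only; omega)

theorem wt_sub_ne_zero {x y : ℕ × ℤ} (h : x ≠ y) : wt x - wt y ≠ 0 :=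
  sub_ne_zero.mpr fun e => h (wt_injective e)

/-- The coefficient `(t - 1) b / (a - b)`. -/
def kap (x y : ℕ × ℤ) : Kqt := (t - 1) * wt y / (wt x - wt y)

/-- The scalar by which the square of an intertwiner acts. -/
def interSq (x y : ℕ × ℤ) : Kqt :=
  (t * wt x - wt y) * (wt x - t * wt y) / (wt x - wt y) ^ 2

/-- The coefficient of an intertwiner. -/
def gam (x y : ℕ × ℤ) : Kqt :=
  open Classical in if Up x y then 1 else interSq x y

/-- For S = I - κ, with I exchanging the two weights, the coefficient of I in S² is minus this sum;
the quadratic relation S² = (t-1)S + t requires it to be t - 1. -/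
theorem kap_add_kap {x y : ℕ × ℤ} (h : x ≠ y) : kap x y + kap y x = -(t - 1) := by
  have h1 := wt_sub_ne_zero h
  have h2 := wt_sub_ne_zero h.symm
  simp only [kap]
  field_simp
  ring

/-- This is the value of I² forced by the diagonal part of S² = (t-1)S + t. -/
theorem interSq_eq {x y : ℕ × ℤ} (h : x ≠ y) : interSq x y = t + kap x y * kap y x := by
  have h1 := wt_sub_ne_zero h
  have h2 := wt_sub_ne_zero h.symm
  simp only [kap, interSq]
  field_simp
  ring

theorem interSq_comm (x y : ℕ × ℤ) : interSq x y = interSq y x := by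
  simp only [interSq]
  rw [← neg_sub (wt x) (wt y), neg_sq]
  ring

/-- Cancels the coefficient of I in S_i θ_i S_i = t θ_(i+1). -/
theorem kap_mul_wt {x y : ℕ × ℤ} (h : x ≠ y) :
    kap x y * wt x + kap y x * wt y = 0 := by
  have h1 := wt_sub_ne_zero h
  have h2 := wt_sub_ne_zero h.symm
  simp only [kap]
  field_simp
  ring

/-- This identity and the next two compare the coefficients of I_i, I_j and the identity in the
braid relation at the weights x, y, z. -/
theorem kap_identity₁ {x y z : ℕ × ℤ} (h : x ≠ y) (h' : y ≠ z) (h'' : x ≠ z) :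
    kap x y * kap y z + kap x z * kap y x = kap y z * kap x z := by
  have h1 := wt_sub_ne_zero h
  have h2 := wt_sub_ne_zero h.symm
  have h3 := wt_sub_ne_zero h'
  have h4 := wt_sub_ne_zero h''
  simp only [kap]
  field_simp
  ring

theorem kap_identity₂ {x y z : ℕ × ℤ} (h : x ≠ y) (h' : y ≠ z) (h'' : x ≠ z) :
    kap x y * kap x z = kap y z * kap x y + kap x z * kap z y := by
  have h1 := wt_sub_ne_zero h
  have h2 := wt_sub_ne_zero h'.symm
  have h3 := wt_sub_ne_zero h'
  have h4 := wt_sub_ne_zero h''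
  simp only [kap]
  field_simp
  ring

theorem kap_identity₃ {x y z : ℕ × ℤ} (h : x ≠ y) (h' : y ≠ z) (h'' : x ≠ z) :
    kap x y * kap y z * kap x y + kap x z * interSq x y =
      kap y z * kap x y * kap y z + kap x z * interSq y z := by
  have k1 := kap_identity₁ h h' h''
  have k2 := kap_identity₂ h h' h''
  rw [interSq_eq h, interSq_eq h']
  linear_combination kap x y * k1 + kap y z * k2

/-- Multiplying a weight by t raises its content by one, so a factor of the numerator can vanish
only for equal exponents and contents that differ by one. -/
theorem interSq_ne_zero {x y : ℕ × ℤ} (h : ¬ Adj x y) : interSq x y ≠ 0 := by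
  have key : ∀ {x y : ℕ × ℤ}, ¬ Adj x y → t * wt x - wt y ≠ 0 := by
    intro x y h h0
    have e : wt (x.1, x.2 + 1) = wt y := by
      rw [← sub_eq_zero, ← h0]
      simp only [wt, zpow_add₀ t_ne_zero, zpow_one]
      ring
    have e' := wt_injective e
    apply h
    rw [← e']
    simp [Adj]
  have hne : x ≠ y := by rintro rfl; exact h (by simp [Adj])
  refine div_ne_zero (mul_ne_zero (key h) ?_) (pow_ne_zero _ (wt_sub_ne_zero hne))
  have := key fun h' => h (Adj.symm h')
  intro h0
  apply this
  linear_combination -h0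

theorem interSq_of_adj {x y : ℕ × ℤ} (h : Adj x y) (hne : x ≠ y) : interSq x y = 0 := by
  obtain ⟨a, m⟩ := x
  obtain ⟨b, n⟩ := y
  obtain ⟨h1, h2⟩ := h
  obtain rfl : a = b := h1
  simp only [abs_le] at h2
  have hmn : m ≠ n := fun e => hne (by rw [e])
  obtain rfl | rfl : m = n + 1 ∨ n = m + 1 := by omega
  all_goals
    simp only [interSq, wt, zpow_add₀ t_ne_zero, zpow_one]
    rw [div_eq_zero_iff]
    left
    ring

theorem gam_of_up {x y : ℕ × ℤ} (h : Up x y) : gam x y = 1 := if_pos h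

theorem gam_of_not_up {x y : ℕ × ℤ} (h : ¬ Up x y) : gam x y = interSq x y := if_neg h

theorem gam_of_adj {x y : ℕ × ℤ} (h : Adj x y) (hne : x ≠ y) : gam x y = 0 := by
  rw [gam_of_not_up fun h' => h'.not_adj h, interSq_of_adj h hne]

theorem gam_ne_zero {x y : ℕ × ℤ} (h : ¬ Adj x y) : gam x y ≠ 0 := by
  by_cases hu : Up x y
  · rw [gam_of_up hu]; exact one_ne_zero
  · rw [gam_of_not_up hu]; exact interSq_ne_zero h

/-- The square of the intertwiner fixes only this product; the factor 1 is placed on the upward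
exchange to match the required normalisation of F_(s_i τ). -/
theorem gam_mul_gam {x y : ℕ × ℤ} (h : ¬ Adj x y) : gam x y * gam y x = interSq x y := by
  rcases up_or_up_of_not_adj h with hu | hu
  · rw [gam_of_up hu, gam_of_not_up hu.asymm, one_mul, interSq_comm]
  · rw [gam_of_up hu, gam_of_not_up hu.asymm, mul_one]

/-- The effect of multiplying a weight by `q`. -/
def qShift (x : ℕ × ℤ) : ℕ × ℤ := (x.1 + 1, x.2)

theorem wt_qShift (x : ℕ × ℤ) : wt (qShift x) = q * wt x := by
  simp only [wt, qShift, pow_succ]; ring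

theorem kap_qShift (x y : ℕ × ℤ) : kap (qShift x) (qShift y) = kap x y := by
  simp only [kap, wt_qShift]
  rw [← mul_sub, mul_left_comm, mul_div_mul_left _ _ q_ne_zero]

theorem interSq_qShift (x y : ℕ × ℤ) : interSq (qShift x) (qShift y) = interSq x y := by
  simp only [interSq, wt_qShift]
  rw [← mul_div_mul_left ((t * wt x - wt y) * (wt x - t * wt y)) _ (pow_ne_zero 2 q_ne_zero)]
  congr 1 <;> ring

theorem up_qShift (x y : ℕ × ℤ) : Up (qShift x) (qShift y) ↔ Up x y := by
  simp [Up, qShift]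

theorem adj_qShift (x y : ℕ × ℤ) : Adj (qShift x) (qShift y) ↔ Adj x y := by
  simp [Adj, qShift]

theorem gam_qShift (x y : ℕ × ℤ) : gam (qShift x) (qShift y) = gam x y := by
  by_cases h : Up x y
  · rw [gam_of_up h, gam_of_up ((up_qShift x y).mpr h)]
  · rw [gam_of_not_up h, gam_of_not_up (mt (up_qShift x y).mp h), interSq_qShift]

/-! ## A model of the induced module -/

/-- The vector space with basis the periodic standard Young tableaux. -/
def Model (lam : YoungDiagram) : Type := PSYT lam →₀ Kqt

namespace Model

variable {lam : YoungDiagram}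

instance : AddCommGroup (Model lam) := inferInstanceAs (AddCommGroup (PSYT lam →₀ Kqt))

instance : Module Kqt (Model lam) := inferInstanceAs (Module Kqt (PSYT lam →₀ Kqt))

/-- The basis of the model. -/
def e : Module.Basis (PSYT lam) Kqt (Model lam) := ⟨LinearEquiv.refl Kqt (PSYT lam →₀ Kqt)⟩

/-- The action of `θ_i` on the model. -/
def thetaOp (i : Fin lam.card) : Module.End Kqt (Model lam) :=
  e.constr Kqt fun τ => wt (τ.d i) • e τ

/-- The diagonal part of the action of `t T_i⁻¹`, up to sign. -/
def kapOp (i : Fin (lam.card - 1)) : Module.End Kqt (Model lam) :=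
  e.constr Kqt fun τ => kap (τ.d (lo i)) (τ.d (hi i)) • e τ

/-- The intertwiner on the model. -/
def interOp (i : Fin (lam.card - 1)) : Module.End Kqt (Model lam) :=
  e.constr Kqt fun τ => gam (τ.d (lo i)) (τ.d (hi i)) • e (τ.sw i)

/-- The action of `t T_i⁻¹` on the model. -/
def sOp (i : Fin (lam.card - 1)) : Module.End Kqt (Model lam) := interOp i - kapOp i

/-- The exponent of the number `1`, and `0` for the empty diagram. -/
def firstExp (x : Fin lam.card → ℕ × ℤ) : ℕ := if h : 0 < lam.card then (x ⟨0, h⟩).1 else 0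

/-- The action of `X_n π_n⁻¹` on the model. -/
def qOp : Module.End Kqt (Model lam) :=
  e.constr Kqt fun τ => (q ^ firstExp τ.d)⁻¹ • e τ.psi

theorem thetaOp_e (i : Fin lam.card) (τ : PSYT lam) : thetaOp i (e τ) = wt (τ.d i) • e τ :=
  e.constr_basis _ _ _

theorem kapOp_e (i : Fin (lam.card - 1)) (τ : PSYT lam) :
    kapOp i (e τ) = kap (τ.d (lo i)) (τ.d (hi i)) • e τ := e.constr_basis _ _ _

theorem interOp_e (i : Fin (lam.card - 1)) (τ : PSYT lam) :
    interOp i (e τ) = gam (τ.d (lo i)) (τ.d (hi i)) • e (τ.sw i) := e.constr_basis _ _ _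

theorem qOp_e (τ : PSYT lam) : qOp (e τ) = (q ^ firstExp τ.d)⁻¹ • e τ.psi :=
  e.constr_basis _ _ _

/-- The vector `v` is zero or a multiple of a basis vector with weight `x`. -/
def Wt (x : Fin lam.card → ℕ × ℤ) (v : Model lam) : Prop :=
  v = 0 ∨ ∃ (k : Kqt) (τ : PSYT lam), v = k • e τ ∧ τ.d = x

theorem wt_e (τ : PSYT lam) : Wt τ.d (e τ) := Or.inr ⟨1, τ, (one_smul _ _).symm, rfl⟩

theorem Wt.smul {x : Fin lam.card → ℕ × ℤ} {v : Model lam} (h : Wt x v) (k : Kqt) :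
    Wt x (k • v) := by
  rcases h with rfl | ⟨k', τ, rfl, h⟩
  · exact Or.inl (smul_zero _)
  · exact Or.inr ⟨k * k', τ, smul_smul _ _ _, h⟩

theorem Wt.theta {x : Fin lam.card → ℕ × ℤ} {v : Model lam} (h : Wt x v) (i : Fin lam.card) :
    thetaOp i v = wt (x i) • v := by
  rcases h with rfl | ⟨k, τ, rfl, rfl⟩
  · simp
  · rw [map_smul, thetaOp_e, smul_comm]

theorem Wt.s {x : Fin lam.card → ℕ × ℤ} {v : Model lam} (h : Wt x v)
    (i : Fin (lam.card - 1)) : sOp i v = interOp i v - kap (x (lo i)) (x (hi i)) • v := by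
  rw [sOp, LinearMap.sub_apply]
  congr 1
  rcases h with rfl | ⟨k, τ, rfl, rfl⟩
  · simp
  · rw [map_smul, kapOp_e, smul_comm]

theorem d_lo_ne_hi (τ : PSYT lam) (i : Fin (lam.card - 1)) : τ.d (lo i) ≠ τ.d (hi i) :=
  τ.d_ne_of_close (Nat.lt_succ_self _) (by simp only [lo, hi]; omega)

/-- The alternative v = 0 in `Wt` is for adjacent labels: `gam` vanishes there, and the permuted
weight need not belong to a tableau. -/
theorem Wt.inter {x : Fin lam.card → ℕ × ℤ} {v : Model lam} (h : Wt x v)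
    (i : Fin (lam.card - 1)) : Wt (x ∘ Equiv.swap (lo i) (hi i)) (interOp i v) := by
  rcases h with rfl | ⟨k, τ, rfl, rfl⟩
  · exact Or.inl (map_zero _)
  · rw [map_smul]
    apply Wt.smul
    rw [interOp_e]
    by_cases ha : Adj (τ.d (lo i)) (τ.d (hi i))
    · rw [gam_of_adj ha (d_lo_ne_hi τ i), zero_smul]
      exact Or.inl rfl
    · apply Wt.smul
      rw [← PSYT.sw_d ha]
      exact wt_e _

theorem interOp_interOp {x : Fin lam.card → ℕ × ℤ} {v : Model lam} (h : Wt x v)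
    (i : Fin (lam.card - 1)) :
    interOp i (interOp i v) = interSq (x (lo i)) (x (hi i)) • v := by
  rcases h with rfl | ⟨k, τ, rfl, rfl⟩
  · simp
  · simp only [map_smul, interOp_e]
    by_cases ha : Adj (τ.d (lo i)) (τ.d (hi i))
    · rw [gam_of_adj ha (d_lo_ne_hi τ i), interSq_of_adj ha (d_lo_ne_hi τ i)]
      simp
    · rw [PSYT.sw_sw, PSYT.sw_d ha, ← gam_mul_gam ha]
      simp only [Function.comp, Equiv.swap_apply_left, Equiv.swap_apply_right, smul_smul]
      congr 1
      ring

end Model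

/-! ### The relations between the operators S_i, θ_i and Q of the model. -/

namespace Model

variable {lam : YoungDiagram}

theorem interOp_eq_zero {i : Fin (lam.card - 1)} {τ : PSYT lam}
    (h : Adj (τ.d (lo i)) (τ.d (hi i))) : interOp i (e τ) = 0 := by
  rw [interOp_e, gam_of_adj h (d_lo_ne_hi τ i), zero_smul]

/-- Both sides meet the same three pairs of weights, in opposite order, and end at the same tableau.
If one of the pairs is adjacent, both sides vanish. -/
theorem interOp_braid {i j : Fin (lam.card - 1)} (h : i.1 + 1 = j.1) (τ : PSYT lam) :
    interOp i (interOp j (interOp i (e τ))) = interOp j (interOp i (interOp j (e τ))) := by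
  have hm : lo j = hi i := Fin.ext h.symm
  have n1 : (lo i : Fin lam.card) ≠ hi i := lo_ne_hi i
  have n2 : (hi i : Fin lam.card) ≠ hi j := by rw [← hm]; exact lo_ne_hi j
  have n3 : (lo i : Fin lam.card) ≠ hi j := by
    simp only [lo, hi, Ne, Fin.mk.injEq]; omega
  by_cases hAB : Adj (τ.d (lo i)) (τ.d (hi i))
  · rw [interOp_eq_zero hAB]
    by_cases hBC : Adj (τ.d (lo j)) (τ.d (hi j))
    · rw [interOp_eq_zero hBC]; simp
    rw [interOp_e j, map_smul, map_smul]
    by_cases hAC : Adj ((τ.sw j).d (lo i)) ((τ.sw j).d (hi i))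
    · rw [interOp_eq_zero hAC]; simp
    rw [interOp_e i, map_smul, interOp_eq_zero (i := j)]
    · simp
    · rw [PSYT.sw_d hAC, PSYT.sw_d hBC, hm]
      simpa [Equiv.swap_apply_of_ne_of_ne, n1, n2, n3, n1.symm, n2.symm, n3.symm] using hAB
  by_cases hBC : Adj (τ.d (lo j)) (τ.d (hi j))
  · rw [interOp_eq_zero hBC, interOp_e i, map_smul, map_smul]
    by_cases hAC : Adj ((τ.sw i).d (lo j)) ((τ.sw i).d (hi j))
    · rw [interOp_eq_zero hAC]; simp
    rw [interOp_e j, map_smul, interOp_eq_zero (i := i)]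
    · simp
    · rw [PSYT.sw_d hAC, PSYT.sw_d hAB, hm]
      rw [hm] at hBC
      simpa [Equiv.swap_apply_of_ne_of_ne, n1, n2, n3, n1.symm, n2.symm, n3.symm] using hBC
  have e1 : (τ.sw i).d (lo j) = τ.d (lo i) := by rw [PSYT.sw_d hAB, hm]; simp
  have e2 : (τ.sw i).d (hi j) = τ.d (hi j) := by
    rw [PSYT.sw_d hAB]; simp [Equiv.swap_apply_of_ne_of_ne, n3.symm, n2.symm]
  have e3 : (τ.sw j).d (lo i) = τ.d (lo i) := by
    rw [PSYT.sw_d hBC, hm]; simp [Equiv.swap_apply_of_ne_of_ne, n3, n1]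
  have e4 : (τ.sw j).d (hi i) = τ.d (hi j) := by
    rw [PSYT.sw_d hBC, hm]; simp
  by_cases hAC : Adj (τ.d (lo i)) (τ.d (hi j))
  · rw [interOp_e i, interOp_e j, map_smul, map_smul, map_smul, map_smul,
      interOp_eq_zero (i := j), interOp_eq_zero (i := i)]
    · simp
    · rwa [e3, e4]
    · rwa [e1, e2]
  have hAC1 : ¬ Adj ((τ.sw i).d (lo j)) ((τ.sw i).d (hi j)) := by rwa [e1, e2]
  have hAC2 : ¬ Adj ((τ.sw j).d (lo i)) ((τ.sw j).d (hi i)) := by rwa [e3, e4]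
  have f1 : ((τ.sw i).sw j).d (lo i) = τ.d (hi i) := by
    rw [PSYT.sw_d hAC1, PSYT.sw_d hAB, hm]; simp [Equiv.swap_apply_of_ne_of_ne, n3, n1]
  have f2 : ((τ.sw i).sw j).d (hi i) = τ.d (hi j) := by
    rw [PSYT.sw_d hAC1, PSYT.sw_d hAB, hm]
    simp [Equiv.swap_apply_of_ne_of_ne, n3.symm, n2.symm]
  have f3 : ((τ.sw j).sw i).d (lo j) = τ.d (lo i) := by
    rw [PSYT.sw_d hAC2, PSYT.sw_d hBC, hm]; simp [Equiv.swap_apply_of_ne_of_ne, n3, n1]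
  have f4 : ((τ.sw j).sw i).d (hi j) = τ.d (hi i) := by
    rw [PSYT.sw_d hAC2, PSYT.sw_d hBC, hm]
    simp [Equiv.swap_apply_of_ne_of_ne, n3.symm, n2.symm]
  have e5 := hBC
  rw [hm] at e5
  -- Tableaux are compared through their weights, on which the exchanges act by transpositions.
  have hsw : ((τ.sw i).sw j).sw i = ((τ.sw j).sw i).sw j := by
    apply PSYT.d_injective
    rw [PSYT.sw_d (τ := (τ.sw i).sw j) (by rwa [f1, f2]), PSYT.sw_d hAC1, PSYT.sw_d hAB,
      PSYT.sw_d (τ := (τ.sw j).sw i) (by rwa [f3, f4]), PSYT.sw_d hAC2, PSYT.sw_d hBC, hm]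
    funext k
    have key : Equiv.swap (lo i) (hi i) * Equiv.swap (hi i) (hi j) * Equiv.swap (lo i) (hi i) =
        Equiv.swap (hi i) (hi j) * Equiv.swap (lo i) (hi i) * Equiv.swap (hi i) (hi j) := by
      rw [Equiv.swap_mul_swap_mul_swap n1 n3, Equiv.swap_comm (hi i) (hi j),
        Equiv.swap_comm (lo i) (hi i), Equiv.swap_mul_swap_mul_swap n2.symm n3.symm,
        Equiv.swap_comm]
    exact congrArg τ.d (DFunLike.congr_fun key k)
  rw [hm] at e1 f3
  simp only [interOp_e, map_smul, e1, e2, e3, e4, f1, f2, f3, f4, hsw, hm, smul_smul]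
  congr 1
  ring

theorem interOp_far {i j : Fin (lam.card - 1)} (h : i.1 + 1 < j.1 ∨ j.1 + 1 < i.1)
    (τ : PSYT lam) : interOp i (interOp j (e τ)) = interOp j (interOp i (e τ)) := by
  have n1 : (lo i : Fin lam.card) ≠ lo j := by simp only [lo, Ne, Fin.mk.injEq]; omega
  have n2 : (lo i : Fin lam.card) ≠ hi j := by simp only [lo, hi, Ne, Fin.mk.injEq]; omega
  have n3 : (hi i : Fin lam.card) ≠ lo j := by simp only [lo, hi, Ne, Fin.mk.injEq]; omega
  have n4 : (hi i : Fin lam.card) ≠ hi j := by simp only [hi, Ne, Fin.mk.injEq]; omega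
  have e1 : (τ.sw j).d (lo i) = τ.d (lo i) ∧ (τ.sw j).d (hi i) = τ.d (hi i) := by
    by_cases ha : Adj (τ.d (lo j)) (τ.d (hi j))
    · rw [PSYT.sw_of_adj ha]; exact ⟨rfl, rfl⟩
    · rw [PSYT.sw_d ha]; simp [Equiv.swap_apply_of_ne_of_ne, n1, n2, n3, n4]
  have e2 : (τ.sw i).d (lo j) = τ.d (lo j) ∧ (τ.sw i).d (hi j) = τ.d (hi j) := by
    by_cases ha : Adj (τ.d (lo i)) (τ.d (hi i))
    · rw [PSYT.sw_of_adj ha]; exact ⟨rfl, rfl⟩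
    · rw [PSYT.sw_d ha]
      simp [Equiv.swap_apply_of_ne_of_ne, n1.symm, n2.symm, n3.symm, n4.symm]
  have hsw : (τ.sw j).sw i = (τ.sw i).sw j := by
    by_cases ha : Adj (τ.d (lo i)) (τ.d (hi i))
    · rw [PSYT.sw_of_adj ha, PSYT.sw_of_adj (by rwa [e1.1, e1.2])]
    by_cases hb : Adj (τ.d (lo j)) (τ.d (hi j))
    · rw [PSYT.sw_of_adj hb, PSYT.sw_of_adj (i := j) (by rwa [e2.1, e2.2])]
    apply PSYT.d_injective
    rw [PSYT.sw_d (τ := τ.sw j) (by rwa [e1.1, e1.2]), PSYT.sw_d hb,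
      PSYT.sw_d (τ := τ.sw i) (by rwa [e2.1, e2.2]), PSYT.sw_d ha]
    funext k
    have key := (Equiv.Perm.disjoint_swap_swap (x := lo i) (y := hi i) (z := lo j)
      (t := hi j) (by simp [n1, n2, n3, n4, lo_ne_hi])).commute.eq
    exact congrArg τ.d (DFunLike.congr_fun key.symm k)
  simp only [interOp_e, map_smul, e1.1, e1.2, e2.1, e2.2, hsw, smul_smul]
  rw [mul_comm]

theorem sw_psi {i j : Fin (lam.card - 1)} (h : i.1 + 1 = j.1) (τ : PSYT lam) :
    τ.psi.sw i = (τ.sw j).psi := by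
  have d1 : τ.psi.d (lo i) = τ.d (lo j) := by
    rw [PSYT.psi_d_of_lt τ (by have := j.2; simp only [lo]; omega)]
    exact congrArg _ (Fin.ext h)
  have d2 : τ.psi.d (hi i) = τ.d (hi j) := by
    rw [PSYT.psi_d_of_lt τ (by have := j.2; simp only [hi]; omega)]
    exact congrArg _ (Fin.ext (by simp only [hi]; omega))
  by_cases ha : Adj (τ.d (lo j)) (τ.d (hi j))
  · rw [PSYT.sw_of_adj ha, PSYT.sw_of_adj (by rwa [d1, d2])]
  · ext1
    funext b
    rw [PSYT.sw_toFun (by rwa [d1, d2])]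
    show (Equiv.swap _ _ (PSYT.psiLabel (τ.toFun b)).1, (PSYT.psiLabel (τ.toFun b)).2) =
      PSYT.psiLabel ((τ.sw j).toFun b)
    rw [PSYT.sw_toFun ha]
    generalize τ.toFun b = x
    obtain ⟨⟨x, hx⟩, y⟩ := x
    have := j.2
    simp only [PSYT.psiLabel, Equiv.swap_apply_def, lo, hi, Fin.mk.injEq]
    split_ifs <;> simp_all <;> omega

/-- Ψ² moves the numbers 1, 2 to n-1, n and raises both exponents; adjacency does not see the common
factor q. -/
theorem sw_psi_psi {f l : Fin (lam.card - 1)} (hf : f.1 = 0) (hl : l.1 + 2 = lam.card)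
    (τ : PSYT lam) : τ.psi.psi.d (lo l) = qShift (τ.d (lo f)) ∧
      τ.psi.psi.d (hi l) = qShift (τ.d (hi f)) ∧ τ.psi.psi.sw l = (τ.sw f).psi.psi := by
  have d1 : ∀ τ : PSYT lam, τ.psi.psi.d (lo l) = qShift (τ.d (lo f)) := fun τ => by
    rw [PSYT.psi_d_of_lt _ (by simp only [lo]; omega), PSYT.psi_d_last _ (by simp only [lo]; omega)]
    rw [show (⟨0, _⟩ : Fin lam.card) = lo f from Fin.ext hf.symm]
    rfl
  have d2 : ∀ τ : PSYT lam, τ.psi.psi.d (hi l) = qShift (τ.d (hi f)) := fun τ => by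
    rw [PSYT.psi_d_last _ (by simp only [hi]; omega),
      PSYT.psi_d_of_lt _ (by show 0 + 1 < _; omega),
      show (⟨_, _⟩ : Fin lam.card) = hi f from Fin.ext (by simp only [hi]; omega)]
    rfl
  refine ⟨d1 τ, d2 τ, ?_⟩
  by_cases ha : Adj (τ.d (lo f)) (τ.d (hi f))
  · rw [PSYT.sw_of_adj ha, PSYT.sw_of_adj (by rwa [d1, d2, adj_qShift])]
  · apply PSYT.d_injective
    rw [PSYT.sw_d (by rwa [d1, d2, adj_qShift])]
    funext k
    simp only [Function.comp]
    by_cases h1 : k = lo l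
    · rw [h1, d1, Equiv.swap_apply_left, d2, PSYT.sw_d ha]
      simp
    by_cases h2 : k = hi l
    · rw [h2, d2, Equiv.swap_apply_right, d1, PSYT.sw_d ha]
      simp
    have hk := k.2
    simp only [lo, hi, Fin.ext_iff] at h1 h2
    rw [Equiv.swap_apply_of_ne_of_ne (by simpa [lo, Fin.ext_iff] using h1)
      (by simpa [hi, Fin.ext_iff] using h2)]
    rw [PSYT.psi_d_of_lt _ (by omega), PSYT.psi_d_of_lt _ (by show k.1 + 1 + 1 < _; omega),
      PSYT.psi_d_of_lt _ (by omega), PSYT.psi_d_of_lt _ (by show k.1 + 1 + 1 < _; omega),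
      PSYT.sw_d ha, Function.comp, Equiv.swap_apply_of_ne_of_ne] <;>
    simp only [lo, hi, Ne, Fin.mk.injEq] <;> omega

theorem interOp_qOp {i j : Fin (lam.card - 1)} (h : i.1 + 1 = j.1) (τ : PSYT lam) :
    interOp i (qOp (e τ)) = qOp (interOp j (e τ)) := by
  have d1 : τ.psi.d (lo i) = τ.d (lo j) := by
    rw [PSYT.psi_d_of_lt τ (by have := j.2; simp only [lo]; omega)]
    exact congrArg _ (Fin.ext h)
  have d2 : τ.psi.d (hi i) = τ.d (hi j) := by
    rw [PSYT.psi_d_of_lt τ (by have := j.2; simp only [hi]; omega)]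
    exact congrArg _ (Fin.ext (by simp only [hi]; omega))
  have hfe : firstExp (τ.sw j).d = firstExp τ.d := by
    by_cases ha : Adj (τ.d (lo j)) (τ.d (hi j))
    · rw [PSYT.sw_of_adj ha]
    · rw [PSYT.sw_d ha]
      simp only [firstExp, Function.comp]
      split_ifs with h0
      · rw [Equiv.swap_apply_of_ne_of_ne] <;> simp only [lo, hi, Ne, Fin.mk.injEq] <;> omega
      · rfl
  simp only [interOp_e, qOp_e, map_smul, d1, d2, sw_psi h, hfe, smul_smul]
  rw [mul_comm]

theorem firstExp_psi {f : Fin (lam.card - 1)} (hf : f.1 = 0) (τ : PSYT lam) :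
    firstExp τ.d = (τ.d (lo f)).1 ∧ firstExp τ.psi.d = (τ.d (hi f)).1 := by
  have h0 : 0 < lam.card := by have := f.2; omega
  constructor
  · rw [firstExp, dif_pos h0, show (⟨0, h0⟩ : Fin lam.card) = lo f from Fin.ext hf.symm]
  · rw [firstExp, dif_pos h0, PSYT.psi_d_of_lt _ (by have := f.2; show 0 + 1 < _; omega),
      show (⟨_, _⟩ : Fin lam.card) = hi f from Fin.ext (by simp only [hi]; omega)]

/-- The two applications of Q contribute q to minus the exponents of the numbers 1 and 2, which is
symmetric under their exchange. -/
theorem interOp_qOp_qOp {f l : Fin (lam.card - 1)} (hf : f.1 = 0) (hl : l.1 + 2 = lam.card)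
    (τ : PSYT lam) : interOp l (qOp (qOp (e τ))) = qOp (qOp (interOp f (e τ))) := by
  obtain ⟨d1, d2, hs⟩ := sw_psi_psi hf hl τ
  obtain ⟨h1, h2⟩ := firstExp_psi hf τ
  by_cases ha : Adj (τ.d (lo f)) (τ.d (hi f))
  · rw [interOp_eq_zero ha, qOp_e, map_smul, qOp_e, map_smul, map_smul, interOp_eq_zero]
    · simp
    · rwa [d1, d2, adj_qShift]
  · obtain ⟨h3, h4⟩ := firstExp_psi hf (τ.sw f)
    rw [PSYT.sw_d ha] at h3 h4
    simp only [Function.comp, Equiv.swap_apply_left, Equiv.swap_apply_right] at h3 h4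
    rw [← PSYT.sw_d ha] at h3
    simp only [interOp_e, qOp_e, map_smul, d1, d2, gam_qShift, hs, h1, h2, h3, h4, smul_smul]
    congr 1
    ring

theorem thetaOp_comm (i j : Fin lam.card) :
    thetaOp i * thetaOp j = thetaOp j * thetaOp (lam := lam) i := by
  refine e.ext fun τ => ?_
  simp only [Module.End.mul_apply, thetaOp_e, map_smul]
  rw [smul_comm]

/-- Here and in the relations below, evaluation at `e τ` with S = I - κ leaves a comparison of
coefficients of products of intertwiners, which the `kap` identities settle where it is not formal.
-/
theorem sOp_sq (i : Fin (lam.card - 1)) :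
    sOp (lam := lam) i * sOp i = (t - 1) • sOp i + t • 1 := by
  refine e.ext fun τ => ?_
  have h := wt_e τ
  have hne := d_lo_ne_hi τ i
  simp only [Module.End.mul_apply, LinearMap.add_apply, LinearMap.smul_apply, h.s,
    Module.End.one_apply, map_sub, map_smul, (h.inter i).s, interOp_interOp h, Function.comp,
    Equiv.swap_apply_left, Equiv.swap_apply_right, interSq_eq hne]
  linear_combination (norm := module)
    (-kap_add_kap hne) • interOp i (e τ) +
      (kap (τ.d (lo i)) (τ.d (hi i)) * kap_add_kap hne) • e τ

theorem sOp_theta_sOp (i : Fin (lam.card - 1)) :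
    sOp (lam := lam) i * thetaOp (lo i) * sOp i = t • thetaOp (hi i) := by
  refine e.ext fun τ => ?_
  have h := wt_e τ
  have hne := d_lo_ne_hi τ i
  simp only [Module.End.mul_apply, LinearMap.smul_apply, h.s, h.theta, (h.inter i).theta,
    map_sub, map_smul, (h.inter i).s, interOp_interOp h, Function.comp,
    Equiv.swap_apply_left, Equiv.swap_apply_right, interSq_eq hne]
  linear_combination (norm := module) (-kap_mul_wt hne) • interOp i (e τ) +
      (kap (τ.d (lo i)) (τ.d (hi i)) * kap_mul_wt hne) • e τ

theorem sOp_theta_far (i : Fin (lam.card - 1)) (j : Fin lam.card) (h₁ : j ≠ lo i)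
    (h₂ : j ≠ hi i) : sOp i * thetaOp j = thetaOp j * sOp (lam := lam) i := by
  refine e.ext fun τ => ?_
  have h := wt_e τ
  simp only [Module.End.mul_apply, h.s, h.theta, (h.inter i).theta,
    map_sub, map_smul, Function.comp, Equiv.swap_apply_of_ne_of_ne h₁ h₂]
  module

theorem sOp_far {i j : Fin (lam.card - 1)} (hij : i.1 + 1 < j.1 ∨ j.1 + 1 < i.1) :
    sOp i * sOp j = sOp j * sOp (lam := lam) i := by
  refine e.ext fun τ => ?_
  have h := wt_e τ
  have n1 : (lo i : Fin lam.card) ≠ lo j := by simp only [lo, Ne, Fin.mk.injEq]; omega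
  have n2 : (lo i : Fin lam.card) ≠ hi j := by simp only [lo, hi, Ne, Fin.mk.injEq]; omega
  have n3 : (hi i : Fin lam.card) ≠ lo j := by simp only [lo, hi, Ne, Fin.mk.injEq]; omega
  have n4 : (hi i : Fin lam.card) ≠ hi j := by simp only [hi, Ne, Fin.mk.injEq]; omega
  simp only [Module.End.mul_apply, h.s, map_sub, map_smul, (h.inter i).s, (h.inter j).s,
    interOp_far hij, Function.comp, Equiv.swap_apply_of_ne_of_ne n1 n2,
    Equiv.swap_apply_of_ne_of_ne n3 n4, Equiv.swap_apply_of_ne_of_ne n1.symm n3.symm,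
    Equiv.swap_apply_of_ne_of_ne n2.symm n4.symm]
  module

theorem sOp_braid {i j : Fin (lam.card - 1)} (hij : i.1 + 1 = j.1) :
    sOp i * sOp j * sOp i = sOp j * sOp i * sOp (lam := lam) j := by
  refine e.ext fun τ => ?_
  have h := wt_e τ
  have hm : lo j = hi i := Fin.ext hij.symm
  have n1 : (lo i : Fin lam.card) ≠ hi i := lo_ne_hi i
  have n2 : (hi i : Fin lam.card) ≠ hi j := by rw [← hm]; exact lo_ne_hi j
  have n3 : (lo i : Fin lam.card) ≠ hi j := by
    simp only [lo, hi, Ne, Fin.mk.injEq]; omega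
  have hAB := d_lo_ne_hi τ i
  have hBC : τ.d (hi i) ≠ τ.d (hi j) := hm ▸ d_lo_ne_hi τ j
  have hAC : τ.d (lo i) ≠ τ.d (hi j) :=
    τ.d_ne_of_close (by simp only [lo, hi]; omega) (by simp only [lo, hi]; omega)
  simp only [Module.End.mul_apply, h.s, map_sub, map_smul, (h.inter i).s, (h.inter j).s,
    ((h.inter i).inter j).s, ((h.inter j).inter i).s, interOp_interOp h, interOp_braid hij,
    Function.comp, hm,
    Equiv.swap_apply_left, Equiv.swap_apply_right, Equiv.swap_apply_of_ne_of_ne n3.symm n2.symm,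
    Equiv.swap_apply_of_ne_of_ne n1 n3]
  linear_combination (norm := module)
    (kap_identity₁ hAB hBC hAC) • interOp i (e τ) +
    (kap_identity₂ hAB hBC hAC) • interOp j (e τ) -
    (kap_identity₃ hAB hBC hAC) • e τ

theorem sOp_qOp {i j : Fin (lam.card - 1)} (hij : i.1 + 1 = j.1) :
    sOp i * qOp = qOp * sOp (lam := lam) j := by
  refine e.ext fun τ => ?_
  have d1 : τ.psi.d (lo i) = τ.d (lo j) := by
    rw [PSYT.psi_d_of_lt τ (by have := j.2; simp only [lo]; omega)]
    exact congrArg _ (Fin.ext hij)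
  have d2 : τ.psi.d (hi i) = τ.d (hi j) := by
    rw [PSYT.psi_d_of_lt τ (by have := j.2; simp only [hi]; omega)]
    exact congrArg _ (Fin.ext (by simp only [hi]; omega))
  have h := wt_e τ
  have h' : Wt τ.psi.d (qOp (e τ)) := by rw [qOp_e]; exact (wt_e _).smul _
  simp only [Module.End.mul_apply, h.s, h'.s, map_sub, map_smul, interOp_qOp hij, d1, d2]

theorem sOp_qOp_qOp {f l : Fin (lam.card - 1)} (hf : f.1 = 0) (hl : l.1 + 2 = lam.card) :
    sOp l * (qOp * qOp) = qOp * qOp * sOp (lam := lam) f := by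
  refine e.ext fun τ => ?_
  obtain ⟨d1, d2, -⟩ := sw_psi_psi hf hl τ
  have h := wt_e τ
  have h' : Wt τ.psi.psi.d (qOp (qOp (e τ))) := by
    rw [qOp_e, map_smul, qOp_e]; exact ((wt_e _).smul _).smul _
  simp only [Module.End.mul_apply, h.s, h'.s, map_sub, map_smul, interOp_qOp_qOp hf hl, d1, d2,
    kap_qShift]

theorem thetaOp_qOp {i j : Fin lam.card} (h : i.1 + 1 = j.1) :
    thetaOp i * qOp = qOp * thetaOp (lam := lam) j := by
  refine e.ext fun τ => ?_
  have d1 : τ.psi.d i = τ.d j := by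
    rw [PSYT.psi_d_of_lt τ (by have := j.2; omega)]
    exact congrArg _ (Fin.ext h)
  simp only [Module.End.mul_apply, qOp_e, thetaOp_e, map_smul, d1]
  rw [smul_comm]

theorem thetaOp_last_qOp {i j : Fin lam.card} (hi : i.1 = 0) (hj : j.1 + 1 = lam.card) :
    thetaOp j * qOp = q • (qOp * thetaOp (lam := lam) i) := by
  refine e.ext fun τ => ?_
  have d1 : τ.psi.d j = qShift (τ.d i) := by
    rw [PSYT.psi_d_last τ (by omega), show (⟨0, _⟩ : Fin lam.card) = i from Fin.ext hi.symm]
    rfl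
  simp only [Module.End.mul_apply, LinearMap.smul_apply, qOp_e, thetaOp_e, map_smul, d1,
    wt_qShift]
  module

end Model

/-! ## The relations of the double affine Hecke algebra from those of an intertwiner -/

section Intertwiner

variable {R : Type*} [Ring R] [Algebra Kqt R]

/-- Relations between elements `S_i = t T_i⁻¹`, `θ_i` and `Q = X_n π_n⁻¹`, for `n = N + 1`, with
indices starting at `0`. -/
structure IntertwinerData (N : ℕ) (S θ : ℕ → R) (Q : R) : Prop where
  sq : ∀ i < N, S i * S i = (t - 1) • S i + t • 1
  braid : ∀ i, i + 1 < N → S i * S (i + 1) * S i = S (i + 1) * S i * S (i + 1)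
  far : ∀ i j, i + 1 < j → j < N → S i * S j = S j * S i
  theta_comm : ∀ i j, i ≤ N → j ≤ N → θ i * θ j = θ j * θ i
  theta_step : ∀ i < N, S i * θ i * S i = t • θ (i + 1)
  theta_far : ∀ i j, i < N → j ≤ N → j ≠ i → j ≠ i + 1 → S i * θ j = θ j * S i
  s_q : ∀ i, i + 1 < N → S i * Q = Q * S (i + 1)
  s_q_q : ∀ i, i + 1 = N → S i * (Q * Q) = Q * Q * S 0
  theta_q : ∀ i < N, θ i * Q = Q * θ (i + 1)
  theta_q_last : θ N * Q = q • (Q * θ 0)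

/-- The product `S_0 ⋯ S_(k-1)`. -/
def upProd (S : ℕ → R) : ℕ → R
  | 0 => 1
  | k + 1 => upProd S k * S k

/-- The product `S_(k-1) ⋯ S_0`. -/
def downProd (S : ℕ → R) : ℕ → R
  | 0 => 1
  | k + 1 => S k * downProd S k

/-- The elements `X_0 = x`, `X_(k+1) = t⁻¹ S_k X_k S_k`. -/
def conjSeq (S : ℕ → R) (x : R) : ℕ → R
  | 0 => x
  | k + 1 => t⁻¹ • (S k * conjSeq S x k * S k)

theorem upProd_succ' {A : Type*} [Ring A] (S : ℕ → A) (k : ℕ) :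
    upProd S (k + 1) = S 0 * upProd (fun i => S (i + 1)) k := by
  induction k with
  | zero => simp [upProd]
  | succ k ih => rw [upProd, ih, upProd, mul_assoc]

theorem smul_conjSeq (S : ℕ → R) (x : R) (k : ℕ) :
    t • conjSeq S x (k + 1) = S k * conjSeq S x k * S k := by
  rw [conjSeq, smul_smul, mul_inv_cancel₀ t_ne_zero, one_smul]

theorem downProd_mul_upProd (S : ℕ → R) (x : R) (k : ℕ) :
    downProd S k * x * upProd S k = t ^ k • conjSeq S x k := by
  induction k with
  | zero => simp [downProd, upProd, conjSeq]
  | succ k ih =>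
    calc S k * downProd S k * x * (upProd S k * S k)
        = S k * (downProd S k * x * upProd S k) * S k := by noncomm_ring
      _ = _ := by
        rw [ih, mul_smul_comm, smul_mul_assoc, ← smul_conjSeq, smul_smul, pow_succ]

namespace IntertwinerData

variable {N : ℕ} {S θ : ℕ → R} {Q : R}

/-- The element `π = θ_0 S_0 ⋯ S_(N-1)`. -/
def pi (N : ℕ) (S θ : ℕ → R) : R := θ 0 * upProd S N

/-- The elements `X_k`. -/
def xSeq (N : ℕ) (S θ : ℕ → R) (Q : R) : ℕ → R := conjSeq S (q⁻¹ • (pi N S θ * Q))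

theorem commute_upProd (h : IntertwinerData N S θ Q) {i k : ℕ} (hk : k < i) (hi : i < N) :
    Commute (S i) (upProd S k) := by
  induction k with
  | zero => exact Commute.one_right _
  | succ k ih =>
    exact (ih (by omega)).mul_right (Commute.symm (h.far k i hk hi))

/-- S_(i+1) moves through S_0 ⋯ S_(k-1) and turns into S_i by the single braid move at S_i S_(i+1).
-/
theorem mul_upProd (h : IntertwinerData N S θ Q) {i k : ℕ} (hk : i + 1 < k) (hN : k ≤ N) :
    S (i + 1) * upProd S k = upProd S k * S i := by
  induction k with
  | zero => omega
  | succ k ih =>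
    rcases Nat.lt_or_ge (i + 1) k with hik | hik
    · rw [upProd, ← mul_assoc, ih hik (by omega), mul_assoc, h.far i k hik (by omega), mul_assoc]
    · obtain rfl : k = i + 1 := by omega
      have hc := (h.commute_upProd (i := i + 1) (k := i) (by omega) (by omega)).eq
      simp only [upProd]
      calc S (i + 1) * (upProd S i * S i * S (i + 1))
          = (S (i + 1) * upProd S i) * S i * S (i + 1) := by noncomm_ring
        _ = upProd S i * (S (i + 1) * S i * S (i + 1)) := by rw [hc]; noncomm_ring
        _ = _ := by rw [← h.braid i (by omega)]; noncomm_ring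

theorem s_pi (h : IntertwinerData N S θ Q) {i : ℕ} (hi : i + 1 < N) :
    S (i + 1) * pi N S θ = pi N S θ * S i := by
  rw [pi, ← mul_assoc, h.theta_far (i + 1) 0 hi (by omega) (by omega) (by omega), mul_assoc,
    h.mul_upProd hi le_rfl, mul_assoc]

theorem theta_eq_conjSeq (h : IntertwinerData N S θ Q) {k : ℕ} (hk : k ≤ N) :
    θ k = conjSeq S (θ 0) k := by
  induction k with
  | zero => rfl
  | succ k ih =>
    rw [conjSeq, ← ih (by omega), h.theta_step k (by omega), smul_smul,
      inv_mul_cancel₀ t_ne_zero, one_smul]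

theorem shift_mul_upProd (h : IntertwinerData N S θ Q) {k : ℕ} (hk : k < N) :
    upProd (fun i => S (i + 1)) k * upProd S N = upProd S N * upProd S k := by
  induction k with
  | zero => simp [upProd]
  | succ k ih =>
    rw [upProd, mul_assoc, h.mul_upProd hk le_rfl, ← mul_assoc, ih (by omega), mul_assoc]
    rfl

theorem commute_theta_shift (h : IntertwinerData N S θ Q) {k : ℕ} (hk : k < N) :
    Commute (θ 0) (upProd (fun i => S (i + 1)) k) := by
  induction k with
  | zero => exact Commute.one_right _
  | succ k ih =>
    exact (ih (by omega)).mul_right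
      (Commute.symm (h.theta_far (k + 1) 0 hk (by omega) (by omega) (by omega)))

theorem upProd_mul_q (h : IntertwinerData N S θ Q) {k : ℕ} (hk : k < N) :
    upProd S k * Q = Q * upProd (fun i => S (i + 1)) k := by
  induction k with
  | zero => simp [upProd]
  | succ k ih =>
    rw [upProd, mul_assoc, h.s_q k hk, ← mul_assoc, ih (by omega), mul_assoc]
    rfl

/-- Write π² = θ_0 S_0 θ_0 D (S_0 ⋯ S_(N-1)) with D = S_1 ⋯ S_(N-1). Moving S_M to the left
completes S_0 θ_0 S_0 = t θ_1, which commutes with θ_0. -/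
theorem pi_pi (h : IntertwinerData N S θ Q) {M : ℕ} (hM : M + 1 = N) :
    pi N S θ * pi N S θ * S M = S 0 * (pi N S θ * pi N S θ) := by
  have hC : upProd S N = S 0 * upProd (fun i => S (i + 1)) M := by rw [← hM, upProd_succ']
  have hC' : upProd S N = upProd S M * S M := by rw [← hM]; rfl
  set D := upProd (fun i => S (i + 1)) M with hD
  have hD1 : D * upProd S N = upProd S N * upProd S M := h.shift_mul_upProd (by omega)
  have hD2 : θ 0 * D = D * θ 0 := (h.commute_theta_shift (k := M) (by omega)).eq
  have hs := h.theta_step 0 (by omega)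
  have key : pi N S θ * pi N S θ = θ 0 * S 0 * θ 0 * D * upProd S N := by
    calc θ 0 * upProd S N * (θ 0 * upProd S N)
        = θ 0 * S 0 * (D * θ 0) * upProd S N := by rw [hC]; noncomm_ring
      _ = _ := by rw [← hD2]; noncomm_ring
  rw [key]
  calc θ 0 * S 0 * θ 0 * D * upProd S N * S M
      = θ 0 * S 0 * θ 0 * (D * upProd S N) * S M := by noncomm_ring
    _ = θ 0 * S 0 * θ 0 * upProd S N * (upProd S M * S M) := by rw [hD1]; noncomm_ring
    _ = θ 0 * (S 0 * θ 0 * S 0) * D * upProd S N := by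
      rw [← hC']; nth_rewrite 1 [hC]; noncomm_ring
    _ = (S 0 * θ 0 * S 0) * θ 0 * D * upProd S N := by
      rw [hs, mul_smul_comm, h.theta_comm 0 (0 + 1) (by omega) (by omega)]
      simp only [smul_mul_assoc]
    _ = _ := by noncomm_ring

theorem s_mul_t (h : IntertwinerData N S θ Q) {i : ℕ} (hi : i < N) :
    S i * (S i - (t - 1) • 1) = t • 1 := by
  rw [mul_sub, h.sq i hi, mul_smul_comm, mul_one, add_sub_cancel_left]

theorem t_mul_s (h : IntertwinerData N S θ Q) {i : ℕ} (hi : i < N) :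
    (S i - (t - 1) • 1) * S i = t • 1 := by
  rw [sub_mul, h.sq i hi, smul_mul_assoc, one_mul, add_sub_cancel_left]

/-- Both sides equal t θ_0 S_0 ⋯ S_(M-1) Q. The factor S_M - (t-1) plays the role of T_M, so this
tells how Q passes π; the commutation of X_0 with X_1 rests on it. -/
theorem q_s_pi (h : IntertwinerData N S θ Q) {M : ℕ} (hM : M + 1 = N) :
    Q * S 0 * pi N S θ = pi N S θ * (S M - (t - 1) • 1) * Q := by
  have hC : upProd S N = S 0 * upProd (fun i => S (i + 1)) M := by rw [← hM, upProd_succ']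
  have hC' : upProd S N = upProd S M * S M := by rw [← hM]; rfl
  have hq := h.upProd_mul_q (k := M) (by omega)
  set D := upProd (fun i => S (i + 1)) M with hD
  have lhs : Q * S 0 * pi N S θ = t • (θ 0 * upProd S M * Q) := by
    calc Q * S 0 * (θ 0 * upProd S N) = Q * (S 0 * θ 0 * S 0) * D := by rw [hC]; noncomm_ring
      _ = t • ((Q * θ (0 + 1)) * D) := by
        rw [h.theta_step 0 (by omega), mul_smul_comm, smul_mul_assoc]
      _ = t • (θ 0 * (Q * D)) := by rw [← h.theta_q 0 (by omega), mul_assoc]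
      _ = _ := by rw [← hq, mul_assoc]
  rw [lhs]
  symm
  calc θ 0 * upProd S N * (S M - (t - 1) • 1) * Q
      = θ 0 * upProd S M * (S M * (S M - (t - 1) • 1)) * Q := by
        rw [hC']; simp only [mul_assoc]
    _ = _ := by rw [h.s_mul_t (by omega), mul_smul_comm, smul_mul_assoc, mul_one]

/-- Conjugation turns θ_0 into θ_N, and θ_N Q = q Q θ_0 brings Q to the left; the factor q⁻¹ in X_0
absorbs the q. -/
theorem xSeq_last (h : IntertwinerData N S θ Q) : xSeq N S θ Q N = Q * pi N S θ := by
  have h1 := downProd_mul_upProd S (q⁻¹ • (pi N S θ * Q)) N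
  have h2 := downProd_mul_upProd S (θ 0) N
  rw [← h.theta_eq_conjSeq le_rfl] at h2
  have h3 : t ^ N • xSeq N S θ Q N = t ^ N • (Q * pi N S θ) := by
    rw [xSeq, ← h1]
    calc downProd S N * (q⁻¹ • (θ 0 * upProd S N * Q)) * upProd S N
        = q⁻¹ • ((downProd S N * θ 0 * upProd S N) * Q * upProd S N) := by
          rw [mul_smul_comm, smul_mul_assoc]; simp only [mul_assoc]
      _ = _ := by
        rw [h2, smul_mul_assoc, h.theta_q_last]
        simp only [smul_mul_assoc, smul_smul]
        rw [pi, mul_assoc]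
        congr 1
        rw [mul_left_comm, inv_mul_cancel₀ q_ne_zero, mul_one]
  exact smul_right_injective R (pow_ne_zero N t_ne_zero) h3

theorem pi_xSeq (h : IntertwinerData N S θ Q) {i : ℕ} (hi : i < N) :
    pi N S θ * xSeq N S θ Q i = xSeq N S θ Q (i + 1) * pi N S θ := by
  induction i with
  | zero =>
    obtain ⟨M, hM⟩ : ∃ M, M + 1 = N := ⟨N - 1, by omega⟩
    apply smul_right_injective R t_ne_zero
    simp only
    rw [← smul_mul_assoc t (xSeq N S θ Q (0 + 1)), xSeq, smul_conjSeq, conjSeq]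
    set p := pi N S θ with hp
    -- The factor t is split as S_M (S_M - (t-1)): `pi_pi` takes the first factor and `q_s_pi` the
    -- second.
    calc t • (p * q⁻¹ • (p * Q)) = q⁻¹ • (p * p * (t • 1) * Q) := by
          simp only [mul_smul_comm, smul_mul_assoc, mul_one, mul_assoc]
          rw [smul_comm]
      _ = q⁻¹ • (p * p * S M * (S M - (t - 1) • 1) * Q) := by
          rw [← h.s_mul_t (i := M) (by omega)]; simp only [mul_assoc]
      _ = q⁻¹ • (S 0 * p * (p * (S M - (t - 1) • 1) * Q)) := by
          rw [h.pi_pi hM, ← hp]; simp only [mul_assoc]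
      _ = q⁻¹ • (S 0 * p * (Q * S 0 * p)) := by rw [h.q_s_pi hM]
      _ = _ := by simp only [mul_smul_comm, smul_mul_assoc, mul_assoc]
  | succ i ih =>
    have ih := ih (by omega)
    have hs := h.s_pi hi
    simp only [xSeq, conjSeq] at ih ⊢
    simp only [mul_smul_comm, smul_mul_assoc] at ih ⊢
    congr 1
    set x := conjSeq S (q⁻¹ • (pi N S θ * Q)) i with hx
    set p := pi N S θ with hp
    calc p * (S i * x * S i) = (p * S i) * x * S i := by noncomm_ring
      _ = S (i + 1) * (p * x) * S i := by rw [← hs]; noncomm_ring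
      _ = S (i + 1) * (t⁻¹ • (S i * x * S i)) * (p * S i) := by
        rw [ih]; simp only [mul_smul_comm, smul_mul_assoc, mul_assoc]
      _ = _ := by rw [← hs]; simp only [mul_smul_comm, smul_mul_assoc, mul_assoc]

/-- In X_0 = q⁻¹ π Q the index shifts cancel: S_(i+1) π = π S_i and S_i Q = Q S_(i+1). -/
theorem s_commute_xSeq_of_lt (h : IntertwinerData N S θ Q) {k j : ℕ} (hk : k < j) (hj : j < N) :
    Commute (S j) (xSeq N S θ Q k) := by
  induction k with
  | zero =>
    obtain ⟨i, rfl⟩ : ∃ i, j = i + 1 := ⟨j - 1, by omega⟩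
    refine Commute.smul_right ?_ _
    show S (i + 1) * (pi N S θ * Q) = pi N S θ * Q * S (i + 1)
    rw [← mul_assoc, h.s_pi hj, mul_assoc, h.s_q i hj, mul_assoc]
  | succ k ih =>
    have h1 : Commute (S j) (S k) := Commute.symm (h.far k j hk hj)
    exact ((h1.mul_right (ih (by omega))).mul_right h1).smul_right _

theorem s_commute_xSeq_of_gt (h : IntertwinerData N S θ Q) {k j : ℕ} (hj : j + 1 < k)
    (hk : k ≤ N) : Commute (S j) (xSeq N S θ Q k) := by
  induction k with
  | zero => omega
  | succ k ih =>
    rcases Nat.lt_or_ge (j + 1) k with hjk | hjk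
    · have h1 : Commute (S j) (S k) := h.far j k hjk (by omega)
      exact ((h1.mul_right (ih hjk (by omega))).mul_right h1).smul_right _
    · obtain rfl : k = j + 1 := by omega
      have c := (h.s_commute_xSeq_of_lt (k := j) (j := j + 1) (by omega) (by omega)).eq
      have b := h.braid j (by omega)
      simp only [xSeq] at c
      simp only [xSeq, conjSeq, mul_smul_comm, smul_mul_assoc]
      refine Commute.smul_right (Commute.smul_right ?_ _) _
      set x := conjSeq S (q⁻¹ • (pi N S θ * Q)) j with hx
      set u := S (j + 1)
      set s := S j
      show s * (u * (s * x * s) * u) = u * (s * x * s) * u * s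
      calc s * (u * (s * x * s) * u) = (s * u * s) * x * s * u := by noncomm_ring
        _ = u * s * (u * x) * s * u := by rw [b]; noncomm_ring
        _ = u * s * x * (u * s * u) := by rw [c]; noncomm_ring
        _ = _ := by rw [← b]; noncomm_ring

/-- The one commutation that is not formal. It combines S_M Q² = Q² S_0 with π² S_M = S_0 π², the
two sides being joined by `q_s_pi`. -/
theorem xSeq_zero_commute_one (h : IntertwinerData N S θ Q) (hN : 0 < N) :
    Commute (xSeq N S θ Q 0) (xSeq N S θ Q 1) := by
  obtain ⟨M, hM⟩ : ∃ M, M + 1 = N := ⟨N - 1, by omega⟩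
  have r := h.q_s_pi hM
  simp only [xSeq, conjSeq]
  refine Commute.smul_right ?_ _
  refine Commute.smul_left ?_ _
  set p := pi N S θ with hp
  set T := S M - (t - 1) • (1 : R) with hT
  rw [mul_smul_comm, smul_mul_assoc]
  refine Commute.smul_right ?_ _
  show p * Q * (S 0 * (p * Q) * S 0) = S 0 * (p * Q) * S 0 * (p * Q)
  calc p * Q * (S 0 * (p * Q) * S 0) = p * (Q * S 0 * p) * (Q * S 0) := by noncomm_ring
    _ = p * p * T * (Q * Q * S 0) := by rw [r]; noncomm_ring
    _ = p * p * (T * S M) * (Q * Q) := by rw [← h.s_q_q M hM]; noncomm_ring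
    _ = p * p * (S M * T) * (Q * Q) := by rw [h.t_mul_s (by omega), h.s_mul_t (by omega)]
    _ = (p * p * S M) * T * (Q * Q) := by noncomm_ring
    _ = S 0 * p * (p * T * Q) * Q := by rw [h.pi_pi hM]; noncomm_ring
    _ = _ := by rw [← r]; noncomm_ring

/-- Starting from X_0 and X_1, conjugation by S_j raises the second index and conjugation by S_i the
first, since these commute with the other factor. -/
theorem xSeq_commute (h : IntertwinerData N S θ Q) {i j : ℕ} (hij : i < j) (hj : j ≤ N) :
    Commute (xSeq N S θ Q i) (xSeq N S θ Q j) := by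
  induction i with
  | zero =>
    induction j with
    | zero => omega
    | succ j ih =>
      rcases Nat.eq_zero_or_pos j with rfl | hpos
      · exact h.xSeq_zero_commute_one (by omega)
      · have h1 := (h.s_commute_xSeq_of_lt (k := 0) (j := j) hpos (by omega)).symm
        exact ((h1.mul_right (ih (by omega) (by omega))).mul_right h1).smul_right _
  | succ i ih =>
    have h1 := h.s_commute_xSeq_of_gt (j := i) hij hj
    exact ((h1.mul_left (ih (by omega))).mul_left h1).smul_left _

/-- Up to a power of t this writes Q θ_0 as X_N T_(N-1) ⋯ T_0, without π⁻¹. As θ_0 acts on basis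
vectors by nonzero scalars, a 𝒟_n-submodule of the model containing `e τ` also contains Q applied to
`e τ`. -/
theorem q_mul_theta (h : IntertwinerData N S θ Q) :
    t ^ N • (Q * θ 0) =
      xSeq N S θ Q N * downProd (fun i => S i - (t - 1) • (1 : R)) N := by
  have key : ∀ k ≤ N, upProd S k * downProd (fun i => S i - (t - 1) • (1 : R)) k = t ^ k • 1 := by
    intro k hk
    induction k with
    | zero => simp [upProd, downProd]
    | succ k ih =>
      calc upProd S k * S k * ((S k - (t - 1) • 1) * downProd (fun i => S i - (t - 1) • (1 : R)) k)
          = upProd S k * (S k * (S k - (t - 1) • 1)) *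
            downProd (fun i => S i - (t - 1) • (1 : R)) k := by simp only [mul_assoc]
        _ = _ := by
          rw [h.s_mul_t (by omega), mul_smul_comm, mul_one, smul_mul_assoc, ih (by omega),
            smul_smul, pow_succ, mul_comm]
  rw [h.xSeq_last, pi, mul_assoc, mul_assoc, key N le_rfl]
  simp

end IntertwinerData

end Intertwiner

/-! ### Deduction of the defining relations of ℋ_n, 𝒜_n and 𝒟_n from `IntertwinerData`. -/

section Relations

variable {R : Type*} [Ring R] [Algebra Kqt R]

theorem map_piElt {R' : Type*} [Ring R'] [Algebra Kqt R'] (f : R →ₐ[Kqt] R') {n : ℕ}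
    (T : Fin (n - 1) → R) (θ : Fin n → R) :
    f (piElt T θ) = piElt (fun i => f (T i)) (fun i => f (θ i)) := by
  unfold piElt
  split_ifs with h
  · rw [map_smul, map_mul, map_list_prod, List.map_ofFn]
    simp only [Function.comp_def, map_tinv]
  · exact map_one f

theorem DahaRel.map {R' : Type*} [Ring R'] [Algebra Kqt R'] (f : R →ₐ[Kqt] R') {n : ℕ}
    {T : Fin (n - 1) → R} {θ X : Fin n → R} {x y : R} (h : DahaRel T θ X x y) :
    DahaRel (fun i => f (T i)) (fun i => f (θ i)) (fun i => f (X i)) (f x) (f y) := by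
  cases h with
  | aff h => exact .aff (h.map f)
  | comm i j => rw [map_mul, map_mul]; exact DahaRel.comm i j
  | step i =>
    rw [map_smul, map_mul, map_mul, map_tinv]
    exact DahaRel.step i
  | far i j h₁ h₂ => rw [map_mul, map_mul]; exact DahaRel.far i j h₁ h₂
  | pi i => rw [map_mul, map_mul, map_piElt]; exact DahaRel.pi i
  | pi_last i j h₁ h₂ =>
    rw [map_smul, map_mul, map_mul, map_piElt]; exact DahaRel.pi_last i j h₁ h₂

/-- With T = S - (t-1) this says S = tT⁻¹, so the defining relations in terms of T become relations
in S. -/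
theorem tinv_sub (x : R) : tinv (x - (t - 1) • 1) = t⁻¹ • x := by
  rw [tinv, Algebra.algebraMap_eq_smul_one, sub_add_cancel]

theorem prod_ofFn_smul (S : ℕ → R) (m : ℕ) :
    (List.ofFn fun i : Fin m => t⁻¹ • S i.1).prod = t⁻¹ ^ m • upProd S m := by
  induction m with
  | zero => simp [upProd]
  | succ m ih =>
    rw [List.ofFn_succ', List.concat_eq_append, List.prod_append]
    simp only [Fin.val_castSucc, Fin.val_last, List.prod_cons, List.prod_nil, mul_one]
    rw [ih, smul_mul_smul_comm, pow_succ]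
    rfl

namespace IntertwinerData

variable {n : ℕ} {S θ : ℕ → R} {Q : R}

theorem piElt_eq (hn : 0 < n) :
    piElt (n := n) (fun i => S i.1 - (t - 1) • 1) (fun i => θ i.1) = pi (n - 1) S θ := by
  rw [piElt, dif_pos hn]
  simp only [tinv_sub]
  rw [prod_ofFn_smul, mul_smul_comm, smul_smul, ← mul_pow, mul_inv_cancel₀ t_ne_zero, one_pow,
    one_smul]
  rfl

theorem heckeRel (h : IntertwinerData (n - 1) S θ Q) {x y : R}
    (hxy : HeckeRel (n := n) (fun i => S i.1 - (t - 1) • 1) x y) : x = y := by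
  cases hxy with
  | quad i =>
    have hs := h.sq i.1 i.2
    rw [Algebra.algebraMap_eq_smul_one]
    simp only [sub_mul, mul_add, mul_sub, hs, smul_mul_assoc, mul_smul_comm, mul_one, one_mul]
    module
  | braid i j hij =>
    have hb := h.braid i.1 (by omega)
    have h1 := h.sq i.1 i.2
    have h2 := h.sq j.1 j.2
    rw [← hij] at h2 ⊢
    set a := S i.1
    set b := S (i.1 + 1)
    -- Once `a * a` is reduced by the quadratic relation, everything except the cubic term is
    -- symmetric in `a` and `b`.
    have expand : ∀ a b : R, (a - (t - 1) • 1) * (b - (t - 1) • 1) * (a - (t - 1) • 1) =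
        a * b * a - (t - 1) • (a * b + b * a) - (t - 1) • (a * a) +
          ((t - 1) * (t - 1)) • ((2 : Kqt) • a + b) -
          ((t - 1) * (t - 1) * (t - 1)) • (1 : R) := by
      intro a b
      simp only [sub_mul, mul_sub, smul_mul_assoc, mul_smul_comm, mul_one, one_mul, smul_sub]
      module
    rw [expand, expand, hb, h1, h2]
    module
  | far i j hij =>
    have hc : S i.1 * S j.1 = S j.1 * S i.1 := by
      rcases hij with hij | hij
      · exact h.far _ _ hij j.2
      · exact (h.far _ _ hij i.2).symm
    simp only [sub_mul, mul_sub, smul_mul_assoc, mul_smul_comm, mul_one, one_mul, hc]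
    module

theorem affRel (h : IntertwinerData (n - 1) S θ Q) {x y : R}
    (hxy : AffRel (n := n) (fun i => S i.1 - (t - 1) • 1) (fun i => θ i.1) x y) : x = y := by
  cases hxy with
  | hecke hxy => exact h.heckeRel hxy
  | comm i j => exact h.theta_comm _ _ (by have := i.2; omega) (by have := j.2; omega)
  | step i =>
    have hs := h.theta_step i.1 i.2
    simp only [tinv_sub, smul_mul_assoc, mul_smul_comm, lo, hi, hs, smul_smul]
    rw [mul_inv_cancel_left₀ t_ne_zero, inv_mul_cancel₀ t_ne_zero, one_smul]
  | far i j h₁ h₂ =>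
    have hc := h.theta_far i.1 j.1 i.2 (by have := j.2; omega) (fun e => h₁ (Fin.ext e))
      (fun e => h₂ (Fin.ext e))
    simp only [sub_mul, mul_sub, smul_mul_assoc, mul_smul_comm, mul_one, one_mul, hc]

theorem dahaRel (h : IntertwinerData (n - 1) S θ Q) {x y : R}
    (hxy : DahaRel (n := n) (fun i => S i.1 - (t - 1) • 1) (fun i => θ i.1)
      (fun i => xSeq (n - 1) S θ Q i.1) x y) : x = y := by
  cases hxy with
  | aff hxy => exact h.affRel hxy
  | comm i j =>
    have hi := i.2
    have hj := j.2
    rcases lt_trichotomy i.1 j.1 with hij | hij | hij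
    · exact h.xSeq_commute hij (by omega)
    · rw [hij]
    · exact (h.xSeq_commute hij (by omega)).symm
  | step i =>
    simp only [tinv_sub, smul_mul_assoc, mul_smul_comm, lo, hi, smul_smul]
    rw [mul_inv_cancel_left₀ t_ne_zero]
    rfl
  | far i j h₁ h₂ =>
    have hc : Commute (S i.1) (xSeq (n - 1) S θ Q j.1) := by
      have h₁' : j.1 ≠ i.1 := fun e => h₁ (Fin.ext e)
      have h₂' : j.1 ≠ i.1 + 1 := fun e => h₂ (Fin.ext e)
      have hi := i.2
      have hj := j.2
      rcases lt_or_gt_of_ne h₁' with hij | hij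
      · exact h.s_commute_xSeq_of_lt hij hi
      · exact h.s_commute_xSeq_of_gt (by omega) (by omega)
    exact hc.sub_left ((Commute.one_left _).smul_left _)
  | pi i =>
    rw [piElt_eq (by have := i.2; omega)]
    exact h.pi_xSeq i.2
  | pi_last i j h₁ h₂ =>
    rw [piElt_eq (by omega), show j.1 = n - 1 by omega, h₁, h.xSeq_last]
    show _ = q • (q⁻¹ • (pi (n - 1) S θ * Q) * pi (n - 1) S θ)
    rw [smul_mul_assoc, smul_smul, mul_inv_cancel₀ q_ne_zero, one_smul, mul_assoc]

end IntertwinerData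

end Relations

/-! ### Induction over generators, and the relations inside 𝒟_n. -/

theorem Hecke.induction {n : ℕ} {P : Hecke n → Prop} (alg : ∀ k, P (algebraMap Kqt _ k))
    (T : ∀ i, P (Hecke.T i)) (mul : ∀ a b, P a → P b → P (a * b))
    (add : ∀ a b, P a → P b → P (a + b)) (a : Hecke n) : P a := by
  obtain ⟨x, rfl⟩ : ∃ x, Hecke.mk n x = a := RingQuot.mkAlgHom_surjective Kqt _ a
  induction x using FreeAlgebra.induction with
  | grade0 k => rw [AlgHom.commutes]; exact alg k
  | grade1 i => exact T i
  | mul a b ha hb => rw [map_mul]; exact mul _ _ ha hb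
  | add a b ha hb => rw [map_add]; exact add _ _ ha hb

theorem Aff.induction {n : ℕ} {P : Aff n → Prop} (alg : ∀ k, P (algebraMap Kqt _ k))
    (T : ∀ i, P (Aff.T i)) (θ : ∀ i, P (Aff.θ i)) (mul : ∀ a b, P a → P b → P (a * b))
    (add : ∀ a b, P a → P b → P (a + b)) (a : Aff n) : P a := by
  obtain ⟨x, rfl⟩ : ∃ x, Aff.mk n x = a := RingQuot.mkAlgHom_surjective Kqt _ a
  induction x using FreeAlgebra.induction with
  | grade0 k => rw [AlgHom.commutes]; exact alg k
  | grade1 i =>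
    cases i with
    | T i => exact T i
    | θ i => exact θ i
  | mul a b ha hb => rw [map_mul]; exact mul _ _ ha hb
  | add a b ha hb => rw [map_add]; exact add _ _ ha hb

theorem Daha.induction {n : ℕ} {P : Daha n → Prop} (alg : ∀ k, P (algebraMap Kqt _ k))
    (T : ∀ i, P (Daha.T i)) (θ : ∀ i, P (Daha.θ i)) (X : ∀ i, P (Daha.X i))
    (mul : ∀ a b, P a → P b → P (a * b))
    (add : ∀ a b, P a → P b → P (a + b)) (a : Daha n) : P a := by
  obtain ⟨x, rfl⟩ : ∃ x, Daha.mk n x = a := RingQuot.mkAlgHom_surjective Kqt _ a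
  induction x using FreeAlgebra.induction with
  | grade0 k => rw [AlgHom.commutes]; exact alg k
  | grade1 i =>
    cases i with
    | T i => exact T i
    | θ i => exact θ i
    | X i => exact X i
  | mul a b ha hb => rw [map_mul]; exact mul _ _ ha hb
  | add a b ha hb => rw [map_add]; exact add _ _ ha hb

theorem Daha.rel {n : ℕ} (x y : Daha n) (h : DahaRel (n := n) Daha.T Daha.θ Daha.X x y) :
    x = y := by
  have key : ∀ {a b : FreeAlgebra Kqt (DahaGen n)}, dahaRel n a b →
      Daha.mk n a = Daha.mk n b := fun h => RingQuot.mkAlgHom_rel Kqt h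
  have hp : Daha.mk n (piElt (fun i => FreeAlgebra.ι Kqt (DahaGen.T i))
      (fun i => FreeAlgebra.ι Kqt (DahaGen.θ i))) = piElt Daha.T Daha.θ := map_piElt _ _ _
  cases h with
  | aff h =>
    cases h with
    | hecke h =>
      cases h with
      | quad i => simpa [Daha.T] using key (.aff (.hecke (.quad i)))
      | braid i j h => simpa [Daha.T] using key (.aff (.hecke (.braid i j h)))
      | far i j h => simpa [Daha.T] using key (.aff (.hecke (.far i j h)))
    | comm i j => simpa [Daha.θ] using key (.aff (.comm i j))
    | step i => simpa [Daha.T, Daha.θ, map_tinv] using key (.aff (.step i))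
    | far i j h₁ h₂ => simpa [Daha.T, Daha.θ] using key (.aff (.far i j h₁ h₂))
  | comm i j => simpa [Daha.X] using key (.comm i j)
  | step i => simpa [Daha.T, Daha.X, map_tinv] using key (.step i)
  | far i j h₁ h₂ => simpa [Daha.T, Daha.X] using key (.far i j h₁ h₂)
  | pi i =>
    rw [← hp]
    simpa [Daha.X] using key (.pi i)
  | pi_last i j h₁ h₂ =>
    rw [← hp]
    simpa [Daha.X] using key (.pi_last i j h₁ h₂)

/-! ### The action of 𝒟_n and ℋ_n on the model. -/

namespace Model

variable {lam : YoungDiagram}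

/-- The operators `S_k`, indexed by natural numbers. -/
def sSeq (lam : YoungDiagram) (k : ℕ) : Module.End Kqt (Model lam) :=
  if h : k < lam.card - 1 then sOp ⟨k, h⟩ else 0

/-- The operators `θ_k`, indexed by natural numbers. -/
def thetaSeq (lam : YoungDiagram) (k : ℕ) : Module.End Kqt (Model lam) :=
  if h : k < lam.card then thetaOp ⟨k, h⟩ else 0

theorem sSeq_val (i : Fin (lam.card - 1)) : sSeq lam i.1 = sOp i := dif_pos i.2

theorem thetaSeq_val (i : Fin lam.card) : thetaSeq lam i.1 = thetaOp i := dif_pos i.2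

theorem intertwinerData (lam : YoungDiagram) :
    IntertwinerData (lam.card - 1) (sSeq lam) (thetaSeq lam) qOp where
  sq i h := by
    have := sOp_sq (lam := lam) ⟨i, h⟩
    simpa only [sSeq, dif_pos h] using this
  braid i h := by
    have := sOp_braid (lam := lam) (i := ⟨i, by omega⟩) (j := ⟨i + 1, h⟩) rfl
    simpa only [sSeq, dif_pos h, dif_pos (show i < lam.card - 1 by omega)] using this
  far i j hij h := by
    have := sOp_far (lam := lam) (i := ⟨i, by omega⟩) (j := ⟨j, h⟩) (Or.inl hij)
    simpa only [sSeq, dif_pos h, dif_pos (show i < lam.card - 1 by omega)] using this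
  theta_comm i j hi hj := by
    simp only [thetaSeq]
    split_ifs
    · exact thetaOp_comm _ _
    all_goals simp
  theta_step i h := by
    have := sOp_theta_sOp (lam := lam) ⟨i, h⟩
    simpa only [sSeq, dif_pos h, thetaSeq, dif_pos (show i < lam.card by omega),
      dif_pos (show i + 1 < lam.card by omega), lo, MackeyDAHA.hi] using this
  theta_far i j hi hj h₁ h₂ := by
    have := sOp_theta_far (lam := lam) ⟨i, hi⟩ ⟨j, by omega⟩ (by simpa [lo] using h₁)
      (by simpa [MackeyDAHA.hi] using h₂)
    simpa only [sSeq, dif_pos hi, thetaSeq, dif_pos (show j < lam.card by omega)] using this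
  s_q i h := by
    have := sOp_qOp (lam := lam) (i := ⟨i, by omega⟩) (j := ⟨i + 1, h⟩) rfl
    simpa only [sSeq, dif_pos h, dif_pos (show i < lam.card - 1 by omega)] using this
  s_q_q i h := by
    have := sOp_qOp_qOp (lam := lam) (f := ⟨0, by omega⟩) (l := ⟨i, by omega⟩) rfl
      (by simp only; omega)
    simpa only [sSeq, dif_pos (show 0 < lam.card - 1 by omega),
      dif_pos (show i < lam.card - 1 by omega)] using this
  theta_q i h := by
    have := thetaOp_qOp (lam := lam) (i := ⟨i, by omega⟩) (j := ⟨i + 1, by omega⟩) rfl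
    simpa only [thetaSeq, dif_pos (show i < lam.card by omega),
      dif_pos (show i + 1 < lam.card by omega)] using this
  theta_q_last := by
    by_cases h : 0 < lam.card
    · have := thetaOp_last_qOp (lam := lam) (i := ⟨0, h⟩) (j := ⟨lam.card - 1, by omega⟩) rfl
        (by simp only; omega)
      simpa only [thetaSeq, dif_pos h, dif_pos (show lam.card - 1 < lam.card by omega)] using this
    -- For n = 0 the operator `thetaSeq lam 0` is the default 0 and both sides vanish.
    · simp [thetaSeq, h]

/-- The operators `X_i`. -/
def xOp (i : Fin lam.card) : Module.End Kqt (Model lam) :=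
  IntertwinerData.xSeq (lam.card - 1) (sSeq lam) (thetaSeq lam) qOp i.1

/-- The images of the generators of `𝒟_n`. -/
def genOp : DahaGen lam.card → Module.End Kqt (Model lam)
  | .T i => sSeq lam i.1 - (t - 1) • 1
  | .θ i => thetaSeq lam i.1
  | .X i => xOp i

/-- The action of `𝒟_n` on the model. -/
def act (lam : YoungDiagram) : Daha lam.card →ₐ[Kqt] Module.End Kqt (Model lam) :=
  RingQuot.liftAlgHom Kqt ⟨FreeAlgebra.lift Kqt genOp, by
    intro x y h
    have h' := h.map (FreeAlgebra.lift Kqt genOp)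
    simp only [FreeAlgebra.lift_ι_apply] at h'
    exact (intertwinerData lam).dahaRel h'⟩

theorem act_mk (g : DahaGen lam.card) :
    act lam (Daha.mk lam.card (FreeAlgebra.ι Kqt g)) = genOp g :=
  (RingQuot.liftAlgHom_mkAlgHom_apply Kqt _ _ _).trans (FreeAlgebra.lift_ι_apply _ _)

/-- The action of `ℋ_n` on the model. -/
def heckeAct (lam : YoungDiagram) : Hecke lam.card →ₐ[Kqt] Module.End Kqt (Model lam) :=
  RingQuot.liftAlgHom Kqt ⟨FreeAlgebra.lift Kqt fun i => genOp (.T i), by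
    intro x y h
    have h' := h.map (FreeAlgebra.lift Kqt fun i => genOp (lam := lam) (.T i))
    simp only [FreeAlgebra.lift_ι_apply] at h'
    exact (intertwinerData lam).heckeRel h'⟩

theorem heckeAct_T (i : Fin (lam.card - 1)) : heckeAct lam (Hecke.T i) = sOp i - (t - 1) • 1 := by
  rw [← sSeq_val]
  exact (RingQuot.liftAlgHom_mkAlgHom_apply Kqt _ _ _).trans (FreeAlgebra.lift_ι_apply _ _)

instance : Module (Daha lam.card) (Model lam) := Module.compHom (Model lam) (act lam).toRingHom

theorem smul_def (a : Daha lam.card) (v : Model lam) : a • v = act lam a v := rfl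

instance : IsScalarTower Kqt (Daha lam.card) (Model lam) where
  smul_assoc k a v := by rw [smul_def, smul_def, map_smul]; rfl

instance : Module (Hecke lam.card) (Model lam) :=
  Module.compHom (Model lam) (heckeAct lam).toRingHom

theorem hecke_smul_def (a : Hecke lam.card) (v : Model lam) : a • v = heckeAct lam a v := rfl

instance : IsScalarTower Kqt (Hecke lam.card) (Model lam) where
  smul_assoc k a v := by rw [hecke_smul_def, hecke_smul_def, map_smul]; rfl

theorem T_smul (i : Fin (lam.card - 1)) (v : Model lam) :
    (Daha.T i : Daha lam.card) • v = sOp i v - (t - 1) • v := by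
  rw [smul_def, Daha.T, act_mk, genOp, sSeq_val]; rfl

theorem theta_smul (i : Fin lam.card) (v : Model lam) :
    (Daha.θ i : Daha lam.card) • v = thetaOp i v := by
  rw [smul_def, Daha.θ, act_mk, genOp, thetaSeq_val]

theorem X_smul (i : Fin lam.card) (v : Model lam) :
    (Daha.X i : Daha lam.card) • v = xOp i v := by
  rw [smul_def, Daha.X, act_mk, genOp]

end Model

/-! ### The map from V_λ onto the model. -/

theorem kap_of_right {x y : ℕ × ℤ} (h₁ : x.1 = y.1) (h₂ : y.2 = x.2 + 1) : kap x y = -t := by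
  obtain ⟨a, m⟩ := x
  obtain ⟨b, n⟩ := y
  simp only at h₁ h₂
  subst h₁ h₂
  have hne := wt_sub_ne_zero (x := (a, m)) (y := (a, m + 1)) (by simp)
  rw [kap, div_eq_iff hne]
  simp only [wt, zpow_add₀ t_ne_zero, zpow_one]
  ring

theorem kap_of_below {x y : ℕ × ℤ} (h₁ : x.1 = y.1) (h₂ : x.2 = y.2 + 1) : kap x y = 1 := by
  obtain ⟨a, m⟩ := x
  obtain ⟨b, n⟩ := y
  simp only at h₁ h₂
  subst h₁ h₂
  have hne := wt_sub_ne_zero (x := (a, n + 1)) (y := (a, n)) (by simp)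
  rw [kap, div_eq_iff hne]
  simp only [wt, zpow_add₀ t_ne_zero, zpow_one]
  ring

theorem SYT.w_toPSYT {lam : YoungDiagram} (σ : SYT lam) (i : Fin lam.card) :
    σ.toPSYT.w i = 0 := rfl

theorem SYT.wt_d {lam : YoungDiagram} (σ : SYT lam) (i : Fin lam.card) :
    wt (σ.toPSYT.d i) = t ^ σ.toPSYT.c i := by
  rw [wt, PSYT.d, SYT.w_toPSYT, pow_zero, one_mul]

/-- The first number has to occupy the corner box; this is what makes θ_1 act as 1 on standard
tableaux, in accordance with θ̄_1 = 1. -/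
theorem SYT.c_zero {lam : YoungDiagram} (σ : SYT lam) (i : Fin lam.card) (hi : i.1 = 0) :
    σ.toPSYT.c i = 0 := by
  have h := σ.toPSYT.toFun_box i
  rw [PSYT.c]
  set b := σ.toPSYT.box i
  by_contra hc
  have h0 : ((0, 0) : ℕ × ℕ) ∈ lam.cells :=
    PSYT.mem_of_le (b := b) (Nat.zero_le _) (Nat.zero_le _)
  have hne : (⟨(0, 0), h0⟩ : Box lam) ≠ b := by
    intro e
    rw [← e] at hc
    exact hc (by simp [content])
  have := σ.toPSYT.labelLt_of_le (Nat.zero_le _) (Nat.zero_le _) hne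
  rw [h] at this
  have h2 : (σ.toPSYT.toFun ⟨(0, 0), h0⟩).2 = 0 := rfl
  simp only [LabelLt, SYT.w_toPSYT, Fin.lt_def, hi] at this
  omega

namespace Model

variable {lam : YoungDiagram}

/-- The span of the standard Young tableaux. -/
def stdSpan (lam : YoungDiagram) : Submodule Kqt (Model lam) :=
  Submodule.span Kqt (Set.range fun σ : SYT lam => e σ.toPSYT)

theorem stdSpan_le_iff {N : Submodule Kqt (Model lam)} :
    stdSpan lam ≤ N ↔ ∀ σ : SYT lam, e σ.toPSYT ∈ N := by
  rw [stdSpan, Submodule.span_le, Set.range_subset_iff]; rfl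

theorem e_mem_stdSpan (σ : SYT lam) : e σ.toPSYT ∈ stdSpan lam :=
  Submodule.subset_span ⟨σ, rfl⟩

theorem sOp_mem_stdSpan (i : Fin (lam.card - 1)) {v : Model lam} (hv : v ∈ stdSpan lam) :
    sOp i v ∈ stdSpan lam := by
  have : stdSpan lam ≤ (stdSpan lam).comap (sOp i) := by
    rw [stdSpan_le_iff]
    intro σ
    obtain ⟨σ', hσ'⟩ := PSYT.exists_toPSYT_eq (τ := σ.toPSYT.sw i)
      (by rw [PSYT.deg_sw, PSYT.deg_toPSYT])
    rw [Submodule.mem_comap, (wt_e _).s, interOp_e, ← hσ']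
    exact sub_mem (Submodule.smul_mem _ _ (e_mem_stdSpan _))
      (Submodule.smul_mem _ _ (e_mem_stdSpan _))
  exact this hv

theorem hecke_smul_mem_stdSpan (a : Hecke lam.card) :
    ∀ v ∈ stdSpan lam, a • v ∈ stdSpan lam := by
  induction a using Hecke.induction with
  | alg k =>
    intro v hv
    rw [algebraMap_smul]
    exact Submodule.smul_mem _ _ hv
  | T i =>
    intro v hv
    rw [hecke_smul_def, heckeAct_T]
    exact sub_mem (sOp_mem_stdSpan i hv) (Submodule.smul_mem _ _ hv)
  | mul a b ha hb =>
    intro v hv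
    rw [mul_smul]
    exact ha _ (hb _ hv)
  | add a b ha hb =>
    intro v hv
    rw [add_smul]
    exact add_mem (ha _ hv) (hb _ hv)

theorem heckeAct_tinv (i : Fin (lam.card - 1)) :
    heckeAct lam (tinv (Hecke.T i)) = t⁻¹ • sOp i := by
  rw [map_tinv, heckeAct_T, tinv_sub]

/-- In degree 0 both families start with the identity and satisfy the same recursion, so there the
action of 𝒜_n factors through ρ_n. -/
theorem thetaBar_smul {v : Model lam} (hv : v ∈ stdSpan lam) (i : Fin lam.card) :
    (Hecke.thetaBar i : Hecke lam.card) • v = thetaOp i v := by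
  have key : ∀ (k : ℕ) (hk : k < lam.card), ∀ v ∈ stdSpan lam,
      heckeAct lam (thetaBarAux Hecke.T k) v = thetaOp ⟨k, hk⟩ v := by
    intro k
    induction k with
    | zero =>
      intro hk v hv
      rw [thetaBarAux, map_one]
      have : stdSpan lam ≤ LinearMap.eqLocus (1 : Module.End Kqt (Model lam))
          (thetaOp ⟨0, hk⟩) := by
        rw [stdSpan_le_iff]
        intro σ
        rw [LinearMap.mem_eqLocus, thetaOp_e, SYT.wt_d, SYT.c_zero _ _ rfl, zpow_zero, one_smul]
        rfl
      exact this hv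
    | succ k ih =>
      intro hk v hv
      have hk' : k < lam.card - 1 := by omega
      rw [thetaBarAux, dif_pos hk', map_smul, map_mul, map_mul, heckeAct_tinv]
      simp only [smul_mul_assoc, mul_smul_comm, LinearMap.smul_apply, Module.End.mul_apply]
      rw [ih (by omega) _ (sOp_mem_stdSpan _ hv)]
      have hs := LinearMap.congr_fun (sOp_theta_sOp (lam := lam) ⟨k, hk'⟩) v
      simp only [Module.End.mul_apply, LinearMap.smul_apply] at hs
      change (sOp ⟨k, hk'⟩) ((thetaOp ⟨k, _⟩) ((sOp ⟨k, hk'⟩) v)) =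
        t • (thetaOp ⟨k + 1, hk⟩) v at hs
      rw [hs, smul_smul, smul_smul, smul_smul, mul_inv_cancel₀ t_ne_zero, one_mul,
        inv_mul_cancel₀ t_ne_zero, one_smul]
  exact key i.1 i.2 v hv

theorem sOp_e_of_adj {i : Fin (lam.card - 1)} {τ : PSYT lam}
    (h : Adj (τ.d (lo i)) (τ.d (hi i))) :
    sOp i (e τ) = -(kap (τ.d (lo i)) (τ.d (hi i))) • e τ := by
  rw [(wt_e _).s, interOp_eq_zero h, zero_sub, neg_smul]

/-- For φ̄_i the diagonal part of S_i drops out of the commutator with θ_i, and the intertwiner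
contributes the difference of the two weights. For boxes in one row or column the intertwiner
vanishes, so S_i = -κ_i is t or -1, that is, T_i is 1 or -t. -/
theorem specht_rel {x y : SYT lam →₀ Hecke lam.card} (h : SpechtRel lam x y) :
    Finsupp.linearCombination (Hecke lam.card) (fun σ : SYT lam => e σ.toPSYT) x =
      Finsupp.linearCombination (Hecke lam.card) (fun σ : SYT lam => e σ.toPSYT) y := by
  cases h with
  | theta i σ =>
    rw [map_smul, Finsupp.linearCombination_single, one_smul, thetaBar_smul (e_mem_stdSpan σ),
      thetaOp_e, SYT.wt_d, Finsupp.smul_single, Finsupp.linearCombination_single, smul_assoc,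
      one_smul]
  | phi i σ σ' h =>
    rw [PSYT.swapUp_iff] at h
    have hS : heckeAct lam (t • tinv (Hecke.T i)) = sOp i := by
      rw [map_smul, heckeAct_tinv, smul_smul, mul_inv_cancel₀ t_ne_zero, one_smul]
    have hw := wt_e σ.toPSYT
    rw [map_smul, Finsupp.linearCombination_single, one_smul, Hecke.phiBar, sub_smul, mul_smul,
      mul_smul, thetaBar_smul (e_mem_stdSpan σ), hecke_smul_def (t • tinv (Hecke.T i)),
      hecke_smul_def (t • tinv (Hecke.T i)), hS,
      thetaBar_smul (sOp_mem_stdSpan _ (e_mem_stdSpan σ)),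
      hw.theta, map_smul, hw.s, map_sub, (hw.inter i).theta, map_smul, hw.theta,
      Finsupp.smul_single, Finsupp.linearCombination_single, smul_assoc, one_smul, interOp_e,
      gam_of_up h.1, one_smul, ← h.2, ← SYT.wt_d, ← SYT.wt_d]
    simp only [Function.comp, Equiv.swap_apply_left]
    module
  | row i σ h =>
    have hw : σ.toPSYT.w (lo i) = σ.toPSYT.w (hi i) := rfl
    have hc := σ.toPSYT.consecutive_cases i hw
    have hc' : (σ.toPSYT.box (hi i)).1.2 = (σ.toPSYT.box (lo i)).1.2 + 1 := by omega
    rw [map_smul, Finsupp.linearCombination_single, one_smul, hecke_smul_def, heckeAct_T,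
      LinearMap.sub_apply, sOp_e_of_adj ((σ.toPSYT.adj_iff i).mpr ⟨hw, Or.inl ⟨h.symm, hc'⟩⟩),
      kap_of_right hw]
    · simp only [LinearMap.smul_apply, Module.End.one_apply]
      module
    · simp only [PSYT.d, PSYT.c, content]
      omega
  | col i σ h =>
    have hw : σ.toPSYT.w (lo i) = σ.toPSYT.w (hi i) := rfl
    have hc := σ.toPSYT.consecutive_cases i hw
    have hc' : (σ.toPSYT.box (hi i)).1.1 = (σ.toPSYT.box (lo i)).1.1 + 1 := by omega
    rw [map_smul, Finsupp.linearCombination_single, one_smul, hecke_smul_def, heckeAct_T,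
      LinearMap.sub_apply, sOp_e_of_adj ((σ.toPSYT.adj_iff i).mpr ⟨hw, Or.inr ⟨h.symm, hc'⟩⟩),
      kap_of_below hw, Finsupp.smul_single, Finsupp.linearCombination_single, smul_assoc, one_smul]
    · simp only [LinearMap.smul_apply, Module.End.one_apply]
      module
    · simp only [PSYT.d, PSYT.c, content]
      omega

/-- The map from the `ℋ_n`-module to the model. -/
def spechtMap (lam : YoungDiagram) : Specht lam →ₗ[Hecke lam.card] Model lam :=
  (spechtSub lam).liftQ
    (Finsupp.linearCombination (Hecke lam.card) (fun σ : SYT lam => e σ.toPSYT)) (by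
      rw [Submodule.span_le]
      rintro _ ⟨x, y, h, rfl⟩
      rw [SetLike.mem_coe, LinearMap.mem_ker, map_sub, specht_rel h, sub_self])

theorem spechtMap_vec (σ : SYT lam) : spechtMap lam (Specht.vec σ) = e σ.toPSYT := by
  refine ((spechtSub lam).liftQ_apply _ _).trans ?_
  rw [Finsupp.linearCombination_single, one_smul]

theorem spechtMap_mem (m : Specht lam) : spechtMap lam m ∈ stdSpan lam := by
  obtain ⟨x, rfl⟩ := (spechtSub lam).mkQ_surjective m
  refine (congrArg (· ∈ stdSpan lam) ((spechtSub lam).liftQ_apply _ x)).mpr ?_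
  rw [Finsupp.linearCombination_apply]
  exact Submodule.sum_mem _ fun σ _ => hecke_smul_mem_stdSpan _ _ (e_mem_stdSpan σ)

theorem aff_smul_specht (a : Aff lam.card) (m : Specht lam) : a • m = rho lam.card a • m := rfl

theorem spechtMap_aff_smul (a : Aff lam.card) :
    ∀ m : Specht lam, spechtMap lam (a • m) = incl lam.card a • spechtMap lam m := by
  induction a using Aff.induction with
  | alg k =>
    intro m
    rw [aff_smul_specht, AlgHom.commutes, AlgHom.commutes, map_smul, algebraMap_smul,
      algebraMap_smul]
  | T i =>
    intro m
    rw [aff_smul_specht, rho_T, incl_T, map_smul, hecke_smul_def, heckeAct_T, T_smul]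
    rfl
  | θ i =>
    intro m
    rw [aff_smul_specht, rho_θ, incl_θ, map_smul, thetaBar_smul (spechtMap_mem m), theta_smul]
  | mul a b ha hb =>
    intro m
    rw [mul_smul, ha, hb, map_mul, mul_smul]
  | add a b ha hb =>
    intro m
    rw [add_smul, map_add, ha, hb, map_add, add_smul]

/-- The map `𝒟_n ⊗_K ρ_n^*(λ) → Model`. -/
def tensorMap (lam : YoungDiagram) :
    Daha lam.card ⊗[Kqt] Specht lam →ₗ[Daha lam.card] Model lam :=
  TensorProduct.AlgebraTensorModule.lift
    { toFun := fun a => (act lam a).comp ((spechtMap lam).restrictScalars Kqt)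
      map_add' := fun a b => by ext m; simp
      map_smul' := fun a b => by ext m; simp [smul_def] }

theorem tensorMap_tmul (a : Daha lam.card) (m : Specht lam) :
    tensorMap lam (a ⊗ₜ m) = a • spechtMap lam m := rfl

/-- The map `V_λ → Model`. -/
def ofV (lam : YoungDiagram) : V lam →ₗ[Daha lam.card] Model lam :=
  (inducedSub lam).liftQ (tensorMap lam) (by
    rw [Submodule.span_le]
    rintro _ ⟨d, a, m, rfl⟩
    rw [SetLike.mem_coe, LinearMap.mem_ker, map_sub, tensorMap_tmul, tensorMap_tmul,
      spechtMap_aff_smul, mul_smul, sub_self])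

theorem ofV_tmul (a : Daha lam.card) (m : Specht lam) :
    ofV lam (V.tmul a m) = a • spechtMap lam m :=
  ((inducedSub lam).liftQ_apply _ _).trans (tensorMap_tmul a m)

/-- S_i e_τ + κ e_τ is the intertwiner applied to e_τ, whose coefficient is nonzero unless the
labels are adjacent, in which case `sw` does nothing. -/
theorem mem_of_sOp_mem {N : Submodule Kqt (Model lam)} {i : Fin (lam.card - 1)} {τ : PSYT lam}
    (h₁ : e τ ∈ N) (h₂ : sOp i (e τ) ∈ N) : e (τ.sw i) ∈ N := by
  by_cases ha : Adj (τ.d (lo i)) (τ.d (hi i))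
  · rwa [PSYT.sw_of_adj ha]
  · rw [(wt_e _).s, interOp_e] at h₂
    have h3 := N.add_mem h₂ (N.smul_mem (kap (τ.d (lo i)) (τ.d (hi i))) h₁)
    rw [sub_add_cancel] at h3
    exact (N.smul_mem_iff (gam_ne_zero ha)).mp h3

theorem sOp_mem_of_T {N : Submodule Kqt (Model lam)} {i : Fin (lam.card - 1)} {v : Model lam}
    (h : v ∈ N) (hT : (Daha.T i : Daha lam.card) • v ∈ N) : sOp i v ∈ N := by
  rw [T_smul] at hT
  have := N.add_mem hT (N.smul_mem (t - 1) h)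
  rwa [sub_add_cancel] at this

/-- The image is a 𝒟_n-submodule containing the standard tableaux. It is closed under exchanges by
`mem_of_sOp_mem` and under Ψ by `q_mul_theta`, so it contains every tableau. -/
theorem ofV_surjective : Function.Surjective (ofV lam) := by
  rw [← LinearMap.range_eq_top]
  let N := (LinearMap.range (ofV lam)).restrictScalars Kqt
  have hN : ∀ (a : Daha lam.card) (v : Model lam), v ∈ N → a • v ∈ N := fun a v hv =>
    (LinearMap.range (ofV lam)).smul_mem a hv
  suffices h : ∀ τ : PSYT lam, e τ ∈ N by
    rw [eq_top_iff]
    rintro v -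
    have : v ∈ N := by
      have h2 : Submodule.span Kqt (Set.range (e (lam := lam))) ≤ N := by
        rw [Submodule.span_le, Set.range_subset_iff]; exact h
      rw [e.span_eq] at h2
      exact h2 trivial
    exact this
  refine PSYT.induction_sw_psi (fun σ => ⟨V.tmul 1 (Specht.vec σ), ?_⟩) (fun i τ h => ?_)
    (fun τ h => ?_)
  · rw [ofV_tmul, spechtMap_vec, one_smul]
  · exact mem_of_sOp_mem h (sOp_mem_of_T h (hN _ _ h))
  · by_cases h0 : 0 < lam.card
    · have hd := LinearMap.congr_fun (intertwinerData lam).q_mul_theta (e τ)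
      simp only [LinearMap.smul_apply, Module.End.mul_apply, thetaSeq, dif_pos h0, thetaOp_e,
        map_smul, qOp_e] at hd
      have hdown : ∀ k ≤ lam.card - 1,
          downProd (fun i => sSeq lam i - (t - 1) • 1) k (e τ) ∈ N := by
        intro k
        induction k with
        | zero => exact fun _ => h
        | succ k ih =>
          intro hk
          have h1 := hN (Daha.T ⟨k, hk⟩) _ (ih (by omega))
          rw [T_smul] at h1
          rw [downProd, Module.End.mul_apply, sSeq, dif_pos (show k < lam.card - 1 from hk)]
          exact h1
      have hX := hN (Daha.X ⟨lam.card - 1, by omega⟩) _ (hdown _ le_rfl)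
      rw [X_smul, xOp] at hX
      simp only at hX
      rw [← hd, N.smul_mem_iff (pow_ne_zero _ t_ne_zero), N.smul_mem_iff (wt_ne_zero _),
        N.smul_mem_iff (inv_ne_zero (pow_ne_zero _ q_ne_zero))] at hX
      exact hX
    -- For n = 0 there are no boxes, and Ψ changes nothing.
    · have : τ.psi = τ := by
        ext b
        · exact absurd (τ.toFun b).1.pos h0
        · exact absurd (τ.toFun b).1.pos h0
      rwa [this]

end Model

/-! ## Spanning sets -/

section Relations

variable {R : Type*} [Ring R] [Algebra Kqt R]

theorem eq_smul_tinv_sub (x : R) : x = t • tinv x - (t - 1) • 1 := by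
  rw [tinv, smul_smul, mul_inv_cancel₀ t_ne_zero, one_smul, Algebra.algebraMap_eq_smul_one,
    add_sub_cancel_right]

/-- Exchange rules for the recursions z = t x⁻¹ y x⁻¹, used with x = T_i and y, z two consecutive θ̄
or two consecutive X. -/
theorem mul_conj_tinv {x y z : R} (h : (x - 1) * (x + algebraMap Kqt R t) = 0)
    (hz : z = t • (tinv x * y * tinv x)) :
    x * z = y * (t • tinv x) ∧ x * y = z * x - (t - 1) • y := by
  have h1 : x * z = y * (t • tinv x) := by
    rw [hz, mul_smul_comm, mul_smul_comm, ← mul_assoc, ← mul_assoc, mul_tinv h, one_mul]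
  have h2 : z * x = t • tinv x * y := by
    rw [hz, smul_mul_assoc, mul_assoc _ _ x, tinv_mul h, mul_one, smul_mul_assoc]
  refine ⟨h1, ?_⟩
  rw [h2]
  nth_rewrite 1 [eq_smul_tinv_sub x]
  rw [sub_mul, smul_mul_assoc, smul_mul_assoc, one_mul]

end Relations

/-! ### The standard tableaux span the ℋ_n-module λ. -/

namespace Specht

variable {lam : YoungDiagram}

theorem rel {x y : SYT lam →₀ Hecke lam.card} (h : SpechtRel lam x y) :
    (spechtSub lam).mkQ x = (spechtSub lam).mkQ y := by
  rw [← sub_eq_zero, ← map_sub]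
  exact (Submodule.Quotient.mk_eq_zero _).mpr (Submodule.subset_span ⟨x, y, h, rfl⟩)

theorem smul_vec (a : Hecke lam.card) (σ : SYT lam) :
    a • vec σ = (spechtSub lam).mkQ (a • Finsupp.single σ 1) := rfl

/-- The span of the standard tableaux. -/
def vecSpan (lam : YoungDiagram) : Submodule Kqt (Specht lam) :=
  Submodule.span Kqt (Set.range vec)

theorem vec_mem (σ : SYT lam) : vec σ ∈ vecSpan lam := Submodule.subset_span ⟨σ, rfl⟩

/-- Since T_i θ̄_(i+1) = θ̄_i tT_i⁻¹, the action of φ̄_i on a joint eigenvector is a combination of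
tT_i⁻¹ and T_i = tT_i⁻¹ - (t-1); dividing by the difference of the weights gives the formula. -/
theorem phi_vec {i : Fin (lam.card - 1)} {σ σ' : SYT lam}
    (h : PSYT.SwapUp i σ.toPSYT σ'.toPSYT) :
    ∃ k : Kqt, vec σ' = (t • tinv (Hecke.T i : Hecke lam.card)) • vec σ + k • vec σ := by
  have h1 : (Hecke.phiBar i : Hecke lam.card) • vec σ =
      (t ^ σ.toPSYT.c (lo i) - t ^ σ.toPSYT.c (hi i)) • vec σ' := rel (.phi i σ σ' h)
  have h2 : ∀ j, (Hecke.thetaBar j : Hecke lam.card) • vec σ = t ^ σ.toPSYT.c j • vec σ :=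
    fun j => rel (.theta j σ)
  have hstep : (Hecke.thetaBar (hi i) : Hecke lam.card) =
      t • (tinv (Hecke.T i) * Hecke.thetaBar (lo i) * tinv (Hecke.T i)) :=
    affRel_thetaBarAux Hecke.rel (.step i)
  have h3 := (mul_conj_tinv (Hecke.rel _ _ (.quad i)) hstep).1
  rw [Hecke.phiBar, ← h3, sub_smul, mul_smul, mul_smul, h2, h2, smul_comm, smul_comm (Hecke.T i)]
    at h1
  have h4 : (Hecke.T i : Hecke lam.card) • vec σ =
      (t • tinv (Hecke.T i : Hecke lam.card)) • vec σ - (t - 1) • vec σ := by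
    nth_rewrite 1 [eq_smul_tinv_sub (Hecke.T i : Hecke lam.card)]
    rw [sub_smul, smul_assoc (t - 1), one_smul]
  rw [h4] at h1
  rw [PSYT.swapUp_iff] at h
  have hne : t ^ σ.toPSYT.c (lo i) - t ^ σ.toPSYT.c (hi i) ≠ 0 := by
    rw [← SYT.wt_d, ← SYT.wt_d]
    exact wt_sub_ne_zero (Model.d_lo_ne_hi _ _)
  refine ⟨(t ^ σ.toPSYT.c (lo i) - t ^ σ.toPSYT.c (hi i))⁻¹ *
    ((t - 1) * t ^ σ.toPSYT.c (hi i)), ?_⟩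
  apply smul_right_injective _ hne
  simp only
  rw [← h1, smul_add, smul_smul, mul_inv_cancel_left₀ hne]
  generalize (t • tinv (Hecke.T i : Hecke lam.card)) • vec σ = w
  module

/-- Neighbouring boxes give a scalar and an upward exchange is `phi_vec`. Downwards, the tableau is
itself an upward exchange of another one, and the quadratic relation for tT_i⁻¹ closes the span. -/
theorem s_smul_mem (i : Fin (lam.card - 1)) (σ : SYT lam) :
    (t • tinv (Hecke.T i : Hecke lam.card)) • vec σ ∈ vecSpan lam := by
  have hT : ∀ k : Kqt, (Hecke.T i : Hecke lam.card) • vec σ = k • vec σ →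
      (t • tinv (Hecke.T i : Hecke lam.card)) • vec σ ∈ vecSpan lam := by
    intro k hk
    have : (t • tinv (Hecke.T i : Hecke lam.card)) • vec σ = (k + (t - 1)) • vec σ := by
      nth_rewrite 1 [eq_smul_tinv_sub (Hecke.T i : Hecke lam.card)] at hk
      rw [sub_smul, smul_assoc (t - 1), one_smul] at hk
      rw [add_smul, ← hk, sub_add_cancel]
    rw [this]
    exact Submodule.smul_mem _ _ (vec_mem σ)
  have up : ∀ {σ σ' : SYT lam}, PSYT.SwapUp i σ.toPSYT σ'.toPSYT →
      (t • tinv (Hecke.T i : Hecke lam.card)) • vec σ ∈ vecSpan lam := by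
    intro σ σ' h
    obtain ⟨k, hk⟩ := phi_vec h
    rw [← sub_eq_iff_eq_add] at hk
    rw [← hk]
    exact sub_mem (vec_mem _) (Submodule.smul_mem _ _ (vec_mem _))
  by_cases ha : Adj (σ.toPSYT.d (lo i)) (σ.toPSYT.d (hi i))
  · rcases ((PSYT.adj_iff _ _).mp ha).2 with h | h
    · exact hT 1 (by
        rw [one_smul]; exact rel (.row i σ h.1.symm))
    · exact hT (-t) (rel (.col i σ h.1.symm))
  · obtain ⟨σ', hσ'⟩ := PSYT.exists_toPSYT_eq (τ := σ.toPSYT.sw i)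
      (by rw [PSYT.deg_sw, PSYT.deg_toPSYT])
    rcases up_or_up_of_not_adj ha with hu | hu
    · exact up (PSYT.swapUp_iff.mpr ⟨hu, hσ'⟩)
    · have hup : PSYT.SwapUp i σ'.toPSYT σ.toPSYT := by
        rw [PSYT.swapUp_iff, hσ', PSYT.sw_sw, PSYT.sw_d ha]
        simpa using hu
      have hmem := up hup
      obtain ⟨k, hk⟩ := phi_vec hup
      have hquad : (t • tinv (Hecke.T i : Hecke lam.card)) * (t • tinv (Hecke.T i)) =
          (t - 1) • (t • tinv (Hecke.T i)) + t • 1 := by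
        have h1 := mul_tinv (Hecke.rel _ _ (.quad i) : (Hecke.T i - 1) *
          ((Hecke.T i : Hecke lam.card) + algebraMap Kqt _ t) = 0)
        nth_rewrite 1 [eq_smul_tinv_sub (Hecke.T i : Hecke lam.card)] at h1
        rw [sub_mul, sub_eq_iff_eq_add, smul_mul_assoc (t - 1), one_mul] at h1
        rw [mul_smul_comm, h1, smul_add, smul_comm t (t - 1), add_comm]
      rw [hk, smul_add, ← mul_smul, hquad, add_smul, smul_assoc (t - 1), smul_assoc t (1 : Hecke _),
        one_smul, smul_comm _ k]
      exact add_mem (add_mem (Submodule.smul_mem _ _ hmem) (Submodule.smul_mem _ _ (vec_mem _)))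
        (Submodule.smul_mem _ _ hmem)

theorem hecke_smul_mem (a : Hecke lam.card) : ∀ v ∈ vecSpan lam, a • v ∈ vecSpan lam := by
  induction a using Hecke.induction with
  | alg k =>
    intro v hv
    rw [algebraMap_smul]
    exact Submodule.smul_mem _ _ hv
  | T i =>
    intro v hv
    induction hv using Submodule.span_induction with
    | mem v hv =>
      obtain ⟨σ, rfl⟩ := hv
      rw [eq_smul_tinv_sub (Hecke.T i : Hecke lam.card), sub_smul, smul_assoc (t - 1), one_smul]
      exact sub_mem (s_smul_mem i σ) (Submodule.smul_mem _ _ (vec_mem σ))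
    | zero => rw [smul_zero]; exact zero_mem _
    | add v w _ _ hv hw => rw [smul_add]; exact add_mem hv hw
    | smul k v _ hv => rw [smul_comm]; exact Submodule.smul_mem _ _ hv
  | mul a b ha hb =>
    intro v hv
    rw [mul_smul]
    exact ha _ (hb _ hv)
  | add a b ha hb =>
    intro v hv
    rw [add_smul]
    exact add_mem (ha _ hv) (hb _ hv)

theorem vecSpan_eq_top (lam : YoungDiagram) : vecSpan lam = ⊤ := by
  rw [eq_top_iff]
  rintro m -
  obtain ⟨x, rfl⟩ := (spechtSub lam).mkQ_surjective m
  induction x using Finsupp.induction_linear with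
  | zero => rw [map_zero]; exact zero_mem _
  | add x y hx hy => rw [map_add]; exact add_mem hx hy
  | single σ a =>
    have := hecke_smul_mem a _ (vec_mem σ)
    rw [smul_vec, Finsupp.smul_single, smul_eq_mul, mul_one] at this
    exact this

end Specht

/-! ### The monomial vectors X^α (1 ⊗ σ) span V_λ. -/

namespace V

variable {lam : YoungDiagram}

theorem smul_tmul (a b : Daha lam.card) (m : Specht lam) : a • tmul b m = tmul (a * b) m := rfl

theorem tmul_eq (a : Daha lam.card) (m : Specht lam) : tmul a m = a • tmul 1 m := by
  rw [smul_tmul, mul_one]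

theorem incl_smul_tmul (a : Aff lam.card) (m : Specht lam) :
    incl lam.card a • tmul 1 m = tmul 1 (a • m) := by
  rw [smul_tmul, mul_one]
  refine (Submodule.Quotient.eq (inducedSub lam)).mpr (Submodule.subset_span ⟨1, a, m, ?_⟩)
  rw [one_mul]

/-- The map `m ↦ 1 ⊗ m`. -/
def ofSpecht (lam : YoungDiagram) : Specht lam →ₗ[Kqt] V lam where
  toFun := tmul 1
  map_add' m m' := by
    unfold tmul
    rw [TensorProduct.tmul_add, map_add]
    rfl
  map_smul' k m := by
    unfold tmul
    rw [TensorProduct.tmul_smul]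
    rfl

theorem eq_top_of_smul_mem {N : Submodule Kqt (V lam)} (h₁ : ∀ σ, tmul 1 (Specht.vec σ) ∈ N)
    (h₂ : ∀ (a : Daha lam.card), ∀ v ∈ N, a • v ∈ N) : N = ⊤ := by
  have h3 : ∀ m, tmul 1 m ∈ N := by
    have : Specht.vecSpan lam ≤ N.comap (ofSpecht lam) := by
      rw [Specht.vecSpan, Submodule.span_le, Set.range_subset_iff]
      exact h₁
    rw [Specht.vecSpan_eq_top] at this
    exact fun m => this trivial
  rw [eq_top_iff]
  rintro v -
  obtain ⟨x, rfl⟩ := (inducedSub lam).mkQ_surjective v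
  induction x using TensorProduct.induction_on with
  | zero => rw [map_zero]; exact zero_mem _
  | tmul a m =>
    have := h₂ a _ (h3 m)
    rw [← tmul_eq] at this
    exact this
  | add x y hx hy => rw [map_add]; exact add_mem hx hy

/-- The commutative algebra generated by the `X_i`. -/
def xAlg (n : ℕ) : Subalgebra Kqt (Daha n) :=
  Algebra.adjoin Kqt (Set.range Daha.X)

instance (n : ℕ) : IsMulCommutative (xAlg n) :=
  Algebra.isMulCommutative_adjoin Kqt (by
    rintro _ ⟨i, rfl⟩ _ ⟨j, rfl⟩
    exact Daha.rel _ _ (.comm i j))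

open scoped IsMulCommutative

/-- The monomial `X^α`. -/
def mon {n : ℕ} (α : Fin n → ℕ) : Daha n :=
  ((∏ i, (⟨Daha.X i, Algebra.subset_adjoin ⟨i, rfl⟩⟩ : xAlg n) ^ α i : xAlg n) : Daha n)

theorem mon_zero {n : ℕ} : mon (0 : Fin n → ℕ) = 1 := by
  unfold mon
  simp only [Pi.zero_apply, pow_zero, Finset.prod_const_one]
  exact Subalgebra.coe_one _

theorem X_mul_mon {n : ℕ} (i : Fin n) (α : Fin n → ℕ) :
    Daha.X i * mon α = mon (α + Pi.single i 1) := by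
  unfold mon
  have h : ∀ x : Fin n → xAlg n, x i * ∏ j, x j ^ α j =
      ∏ j, x j ^ (α + Pi.single i 1 : Fin n → ℕ) j := by
    intro x
    simp only [Pi.add_apply, pow_add, Finset.prod_mul_distrib]
    rw [mul_comm, Finset.prod_eq_single (f := fun j => x j ^ (Pi.single i 1 : Fin n → ℕ) j) i]
    · simp
    · intro j _ hj
      simp [hj]
    · simp
  rw [← h]
  rfl

theorem exponent_induction {n : ℕ} {P : (Fin n → ℕ) → Prop} (zero : P 0)
    (add : ∀ i β, P β → P (β + Pi.single i 1)) (α : Fin n → ℕ) : P α := by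
  induction hd : ∑ i, α i generalizing α with
  | zero =>
    have : α = 0 := by
      funext i
      exact (Finset.sum_eq_zero_iff.mp hd) i (Finset.mem_univ i)
    rwa [this]
  | succ d ih =>
    obtain ⟨i, -, hi⟩ : ∃ i ∈ Finset.univ, α i ≠ 0 := by
      apply Finset.exists_ne_zero_of_sum_ne_zero
      rw [hd]; omega
    obtain ⟨β, rfl⟩ : ∃ β : Fin n → ℕ, α = β + Pi.single i 1 := by
      refine ⟨α - Pi.single i 1, ?_⟩
      funext j
      by_cases hj : j = i
      · subst hj
        simp only [Pi.add_apply, Pi.sub_apply, Pi.single_eq_same]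
        omega
      · simp [Pi.single_eq_of_ne hj]
    have hβ : ∑ i, β i = d := by
      simp only [Pi.add_apply, Finset.sum_add_distrib, Finset.sum_pi_single', Finset.mem_univ,
        if_true] at hd
      omega
    exact add i β (ih β hβ)

/-- The spanning set `X^α (1 ⊗ σ)`. -/
def monVec (p : (Fin lam.card → ℕ) × SYT lam) : V lam := mon p.1 • tmul 1 (Specht.vec p.2)

/-- The span of the vectors `X^α (1 ⊗ σ)`. -/
def monSpan (lam : YoungDiagram) : Submodule Kqt (V lam) := Submodule.span Kqt (Set.range monVec)

theorem monVec_mem (p : (Fin lam.card → ℕ) × SYT lam) : monVec p ∈ monSpan lam :=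
  Submodule.subset_span ⟨p, rfl⟩

theorem tmul_one_mem (m : Specht lam) : tmul 1 m ∈ monSpan lam := by
  have : Specht.vecSpan lam ≤ (monSpan lam).comap (ofSpecht lam) := by
    rw [Specht.vecSpan, Submodule.span_le, Set.range_subset_iff]
    intro σ
    have := monVec_mem ((0 : Fin lam.card → ℕ), σ)
    rw [monVec, mon_zero, one_smul] at this
    exact this
  rw [Specht.vecSpan_eq_top] at this
  exact this trivial

theorem smul_mem_monSpan_of {a : Daha lam.card} (h : ∀ p, a • monVec p ∈ monSpan lam) :
    ∀ v ∈ monSpan lam, a • v ∈ monSpan lam := by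
  intro v hv
  induction hv using Submodule.span_induction with
  | mem v hv => obtain ⟨p, rfl⟩ := hv; exact h p
  | zero => rw [smul_zero]; exact zero_mem _
  | add v w _ _ hv hw => rw [smul_add]; exact add_mem hv hw
  | smul k v _ hv => rw [smul_comm]; exact Submodule.smul_mem _ _ hv

theorem X_smul_mem (i : Fin lam.card) :
    ∀ v ∈ monSpan lam, (Daha.X i : Daha lam.card) • v ∈ monSpan lam := by
  apply smul_mem_monSpan_of
  intro p
  rw [monVec, ← mul_smul, X_mul_mon]
  exact monVec_mem (_, p.2)

/-- Induction on the monomial: it suffices to treat 1 ⊗ m and to move the operator past one X_i. -/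
theorem smul_monVec_mem {a : Daha lam.card} (h₀ : ∀ m : Specht lam, a • tmul 1 m ∈ monSpan lam)
    (h : ∀ (i : Fin lam.card), ∀ v ∈ monSpan lam, a • v ∈ monSpan lam →
      a • (Daha.X i : Daha lam.card) • v ∈ monSpan lam) :
    ∀ v ∈ monSpan lam, a • v ∈ monSpan lam := by
  apply smul_mem_monSpan_of
  rintro ⟨α, σ⟩
  induction α using exponent_induction with
  | zero =>
    rw [monVec, mon_zero, one_smul]
    exact h₀ _
  | add i β ih =>
    rw [monVec, ← X_mul_mon, mul_smul]
    exact h i _ (monVec_mem (β, σ)) ih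

theorem T_smul_mem (i : Fin (lam.card - 1)) :
    ∀ v ∈ monSpan lam, (Daha.T i : Daha lam.card) • v ∈ monSpan lam := by
  apply smul_monVec_mem
  · intro m
    rw [← incl_T, incl_smul_tmul]
    exact tmul_one_mem _
  · intro j v hv hT
    have hX := mul_conj_tinv (Daha.rel _ _ (.aff (.hecke (.quad i))))
      (Daha.rel (n := lam.card) _ _ (.step i))
    rw [← mul_smul]
    by_cases h1 : j = lo i
    · rw [h1, hX.2, sub_smul, mul_smul, smul_assoc]
      exact sub_mem (X_smul_mem _ _ hT) (Submodule.smul_mem _ _ (X_smul_mem _ _ hv))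
    by_cases h2 : j = hi i
    · rw [h2, hX.1, mul_smul]
      apply X_smul_mem
      have : (t • tinv (Daha.T i : Daha lam.card)) • v = Daha.T i • v + (t - 1) • v := by
        nth_rewrite 2 [eq_smul_tinv_sub (Daha.T i : Daha lam.card)]
        rw [sub_smul, smul_assoc (t - 1), one_smul, sub_add_cancel]
      rw [this]
      exact add_mem hT (Submodule.smul_mem _ _ hv)
    · rw [Daha.rel _ _ (.far i j h1 h2), mul_smul]
      exact X_smul_mem _ _ hT

theorem incl_pi (n : ℕ) : incl n (Aff.pi n) = piElt Daha.T Daha.θ := by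
  rw [Aff.pi, map_piElt]
  simp only [incl_T, incl_θ]

theorem pi_smul_mem :
    ∀ v ∈ monSpan lam, (piElt Daha.T Daha.θ : Daha lam.card) • v ∈ monSpan lam := by
  apply smul_monVec_mem
  · intro m
    rw [← incl_pi, incl_smul_tmul]
    exact tmul_one_mem _
  · intro j v hv hp
    rw [← mul_smul]
    by_cases hj : j.1 + 1 < lam.card
    · have hr := Daha.rel _ _ (.pi (n := lam.card) ⟨j.1, by omega⟩)
      change _ * Daha.X j = _ at hr
      rw [hr, mul_smul]
      exact X_smul_mem _ _ hp
    · have h1 := j.2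
      rw [Daha.rel _ _ (.pi_last (n := lam.card) ⟨0, by omega⟩ j rfl (by omega)), smul_assoc,
        mul_smul]
      exact Submodule.smul_mem _ _ (X_smul_mem _ _ hp)

theorem tinv_smul_mem (i : Fin (lam.card - 1)) :
    ∀ v ∈ monSpan lam, tinv (Daha.T i : Daha lam.card) • v ∈ monSpan lam := by
  intro v hv
  rw [tinv, smul_assoc, add_smul, algebraMap_smul]
  exact Submodule.smul_mem _ _ (add_mem (T_smul_mem i v hv) (Submodule.smul_mem _ _ hv))

theorem exists_prod_tinv_inverse (l : List (Fin (lam.card - 1))) :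
    ∃ c : Daha lam.card, (l.map fun i => tinv (Daha.T i : Daha lam.card)).prod * c = 1 ∧
      ∀ v ∈ monSpan lam, c • v ∈ monSpan lam := by
  induction l with
  | nil => exact ⟨1, by simp, fun v hv => by rwa [one_smul]⟩
  | cons i l ih =>
    obtain ⟨c, hc, hm⟩ := ih
    refine ⟨c * Daha.T i, ?_, fun v hv => ?_⟩
    · rw [List.map_cons, List.prod_cons, mul_assoc, ← mul_assoc _ c, hc, one_mul,
        tinv_mul (Daha.rel _ _ (.aff (.hecke (.quad i))))]
    · rw [mul_smul]
      exact hm _ (T_smul_mem i v hv)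

/-- The relations give no direct rule for moving θ past X. But π and the T_i preserve the span, θ_1
is π times the inverse of a product of T_i⁻¹ up to a power of t, and the other θ_i follow by
conjugation. -/
theorem theta_smul_mem (i : Fin lam.card) :
    ∀ v ∈ monSpan lam, (Daha.θ i : Daha lam.card) • v ∈ monSpan lam := by
  obtain ⟨k, hk⟩ := i
  induction k with
  | zero =>
    intro v hv
    obtain ⟨c, hc, hm⟩ := exists_prod_tinv_inverse (List.ofFn fun i : Fin (lam.card - 1) => i)
    rw [List.map_ofFn] at hc
    have h1 : (piElt Daha.T Daha.θ : Daha lam.card) * c = t ^ (lam.card - 1) • Daha.θ ⟨0, hk⟩ := by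
      rw [piElt, dif_pos hk, smul_mul_assoc, mul_assoc]
      change _ • (_ * ((List.ofFn ((fun i => tinv (Daha.T i)) ∘ fun i => i)).prod * c)) = _
      rw [hc, mul_one]
    have h2 := pi_smul_mem _ (hm v hv)
    rw [← mul_smul, h1, smul_assoc, Submodule.smul_mem_iff _ (pow_ne_zero _ t_ne_zero)] at h2
    exact h2
  | succ k ih =>
    intro v hv
    have hr := Daha.rel _ _ (.aff (.step (n := lam.card) ⟨k, by omega⟩))
    change Daha.θ ⟨k + 1, hk⟩ = _ at hr
    rw [hr, smul_assoc, mul_smul, mul_smul]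
    exact Submodule.smul_mem _ _ (tinv_smul_mem _ _ (ih (by omega) _ (tinv_smul_mem _ _ hv)))

theorem monSpan_eq_top (lam : YoungDiagram) : monSpan lam = ⊤ := by
  refine eq_top_of_smul_mem (fun σ => tmul_one_mem _) fun a => ?_
  induction a using Daha.induction with
  | alg k =>
    intro v hv
    rw [algebraMap_smul]
    exact Submodule.smul_mem _ _ hv
  | T i => exact T_smul_mem i
  | θ i => exact theta_smul_mem i
  | X i => exact X_smul_mem i
  | mul a b ha hb =>
    intro v hv
    rw [mul_smul]
    exact ha _ (hb _ hv)
  | add a b ha hb =>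
    intro v hv
    rw [add_smul]
    exact add_mem (ha _ hv) (hb _ hv)

end V

namespace Model

variable {lam : YoungDiagram}

/-! ## The grading of the model and injectivity -/

/-- The part of degree `N` of the model. -/
def degSub (lam : YoungDiagram) (N : ℕ) : Submodule Kqt (Model lam) :=
  Submodule.span Kqt (e '' {τ | τ.deg = N})

theorem e_mem_degSub {τ : PSYT lam} {N : ℕ} (h : τ.deg = N) : e τ ∈ degSub lam N :=
  Submodule.subset_span ⟨τ, h, rfl⟩

theorem apply_mem_degSub {f : Module.End Kqt (Model lam)} {k : ℕ}
    (h : ∀ τ, f (e τ) ∈ degSub lam (τ.deg + k)) {N : ℕ} {v : Model lam}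
    (hv : v ∈ degSub lam N) : f v ∈ degSub lam (N + k) := by
  have : degSub lam N ≤ (degSub lam (N + k)).comap f := by
    rw [degSub, Submodule.span_le]
    rintro _ ⟨τ, rfl, rfl⟩
    exact h τ
  exact this hv

theorem sSeq_mem_degSub (i : ℕ) {N : ℕ} {v : Model lam} (hv : v ∈ degSub lam N) :
    sSeq lam i v ∈ degSub lam N := by
  rw [sSeq]
  split_ifs
  · refine apply_mem_degSub (k := 0) (fun τ => ?_) hv
    rw [(wt_e τ).s, interOp_e]
    exact sub_mem (Submodule.smul_mem _ _ (e_mem_degSub (PSYT.deg_sw _ _)))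
      (Submodule.smul_mem _ _ (e_mem_degSub rfl))
  · exact zero_mem _

theorem thetaSeq_mem_degSub (i : ℕ) {N : ℕ} {v : Model lam} (hv : v ∈ degSub lam N) :
    thetaSeq lam i v ∈ degSub lam N := by
  rw [thetaSeq]
  split_ifs
  · refine apply_mem_degSub (k := 0) (fun τ => ?_) hv
    rw [thetaOp_e]
    exact Submodule.smul_mem _ _ (e_mem_degSub rfl)
  · exact zero_mem _

theorem pi_mem_degSub {N : ℕ} {v : Model lam} (hv : v ∈ degSub lam N) :
    IntertwinerData.pi (lam.card - 1) (sSeq lam) (thetaSeq lam) v ∈ degSub lam N := by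
  have : ∀ k, ∀ v ∈ degSub lam N, upProd (sSeq lam) k v ∈ degSub lam N := by
    intro k
    induction k with
    | zero => exact fun v hv => hv
    | succ k ih => exact fun v hv => ih _ (sSeq_mem_degSub k hv)
  exact thetaSeq_mem_degSub 0 (this _ v hv)

theorem xOp_mem_degSub (i : Fin lam.card) {N : ℕ} {v : Model lam} (hv : v ∈ degSub lam N) :
    xOp i v ∈ degSub lam (N + 1) := by
  have : ∀ k, ∀ v ∈ degSub lam N, IntertwinerData.xSeq (lam.card - 1) (sSeq lam) (thetaSeq lam)
      qOp k v ∈ degSub lam (N + 1) := by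
    intro k
    induction k with
    | zero =>
      intro v hv
      refine Submodule.smul_mem _ _ (pi_mem_degSub ?_)
      refine apply_mem_degSub (fun τ => ?_) hv
      rw [qOp_e]
      exact Submodule.smul_mem _ _ (e_mem_degSub (PSYT.deg_psi τ i.pos))
    | succ k ih =>
      intro v hv
      exact Submodule.smul_mem _ _ (sSeq_mem_degSub k (ih _ (sSeq_mem_degSub k hv)))
  exact this _ v hv

theorem ofV_monVec_mem (p : (Fin lam.card → ℕ) × SYT lam) :
    ofV lam (V.monVec p) ∈ degSub lam (∑ i, p.1 i) := by
  obtain ⟨α, σ⟩ := p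
  rw [V.monVec, map_smul, ofV_tmul, one_smul, spechtMap_vec]
  induction α using V.exponent_induction with
  | zero =>
    rw [V.mon_zero, one_smul]
    exact e_mem_degSub (by simp [PSYT.deg_toPSYT])
  | add i β ih =>
    rw [← V.X_mul_mon, mul_smul, X_smul]
    have h := xOp_mem_degSub i ih
    simpa [Finset.sum_add_distrib] using h

/-- The projection onto the part of degree `N`. -/
def degProj (lam : YoungDiagram) (N : ℕ) : Module.End Kqt (Model lam) :=
  e.constr Kqt fun τ => if τ.deg = N then e τ else 0

theorem degProj_e (N : ℕ) (τ : PSYT lam) :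
    degProj lam N (e τ) = if τ.deg = N then e τ else 0 := e.constr_basis _ _ _

theorem degProj_of_mem {N : ℕ} {v : Model lam} (hv : v ∈ degSub lam N) (M : ℕ) :
    degProj lam M v = if N = M then v else 0 := by
  induction hv using Submodule.span_induction with
  | mem v hv => obtain ⟨τ, rfl, rfl⟩ := hv; exact degProj_e _ _
  | zero => simp
  | add v w _ _ hv hw => rw [map_add, hv, hw]; split_ifs <;> simp
  | smul k v _ hv => rw [map_smul, hv]; split_ifs <;> simp

theorem degProj_mem (N : ℕ) (v : Model lam) : degProj lam N v ∈ degSub lam N := by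
  have h : v ∈ Submodule.span Kqt (Set.range (e (lam := lam))) := by rw [e.span_eq]; trivial
  induction h using Submodule.span_induction with
  | zero => rw [map_zero]; exact zero_mem _
  | add v w _ _ hv hw => rw [map_add]; exact add_mem hv hw
  | smul k v _ hv => rw [map_smul]; exact Submodule.smul_mem _ _ hv
  | mem v hv =>
    obtain ⟨τ, rfl⟩ := hv
    rw [degProj_e]
    split_ifs with h
    · exact e_mem_degSub h
    · exact zero_mem _

theorem eq_zero_of_degProj {v : Model lam} (h : ∀ N, degProj lam N v = 0) : v = 0 := by
  classical
  have key : ∀ τ, e.repr v τ = e.repr (degProj lam τ.deg v) τ := by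
    intro τ
    have : e.coord τ = e.coord τ ∘ₗ degProj lam τ.deg := by
      refine e.ext fun τ' => ?_
      rw [LinearMap.comp_apply, degProj_e]
      split_ifs with h
      · rfl
      · rw [map_zero, Module.Basis.coord_apply, Module.Basis.repr_self, Finsupp.single_apply,
          if_neg]
        rintro rfl
        exact h rfl
    exact LinearMap.congr_fun this v
  apply e.repr.injective
  ext τ
  rw [key, h]

instance (N : ℕ) : FiniteDimensional Kqt (degSub lam N) :=
  FiniteDimensional.span_of_finite Kqt ((PSYT.finite_deg N).image _)

/-- A surjective endomorphism of degree zero of the model is injective. -/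
theorem injective_of_graded {f : Module.End Kqt (Model lam)} (hs : Function.Surjective f)
    (hd : ∀ τ, f (e τ) ∈ degSub lam τ.deg) : Function.Injective f := by
  have hmem : ∀ N, ∀ v ∈ degSub lam N, f v ∈ degSub lam N := fun N v hv =>
    apply_mem_degSub (k := 0) hd hv
  have hcomm : ∀ N v, degProj lam N (f v) = f (degProj lam N v) := by
    intro N v
    have : degProj lam N ∘ₗ f = f ∘ₗ degProj lam N := by
      refine e.ext fun τ => ?_
      rw [LinearMap.comp_apply, LinearMap.comp_apply, degProj_e, degProj_of_mem (hd τ)]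
      split_ifs <;> simp
    exact LinearMap.congr_fun this v
  have hinj : ∀ N, Function.Injective (f.restrict (hmem N)) := by
    intro N
    rw [LinearMap.injective_iff_surjective]
    rintro ⟨y, hy⟩
    obtain ⟨x, rfl⟩ := hs y
    -- The degree-N component of any preimage is again a preimage, as `f` commutes with the
    -- projections; on the finite-dimensional piece surjectivity gives injectivity.
    refine ⟨⟨degProj lam N x, degProj_mem N x⟩, Subtype.ext ?_⟩
    show f (degProj lam N x) = f x
    rw [← hcomm, degProj_of_mem hy, if_pos rfl]
  rw [injective_iff_map_eq_zero]
  intro v hv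
  refine eq_zero_of_degProj fun N => ?_
  have h1 : f (degProj lam N v) = 0 := by rw [← hcomm, hv, map_zero]
  have h2 : f.restrict (hmem N) ⟨degProj lam N v, degProj_mem N v⟩ = 0 := Subtype.ext h1
  exact congrArg Subtype.val ((map_eq_zero_iff _ (hinj N)).mp h2)

/-- The map `Model → V_λ` that sends a tableau to the corresponding monomial vector. -/
def toV (lam : YoungDiagram) : Model lam →ₗ[Kqt] V lam :=
  -- The value 0 is a default off the image of `ofExponents`; surjectivity of `ofExponents` is not
  -- needed.
  e.constr Kqt (Function.extend PSYT.ofExponents V.monVec 0)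

theorem toV_surjective : Function.Surjective (toV lam) := by
  rw [← LinearMap.range_eq_top, eq_top_iff, ← V.monSpan_eq_top, V.monSpan, Submodule.span_le]
  rintro _ ⟨p, rfl⟩
  refine ⟨e (PSYT.ofExponents p), ?_⟩
  rw [toV, Module.Basis.constr_basis, PSYT.ofExponents_injective.extend_apply]

/-- The composite with `toV` preserves degrees and is onto, hence injective; as `toV` is onto, `ofV`
is injective too. -/
theorem ofV_injective : Function.Injective (ofV lam) := by
  have h : Function.Injective (((ofV lam).restrictScalars Kqt) ∘ₗ toV lam) := by
    apply injective_of_graded (ofV_surjective.comp toV_surjective)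
    intro τ
    rw [LinearMap.comp_apply, toV, Module.Basis.constr_basis]
    by_cases hτ : ∃ p, PSYT.ofExponents p = τ
    · obtain ⟨p, rfl⟩ := hτ
      rw [PSYT.ofExponents_injective.extend_apply, PSYT.deg_ofExponents]
      exact ofV_monVec_mem p
    · rw [Function.extend_apply' _ _ _ hτ]
      rw [Pi.zero_apply, map_zero]
      exact zero_mem _
  intro v w hvw
  obtain ⟨x, rfl⟩ := toV_surjective v
  obtain ⟨y, rfl⟩ := toV_surjective w
  rw [h hvw]

end Model

/-- The induced module is isomorphic to the model. -/
def equivModel (lam : YoungDiagram) : V lam ≃ₗ[Daha lam.card] Model lam :=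
  LinearEquiv.ofBijective (Model.ofV lam) ⟨Model.ofV_injective, Model.ofV_surjective⟩

/-- This makes every U_T nonzero. The boxes are numbered by decreasing value of `T`, with ties
broken by row + column, which strictly increases along rows and columns. -/
theorem exists_toRYT_eq {lam : YoungDiagram} (T : RYT lam) : ∃ τ : PSYT lam, τ.toRYT = T := by
  have hcard : Fintype.card (Box lam) = lam.card := Fintype.card_coe _
  let ε : Box lam ≃ Fin lam.card := Fintype.equivFinOfCardEq hcard
  let key : Box lam → ℕᵒᵈ ×ₗ ℕ := fun b => toLex (OrderDual.toDual (T.toFun b), b.1.1 + b.1.2)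
  let σ := Tuple.sort (key ∘ ε.symm)
  have hσ : Monotone ((key ∘ ε.symm) ∘ σ) := Tuple.monotone_sort _
  have hlt : ∀ b b', key b < key b' → σ.symm (ε b) < σ.symm (ε b') := by
    intro b b' h
    by_contra! hcon
    have := hσ hcon
    simp only [Function.comp, Equiv.apply_symm_apply, Equiv.symm_apply_apply] at this
    exact absurd h (not_lt.mpr this)
  refine ⟨⟨fun b => (σ.symm (ε b), T.toFun b), σ.symm.bijective.comp ε.bijective, ?_⟩, ?_⟩
  · intro b b' h
    rcases (T.anti b b' h).lt_or_eq with h1 | h1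
    · exact Or.inl h1
    · refine Or.inr ⟨h1.symm, hlt b b' ?_⟩
      rw [Prod.Lex.toLex_lt_toLex]
      refine Or.inr ⟨by rw [h1], ?_⟩
      rcases h with h | h <;> simp only <;> omega
  · rfl

theorem PSYT.weight_eq {lam : YoungDiagram} (τ : PSYT lam) (i : Fin lam.card) :
    τ.weight i = wt (τ.d i) := rfl

theorem PSYT.weight_injective {lam : YoungDiagram} :
    Function.Injective (PSYT.weight (lam := lam)) := by
  intro τ τ' h
  apply PSYT.d_injective
  funext i
  apply wt_injective
  rw [← PSYT.weight_eq, ← PSYT.weight_eq, h]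

/-! ### Invertibility of π, joint eigenvectors of the θ_i, and blocks of fixed exponents in the
model. -/

namespace Model

variable {lam : YoungDiagram}

theorem isUnit_thetaOp (i : Fin lam.card) : IsUnit (thetaOp (lam := lam) i) := by
  refine ⟨⟨thetaOp i, e.constr Kqt fun τ => (wt (τ.d i))⁻¹ • e τ, ?_, ?_⟩, rfl⟩
  all_goals
    refine e.ext fun τ => ?_
    rw [Module.End.mul_apply]
    simp only [Module.Basis.constr_basis, map_smul, thetaOp_e, smul_smul]
    simp [wt_ne_zero]

theorem isUnit_sSeq {i : ℕ} (hi : i < lam.card - 1) : IsUnit (sSeq lam i) := by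
  have h := intertwinerData lam
  refine ⟨⟨sSeq lam i, t⁻¹ • (sSeq lam i - (t - 1) • 1), ?_, ?_⟩, rfl⟩
  · rw [mul_smul_comm, h.s_mul_t hi, smul_smul, inv_mul_cancel₀ t_ne_zero, one_smul]
  · rw [smul_mul_assoc, h.t_mul_s hi, smul_smul, inv_mul_cancel₀ t_ne_zero, one_smul]

theorem act_pi (h : 0 < lam.card) : act lam (piElt Daha.T Daha.θ) =
    IntertwinerData.pi (lam.card - 1) (sSeq lam) (thetaSeq lam) := by
  rw [map_piElt, ← IntertwinerData.piElt_eq h]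
  congr 1
  · funext i; exact act_mk (.T i)
  · funext i; exact act_mk (.θ i)

theorem isUnit_act_pi : IsUnit (act lam (piElt Daha.T Daha.θ)) := by
  by_cases h : 0 < lam.card
  · rw [act_pi h]
    have : ∀ k ≤ lam.card - 1, IsUnit (upProd (sSeq lam) k) := by
      intro k
      induction k with
      | zero => exact fun _ => isUnit_one
      | succ k ih => exact fun hk => (ih (by omega)).mul (isUnit_sSeq hk)
    refine IsUnit.mul ?_ (this _ le_rfl)
    rw [thetaSeq, dif_pos h]
    exact isUnit_thetaOp _
  · rw [piElt, dif_neg h, map_one]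
    exact isUnit_one

theorem tinv_T_smul (i : Fin (lam.card - 1)) (v : Model lam) :
    (t • tinv (Daha.T i : Daha lam.card)) • v = sOp i v := by
  rw [smul_def, map_smul, map_tinv, Daha.T, act_mk, genOp, tinv_sub, smul_smul,
    mul_inv_cancel₀ t_ne_zero, one_smul, sSeq_val]

theorem thetaOp_repr (i : Fin lam.card) (v : Model lam) (σ : PSYT lam) :
    e.repr (thetaOp i v) σ = wt (σ.d i) * e.repr v σ := by
  classical
  have : e.coord σ ∘ₗ thetaOp i = wt (σ.d i) • e.coord σ := by
    refine e.ext fun ρ => ?_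
    rw [LinearMap.comp_apply, thetaOp_e, map_smul, LinearMap.smul_apply,
      Module.Basis.coord_apply, Module.Basis.repr_self, Finsupp.single_apply]
    split_ifs with h
    · rw [h]
    · simp
  exact LinearMap.congr_fun this v

/-- A subspace stable under all `θ_i` contains the tableaux in the support of its elements. -/
theorem e_mem_of_thetaOp_mem {M : Submodule Kqt (Model lam)}
    (hM : ∀ i, ∀ v ∈ M, thetaOp i v ∈ M) {v : Model lam} (hv : v ∈ M) {τ : PSYT lam}
    (hτ : e.repr v τ ≠ 0) : e τ ∈ M := by
  classical
  induction hN : (e.repr v).support.card using Nat.strong_induction_on generalizing v with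
  | _ N ih =>
    by_cases hex : ∃ σ ≠ τ, e.repr v σ ≠ 0
    · obtain ⟨σ, hne, hσ⟩ := hex
      obtain ⟨i, hi⟩ : ∃ i, τ.d i ≠ σ.d i := by
        by_contra! h
        exact hne (PSYT.d_injective (funext fun i => (h i).symm))
      have hr : ∀ ρ, e.repr (thetaOp i v - wt (σ.d i) • v) ρ =
          (wt (ρ.d i) - wt (σ.d i)) * e.repr v ρ := by
        intro ρ
        rw [map_sub, Finsupp.sub_apply, thetaOp_repr, map_smul, Finsupp.smul_apply, smul_eq_mul, sub_mul]
      -- Applying θ_i minus the weight of σ removes σ from the support and rescales the coefficient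
      -- of τ by a nonzero factor.
      refine ih _ ?_ (sub_mem (hM i v hv) (M.smul_mem (wt (σ.d i)) hv)) ?_ rfl
      · rw [← hN]
        apply Finset.card_lt_card
        rw [Finset.ssubset_iff_of_subset]
        · refine ⟨σ, Finsupp.mem_support_iff.mpr hσ, ?_⟩
          rw [Finsupp.notMem_support_iff, hr, sub_self, zero_mul]
        · intro ρ hρ
          rw [Finsupp.mem_support_iff, hr] at hρ
          exact Finsupp.mem_support_iff.mpr (right_ne_zero_of_mul hρ)
      · rw [hr]
        exact mul_ne_zero (wt_sub_ne_zero hi) hτ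
    · push Not at hex
      have : v = e.repr v τ • e τ := by
        apply e.repr.injective
        ext σ
        rw [map_smul, Module.Basis.repr_self, Finsupp.smul_apply, Finsupp.single_apply]
        split_ifs with h
        · rw [h, smul_eq_mul, mul_one]
        · rw [hex σ (Ne.symm h), smul_zero]
      rw [this] at hv
      exact (M.smul_mem_iff hτ).mp hv

/-- The span of the tableaux whose exponents lie in `s`. -/
def block (s : Set (RYT lam)) : Submodule Kqt (Model lam) :=
  Submodule.span Kqt (e '' {τ | τ.toRYT ∈ s})

theorem mem_block {s : Set (RYT lam)} {v : Model lam} :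
    v ∈ block s ↔ ∀ τ, e.repr v τ ≠ 0 → τ.toRYT ∈ s := by
  rw [block, Module.Basis.mem_span_image]
  constructor
  · intro h τ hτ
    exact h (Finsupp.mem_support_iff.mpr hτ)
  · intro h τ hτ
    exact h τ (Finsupp.mem_support_iff.mp hτ)

theorem e_mem_block {s : Set (RYT lam)} {τ : PSYT lam} (h : τ.toRYT ∈ s) : e τ ∈ block s :=
  Submodule.subset_span ⟨τ, h, rfl⟩

theorem apply_mem_block {f : Module.End Kqt (Model lam)} {s : Set (RYT lam)}
    (h : ∀ τ : PSYT lam, τ.toRYT ∈ s → f (e τ) ∈ block s) {v : Model lam} (hv : v ∈ block s) :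
    f v ∈ block s := by
  have : block s ≤ (block s).comap f := by
    conv_lhs => rw [block]
    rw [Submodule.span_le]
    rintro _ ⟨τ, hτ, rfl⟩
    exact h τ hτ
  exact this hv

theorem incl_smul_mem_block (s : Set (RYT lam)) (a : Aff lam.card) :
    ∀ v ∈ block s, incl lam.card a • v ∈ block s := by
  induction a using Aff.induction with
  | alg k =>
    intro v hv
    rw [AlgHom.commutes, algebraMap_smul]
    exact Submodule.smul_mem _ _ hv
  | T i =>
    intro v hv
    rw [incl_T, T_smul]
    refine sub_mem (apply_mem_block (fun τ hτ => ?_) hv) (Submodule.smul_mem _ _ hv)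
    rw [(wt_e τ).s, interOp_e]
    exact sub_mem (Submodule.smul_mem _ _ (e_mem_block (by rwa [PSYT.sw_toRYT])))
      (Submodule.smul_mem _ _ (e_mem_block hτ))
  | θ i =>
    intro v hv
    rw [incl_θ, theta_smul]
    refine apply_mem_block (fun τ hτ => ?_) hv
    rw [thetaOp_e]
    exact Submodule.smul_mem _ _ (e_mem_block hτ)
  | mul a b ha hb =>
    intro v hv
    rw [map_mul, mul_smul]
    exact ha _ (hb _ hv)
  | add a b ha hb =>
    intro v hv
    rw [map_add, add_smul]
    exact add_mem (ha _ hv) (hb _ hv)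

end Model

open Model

/-! ### Transfer to V_λ: the basis, the direct sum and irreducibility. -/

section Transport

variable {lam : YoungDiagram}

theorem equivModel_aff_smul (a : Aff lam.card) (v : V lam) :
    equivModel lam (a • v) = incl lam.card a • equivModel lam v :=
  (equivModel lam).map_smul (incl lam.card a) v

theorem equivModel_K_smul (k : Kqt) (v : V lam) :
    equivModel lam (k • v) = k • equivModel lam v :=
  ((equivModel lam).restrictScalars Kqt).map_smul k v

theorem equivModel_tmul (σ : SYT lam) :
    equivModel lam (V.tmul 1 (Specht.vec σ)) = e σ.toPSYT := by
  refine (ofV_tmul 1 (Specht.vec σ)).trans ?_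
  rw [spechtMap_vec, one_smul]

theorem pi_bijective (lam : YoungDiagram) :
    Function.Bijective (fun v : V lam => Aff.pi lam.card • v) := by
  have h := (Module.End.isUnit_iff _).mp (isUnit_act_pi (lam := lam))
  have h2 : (fun v : V lam => Aff.pi lam.card • v) =
      (equivModel lam).symm ∘ (act lam (piElt Daha.T Daha.θ)) ∘ equivModel lam := by
    funext v
    rw [Function.comp_apply, LinearEquiv.eq_symm_apply, equivModel_aff_smul, V.incl_pi]
    rfl
  rw [h2]
  exact (equivModel lam).symm.bijective.comp (h.comp (equivModel lam).bijective)

/-- The basis `F_τ`. -/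
def macdonaldBasis (lam : YoungDiagram) : Module.Basis (PSYT lam) Kqt (V lam) :=
  e.map ((equivModel lam).restrictScalars Kqt).symm

theorem equivModel_macdonaldBasis (τ : PSYT lam) :
    equivModel lam (macdonaldBasis lam τ) = e τ := by
  rw [macdonaldBasis, Module.Basis.map_apply]
  exact (equivModel lam).apply_symm_apply (e τ)

theorem isMacdonaldBasis_macdonaldBasis (lam : YoungDiagram) :
    IsMacdonaldBasis (macdonaldBasis lam) where
  weight τ i := by
    apply (equivModel lam).injective
    rw [equivModel_aff_smul, equivModel_K_smul, equivModel_macdonaldBasis, incl_θ, theta_smul,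
      thetaOp_e, PSYT.weight_eq]
  weight_injective := PSYT.weight_injective
  standard σ := by
    apply (equivModel lam).injective
    rw [equivModel_macdonaldBasis, equivModel_tmul]
  swap i τ τ' h := by
    rw [PSYT.swapUp_iff] at h
    apply (equivModel lam).injective
    rw [map_add, equivModel_aff_smul, equivModel_K_smul, equivModel_macdonaldBasis,
      equivModel_macdonaldBasis, map_smul, map_tinv, incl_T, tinv_T_smul, (wt_e τ).s, interOp_e,
      gam_of_up h.1, one_smul, ← h.2]
    simp only [PSYT.weight_eq]
    rw [← kap, sub_add_cancel]
  psi τ i j hi hj v hv := by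
    have h0 : 0 < lam.card := i.pos
    have hv' := congrArg (equivModel lam) hv
    rw [equivModel_aff_smul, equivModel_macdonaldBasis, V.incl_pi, smul_def, act_pi h0] at hv'
    apply (equivModel lam).injective
    -- Since X_n = Qπ, the vector X_n v is Q applied to `e τ`, and the prescribed power of q cancels
    -- the one in `qOp`.
    rw [equivModel_K_smul, LinearEquiv.map_smul, X_smul, xOp,
      show j.1 = lam.card - 1 by omega, (intertwinerData lam).xSeq_last, Module.End.mul_apply, hv',
      qOp_e, equivModel_macdonaldBasis, firstExp, dif_pos h0,
      show (⟨0, h0⟩ : Fin lam.card) = i from Fin.ext hi.symm, PSYT.d,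
      smul_inv_smul₀ (pow_ne_zero _ q_ne_zero)]

/-- The vectors of `V_λ` that correspond to `block s`. -/
def blockV (s : Set (RYT lam)) : Submodule (Aff lam.card) (V lam) where
  carrier := {v | equivModel lam v ∈ block s}
  add_mem' h h' := by
    rw [Set.mem_ofPred_eq, map_add]
    exact add_mem h h'
  zero_mem' := by
    rw [Set.mem_ofPred_eq, map_zero]
    exact zero_mem _
  smul_mem' a v h := by
    rw [Set.mem_ofPred_eq, equivModel_aff_smul]
    exact incl_smul_mem_block s a _ h

theorem mem_blockV {s : Set (RYT lam)} {v : V lam} :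
    v ∈ blockV s ↔ equivModel lam v ∈ block s := Iff.rfl

/-- Only the eigenvalues of F_τ are used: joint eigenspaces are one-dimensional. This is why the
decomposition is the same for every admissible basis. -/
theorem IsMacdonaldBasis.exists_eq_smul {F : Module.Basis (PSYT lam) Kqt (V lam)}
    (hF : IsMacdonaldBasis F) (τ : PSYT lam) :
    ∃ k : Kqt, k ≠ 0 ∧ equivModel lam (F τ) = k • e τ := by
  classical
  have h1 : ∀ σ i, wt (σ.d i) * e.repr (equivModel lam (F τ)) σ =
      wt (τ.d i) * e.repr (equivModel lam (F τ)) σ := by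
    intro σ i
    have h2 := congrArg (equivModel lam) (hF.weight τ i)
    rw [equivModel_aff_smul, equivModel_K_smul, incl_θ, theta_smul, PSYT.weight_eq] at h2
    have h3 := congrArg (fun v => e.repr v σ) h2
    simp only [map_smul, Finsupp.smul_apply, smul_eq_mul] at h3
    rw [← h3, thetaOp_repr]
  have h2 : equivModel lam (F τ) = e.repr (equivModel lam (F τ)) τ • e τ := by
    apply e.repr.injective
    ext σ
    rw [map_smul, Module.Basis.repr_self, Finsupp.smul_apply, Finsupp.single_apply]
    split_ifs with h
    · rw [h, smul_eq_mul, mul_one]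
    · rw [smul_zero]
      by_contra h0
      refine h (PSYT.d_injective (funext fun i => wt_injective ?_))
      exact (mul_right_cancel₀ h0 (h1 σ i)).symm
  refine ⟨_, fun h0 => ?_, h2⟩
  rw [h0, zero_smul, map_eq_zero_iff _ (equivModel lam).injective] at h2
  exact F.ne_zero τ h2

theorem IsMacdonaldBasis.restrictScalars_blockV {F : Module.Basis (PSYT lam) Kqt (V lam)}
    (hF : IsMacdonaldBasis F) (T : RYT lam) :
    (blockV {T}).restrictScalars Kqt = Submodule.span Kqt (F '' {τ | τ.toRYT = T}) := by
  apply le_antisymm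
  · intro v hv
    have h1 : block {T} ≤ (Submodule.span Kqt (F '' {τ | τ.toRYT = T})).comap
        (((equivModel lam).restrictScalars Kqt).symm : Model lam →ₗ[Kqt] V lam) := by
      rw [block, Submodule.span_le]
      rintro _ ⟨τ, hτ, rfl⟩
      obtain ⟨k, hk, hτ'⟩ := hF.exists_eq_smul τ
      have h2 : ((equivModel lam).restrictScalars Kqt).symm (e τ) = k⁻¹ • F τ := by
        rw [LinearEquiv.symm_apply_eq, map_smul]
        refine Eq.trans ?_ (congrArg (k⁻¹ • ·) hτ'.symm)
        rw [smul_smul, inv_mul_cancel₀ hk, one_smul]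
      show ((equivModel lam).restrictScalars Kqt).symm (e τ) ∈
        Submodule.span Kqt (F '' {τ | τ.toRYT = T})
      rw [h2]
      exact Submodule.smul_mem _ _ (Submodule.subset_span ⟨τ, hτ, rfl⟩)
    have h3 := h1 (mem_blockV.mp hv)
    have h4 : ((equivModel lam).restrictScalars Kqt).symm (equivModel lam v) = v :=
      (equivModel lam).symm_apply_apply v
    change ((equivModel lam).restrictScalars Kqt).symm (equivModel lam v) ∈
      Submodule.span Kqt (F '' {τ | τ.toRYT = T}) at h3
    rwa [h4] at h3
  · rw [Submodule.span_le]
    rintro _ ⟨τ, hτ, rfl⟩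
    obtain ⟨k, -, hτ'⟩ := hF.exists_eq_smul τ
    show equivModel lam (F τ) ∈ block {T}
    rw [hτ']
    exact Submodule.smul_mem _ _ (e_mem_block hτ)

theorem isInternal_blockV (lam : YoungDiagram) :
    DirectSum.IsInternal fun T : RYT lam => blockV {T} := by
  rw [DirectSum.isInternal_submodule_iff_iSupIndep_and_iSup_eq_top]
  constructor
  · intro T
    -- All other blocks lie in the span of the tableaux with exponents different from `T`, whose
    -- support is disjoint from that of `blockV {T}`.
    have h1 : ⨆ (T') (_ : T' ≠ T), blockV {T'} ≤ blockV {T}ᶜ := by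
      refine iSup₂_le fun T' hT' v hv => ?_
      rw [mem_blockV, mem_block] at hv ⊢
      intro τ hτ h
      exact hT' ((hv τ hτ).symm.trans h)
    refine Disjoint.mono_right h1 ?_
    rw [Submodule.disjoint_def]
    intro v hv hv'
    rw [mem_blockV, mem_block] at hv hv'
    apply (map_eq_zero_iff _ (equivModel lam).injective).mp
    apply e.repr.injective
    ext τ
    rw [map_zero, Finsupp.zero_apply]
    by_contra h
    exact hv' τ h (hv τ h)
  · rw [eq_top_iff]
    rintro v -
    have hw : equivModel lam v ∈ Submodule.span Kqt (Set.range (e (lam := lam))) := by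
      rw [e.span_eq]; trivial
    have key : ∀ w ∈ Submodule.span Kqt (Set.range (e (lam := lam))),
        (equivModel lam).symm w ∈ ⨆ T : RYT lam, blockV {T} := by
      intro w hw
      induction hw using Submodule.span_induction with
      | mem w hw =>
        obtain ⟨τ, rfl⟩ := hw
        refine Submodule.mem_iSup_of_mem τ.toRYT ?_
        rw [mem_blockV, LinearEquiv.apply_symm_apply]
        exact e_mem_block rfl
      | zero => rw [map_zero]; exact zero_mem _
      | add v w _ _ hv hw => rw [map_add]; exact add_mem hv hw
      | smul k v _ hv =>
        -- The supremum is one of 𝒜_n-submodules, so the scalar has to act through 𝒜_n.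
        have : (equivModel lam).symm (k • v) =
            algebraMap Kqt (Aff lam.card) k • (equivModel lam).symm v := by
          rw [LinearEquiv.symm_apply_eq, equivModel_aff_smul, AlgHom.commutes, algebraMap_smul,
            LinearEquiv.apply_symm_apply]
        rw [this]
        exact Submodule.smul_mem _ _ hv
    have := key _ hw
    rwa [LinearEquiv.symm_apply_apply] at this

/-- A nonzero submodule is stable under the θ_i, so it contains a basis vector; `mem_of_sOp_mem`
then carries it along exchanges to all tableaux with the same exponents. -/
theorem isSimpleModule_blockV (T : RYT lam) :
    IsSimpleModule (Aff lam.card) (blockV (lam := lam) {T}) := by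
  rw [isSimpleModule_iff_isAtom]
  constructor
  · intro h
    obtain ⟨τ, rfl⟩ := exists_toRYT_eq T
    have h1 : (equivModel lam).symm (e τ) ∈ blockV {τ.toRYT} := by
      rw [mem_blockV, LinearEquiv.apply_symm_apply]
      exact e_mem_block rfl
    rw [h, Submodule.mem_bot, LinearEquiv.map_eq_zero_iff] at h1
    exact e.ne_zero τ h1
  · intro N hN
    by_contra hne
    obtain ⟨v, hv, hv0⟩ := N.ne_bot_iff.mp hne
    refine hN.not_ge ?_
    let M : Submodule Kqt (Model lam) := (N.restrictScalars Kqt).comap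
      (((equivModel lam).restrictScalars Kqt).symm : Model lam →ₗ[Kqt] V lam)
    have mem_M : ∀ w, w ∈ M ↔ (equivModel lam).symm w ∈ N := fun w => Iff.rfl
    have hM : ∀ (a : Aff lam.card), ∀ w ∈ M, incl lam.card a • w ∈ M := by
      intro a w hw
      rw [mem_M] at hw ⊢
      rw [LinearEquiv.map_smul]
      exact N.smul_mem a hw
    have hvM : equivModel lam v ∈ M := by
      rw [mem_M, LinearEquiv.symm_apply_apply]; exact hv
    obtain ⟨τ, hτ⟩ : ∃ τ, e.repr (equivModel lam v) τ ≠ 0 := by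
      by_contra! h
      apply hv0
      apply (map_eq_zero_iff _ (equivModel lam).injective).mp
      apply e.repr.injective
      ext τ
      rw [h, map_zero, Finsupp.zero_apply]
    have hτM : e τ ∈ M := by
      refine e_mem_of_thetaOp_mem (fun i w hw => ?_) hvM hτ
      have := hM (Aff.θ i) w hw
      rwa [incl_θ, theta_smul] at this
    have hτT : τ.toRYT = T := mem_block.mp (hN.le hv) τ hτ
    have hall : ∀ σ : PSYT lam, σ.toRYT = T → e σ ∈ M := by
      intro σ hσ
      refine PSYT.induction_sw (P := fun σ => e σ ∈ M) (fun i ρ hρ => ?_) (hτT.trans hσ.symm) hτM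
      refine mem_of_sOp_mem hρ (sOp_mem_of_T hρ ?_)
      have := hM (Aff.T i) _ hρ
      rwa [incl_T] at this
    have hle : block {T} ≤ M := by
      rw [block, Submodule.span_le]
      rintro _ ⟨σ, hσ, rfl⟩
      exact hall σ hσ
    intro w hw
    have := hle (mem_blockV.mp hw)
    rwa [mem_M, LinearEquiv.symm_apply_apply] at this

end Transport

end MackeyDAHA

end

theorem mainTheorem11 (lam : YoungDiagram) :
    Function.Bijective
      (fun v : MackeyDAHA.V lam => MackeyDAHA.Aff.pi lam.card • v) ∧
    (∃ F : Module.Basis (MackeyDAHA.PSYT lam) MackeyDAHA.Kqt (MackeyDAHA.V lam),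
      MackeyDAHA.IsMacdonaldBasis F) ∧
    ∀ F : Module.Basis (MackeyDAHA.PSYT lam) MackeyDAHA.Kqt (MackeyDAHA.V lam),
      MackeyDAHA.IsMacdonaldBasis F →
      ∃ U : MackeyDAHA.RYT lam →
          Submodule (MackeyDAHA.Aff lam.card) (MackeyDAHA.V lam),
        (∀ T, (U T).restrictScalars MackeyDAHA.Kqt =
          Submodule.span MackeyDAHA.Kqt (F '' {τ | τ.toRYT = T})) ∧
        DirectSum.IsInternal U ∧
        ∀ T, IsSimpleModule (MackeyDAHA.Aff lam.card) (U T) :=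
  ⟨MackeyDAHA.pi_bijective lam,
    ⟨MackeyDAHA.macdonaldBasis lam, MackeyDAHA.isMacdonaldBasis_macdonaldBasis lam⟩,
    fun _ hF => ⟨fun T => MackeyDAHA.blockV {T}, fun T => hF.restrictScalars_blockV T,
      MackeyDAHA.isInternal_blockV lam, MackeyDAHA.isSimpleModule_blockV⟩⟩
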